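/- **Setting.** For $k\mid n$ let $G_{n,k}$ be the graph on $n$ nodes consisting of $n/k$ cliques $C_1,\dots,C_{n/k}$ of size $k$, in which any two consecutive cliques are joined by a perfect matching, so that the matchings form $k$ disjoint paths from $C_1$ to $C_{n/k}$. Each node $u$ initially holds one message $m_u$. Time proceeds in synchronous rounds $0,1,2,\dots$; in each round a working node may send one message, the same to all its neighbours. Nodes fail independently: each node fails in each round with probability $q$ and never recovers (from the round in which it fails, it neither sends nor receives); links are reliable. **Algorithm.** Let $\alpha,d>0$ and $0<\hat c\le\frac12$ be constants, $\tau=\lceil\alpha\log_2 n\rceil$, $\tau'=\lceil 8d\,\tau\log_2^2 n\rceil$, $T=\tau/2$. A node $u$ keeps the set $R_u$ of messages it knows (initially $\{m_u\}$), the set $S_u$ of messages it has sent outside shuffle phases, $B_u=R_u\setminus S_u$, and counters $\mathrm{cnt}_{u,v}$ of the receptions of $m_v$ outside shuffle phases (initially $1$ for $v=u$ and $0$ otherwise). A message $m_v\in R_u$ is *fresh* for $u$ if $\mathrm{cnt}_{u,v}<T$. * Round 0: $u$ sends $m_u$. * Random phase ($\tau$ rounds): a buffer $\hat B_u$ is set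 to $B_u$ at the start; in each round $u$ removes a uniformly random message from $\hat B_u$ and sends it. * Then, for $p=1,2,\dots$, ranking phase $p$ is followed by shuffle phase $p$. * Ranking phase ($\tau'$ rounds): at the start, $\hat B_u$ is set to $B_u$ in the first ranking phase, and in later ranking phases to the messages of $B_u$ that were selected at the end of the preceding shuffle phase or are not fresh. $\hat B_u$ is sorted with the selected messages first and then by increasing $\mathrm{cnt}$, ties being broken arbitrarily; the message of rank $r$ gets weight $1/r$. In each round $u$ draws a message from $\hat B_u$ with probability proportional to its weight among the messages that remain there, removes it and sends it. In the random phase and in ranking phases a node with $\hat B_u=\emptyset$ sends nothing. * Shuffle phase ($8\tau$ rounds): at the start, $\hat B_u$ is set to the fresh messages of $B_u$, and $\mathrm{phasecnt}_{u,v}$ to $1$ for these and $0$ for the others. In each round $u$ removes an arbitrary message from $\hat B_u$ and sends it (it sends $m_u$ if $\hat B_u=\emptyset$), and increases $\mathrm{phasecnt}_{u,v}$ by one for each reception of $m_v$; $R_u$, $S_u$ and $\mathrm{cnt}$ do not change. At the end, let $Q_u$ be the set of messages with $\mathrm{phasecnt}_{u,v}\ge\hat cT$, $\mathrm{phasecnt}_{u,v}>0$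 and $\mathrm{cnt}_{u,v}<T$. The node adds $Q_u$ to $R_u$ and selects a uniformly random subset of $\min(4\tau,|Q_u|)$ messages of $Q_u$. All random choices are independent across nodes and of the failures. The choices left arbitrary may depend on the node, the round and the node's local state. Let $\tau_e=1+\tau+(\frac nk-1)(\tau'+8\tau)+\tau'$ be the number of rounds up to the end of ranking phase $n/k$. **Theorem.** For every $c\ge1$ there are $\alpha_0,d_0$ such that for all constants $\alpha\ge\alpha_0$, $d\ge d_0$ and $0<\hat c\le\frac12$ there is a constant $C>0$ with the following property. Let $k=k(n)=\omega(\log^3 n)$. Then for all sufficiently large $n$ with $k\mid n$: 1. $\tau_e\le C\,\dfrac{n\log^3 n}{k}$ (so $\frac1{32\tau_e}\ge \frac{1}{32C}\cdot\frac{k}{n\log^3 n}$); 2. for every failure probability $0\le q\le\frac{1}{32\tau_e}$ and however the arbitrary choices are made, the algorithm on $G_{n,k}$ completes information spreading within $\tau_e$ rounds with probability at least $1-n^{-c}$; that is, after $\tau_e$ rounds every node that has not failed knows $m_v$ for every node $v$ that did not fail before sending $m_v$ in round 0. -/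

import Mathlib

open Filter
open scoped ENNReal Topology

namespace VertexCongest

noncomputable section

/-! ### Finite product distributions -/

/-- Independent choices: the coordinate `x v` of a sample `x` has law `f v`, and the coordinates
are independent. -/
def pmfPi {ι β : Type*} [Fintype ι] [DecidableEq ι] [Fintype β] (f : ι → PMF β) :
    PMF (ι → β) :=
  PMF.ofFintype (fun x => ∏ i, f i (x i)) (by
    rw [← Fintype.prod_sum]
    refine Finset.prod_eq_one fun i _ => ?_
    have h := (f i).tsum_coe
    rwa [tsum_fintype] at h)

/-- A coin that shows `true` with probability `q`. -/
def coin (q : unitInterval) : PMF Bool :=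
  PMF.ofFintype (fun b => cond b (ENNReal.ofReal (q : ℝ)) (ENNReal.ofReal (1 - (q : ℝ)))) (by
    rw [Fintype.sum_bool, cond_true, cond_false,
      ← ENNReal.ofReal_add q.2.1 (sub_nonneg.2 q.2.2)]
    simp)

/-- Run the random transition `f` `N` times. -/
def iterate {α : Type*} (f : α → PMF α) : ℕ → α → PMF α
  | 0, a => PMF.pure a
  | N + 1, a => (f a).bind (iterate f N)

/-! ### Local states -/

/-- The parameters of the algorithm. -/
structure Params where
  /-- the length `τ` of the random phase -/
  tau : ℕ
  /-- the length `τ'` of a ranking phase -/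
  tau' : ℕ
  /-- the constant `ĉ` of the filter of the shuffle phases -/
  cHat : ℝ

/-- The freshness threshold `T = τ / 2`. -/
def Params.T (P : Params) : ℝ := (P.tau : ℝ) / 2

/-- `τ = α log n`, `τ' = 8 d τ log² n` (binary logarithms, rounded up). -/
def params (α d cHat : ℝ) (n : ℕ) : Params where
  tau := ⌈α * Real.logb 2 n⌉₊
  tau' := ⌈8 * d * (⌈α * Real.logb 2 n⌉₊ : ℝ) * (Real.logb 2 n) ^ 2⌉₊
  cHat := cHat

/-- The local state of a node. The message `m_v` is identified with its origin `v`. -/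
structure NodeState (V : Type*) where
  /-- `R_u`: the known messages -/
  R : Finset V
  /-- `S_u`: the messages sent in round 0, in the random phase and in ranking phases -/
  S : Finset V
  /-- `cnt_{u,v}`: how often `m_v` was received (shuffle phases use `phasecnt` instead) -/
  cnt : V → ℕ
  /-- the working buffer of the current phase -/
  hatB : Finset V
  /-- the message `m` has weight `1 / (pos m + 1)` in the current phase -/
  pos : V → ℕ
  /-- `phasecnt_{u,v}`: the counters of the current shuffle phase -/
  phasecnt : V → ℕ
  /-- the messages selected at the end of the last shuffle phase (`none` before the first one) -/
  sel : Option (Finset V)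

/-- How the choices are made that the algorithm leaves open: ties in the sorting step are broken,
and the next message of a shuffle phase is popped, in the increasing order of an arbitrary
injective key. The key may depend on the node, the round, and the whole local state. -/
structure Rules (V : Type*) where
  tie : V → ℕ → NodeState V → (V ↪ ℕ)
  pop : V → ℕ → NodeState V → (V ↪ ℕ)

section Algorithm

variable {V : Type*} [Fintype V] [DecidableEq V]

/-- The initial state of node `u`. -/
def initState (u : V) : NodeState V where
  R := {u}
  S := ∅
  cnt := fun v => if v = u then 1 else 0
  hatB := ∅
  pos := fun _ => 0
  phasecnt := fun _ => 0
  sel := none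

/-- `B_u = R_u - S_u`. -/
def NodeState.B (s : NodeState V) : Finset V := s.R \ s.S

/-- Start of the random phase: the buffer is `B_u`, and all weights are equal. -/
def NodeState.startRandom (s : NodeState V) : NodeState V :=
  { s with hatB := s.B, pos := fun _ => 0 }

open Classical in
/-- The buffer at the start of a ranking phase. The first ranking phase starts with all of `B_u`.
After a shuffle phase, the only fresh messages to start with are the selected ones. -/
def NodeState.rankingBuffer (P : Params) (s : NodeState V) : Finset V :=
  match s.sel with
  | none => s.B
  | some A => s.B.filter fun m => m ∈ A ∨ P.T ≤ (s.cnt m : ℝ)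

/-- The order of the ranking list: selected messages first, then by increasing `cnt`,
ties being broken by `key`. -/
def NodeState.Precedes (s : NodeState V) (key : V ↪ ℕ) (m m' : V) : Prop :=
  let a : V → ℕ := fun x => if x ∈ s.sel.getD ∅ then 0 else 1
  a m < a m' ∨ (a m = a m' ∧
    (s.cnt m < s.cnt m' ∨ (s.cnt m = s.cnt m' ∧ key m < key m')))

open Classical in
/-- Start of a ranking phase: `pos m + 1` is the position of `m` in the sorted buffer, so the
message of rank `r` gets probability `1 / (r H_b)`, where `b` is the size of the buffer. -/
def NodeState.startRanking (P : Params) (key : V ↪ ℕ) (s : NodeState V) : NodeState V :=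
  { s with
    hatB := s.rankingBuffer P
    pos := fun m => ((s.rankingBuffer P).filter fun m' => s.Precedes key m' m).card }

open Classical in
/-- Start of a shuffle phase: the buffer consists of the fresh messages of `B_u`,
that is, those with `cnt < T`. -/
def NodeState.startShuffle (P : Params) (s : NodeState V) : NodeState V :=
  let F := s.B.filter fun m => (s.cnt m : ℝ) < P.T
  { s with hatB := F, phasecnt := fun m => if m ∈ F then 1 else 0 }

/-- Pick a message from `B` with probability proportional to `1 / (pos m + 1)`;
nothing is picked from the empty buffer. -/
def draw (B : Finset V) (pos : V → ℕ) : PMF (Option V) :=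
  if h : B.Nonempty then
    (PMF.normalize (fun m => if m ∈ B then ((pos m + 1 : ℕ) : ℝ≥0∞)⁻¹ else 0)
      (by
        obtain ⟨m, hm⟩ := h
        refine fun h0 => ?_
        have h1 := ENNReal.tsum_eq_zero.1 h0 m
        rw [if_pos hm] at h1
        exact ENNReal.natCast_ne_top _ (ENNReal.inv_eq_zero.1 h1))
      (by
        rw [tsum_fintype]
        refine (ENNReal.sum_lt_top.2 fun m _ => ?_).ne
        split_ifs
        · exact ENNReal.inv_lt_top.2 (by exact_mod_cast Nat.succ_pos _)
        · exact ENNReal.zero_lt_top)).map some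
  else PMF.pure none

open Classical in
/-- How many neighbours of `u` send `m_v`, when `out w` is the message sent by `w`. -/
def received (G : SimpleGraph V) (out : V → Option V) (u v : V) : ℕ :=
  (Finset.univ.filter fun w => G.Adj u w ∧ out w = some v).card

open Classical in
/-- The update of the state of `u` in a round of the random phase or of a ranking phase
(and in round 0). -/
def NodeState.sync (G : SimpleGraph V) (out : V → Option V) (u : V) (s : NodeState V) :
    NodeState V :=
  { s with
    R := s.R ∪ Finset.univ.filter fun v => 0 < received G out u v
    S := s.S ∪ (out u).toFinset
    cnt := fun v => s.cnt v + received G out u v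
    hatB := s.hatB \ (out u).toFinset }

/-- The update of the state of `u` in a round of a shuffle phase. -/
def NodeState.syncShuffle (G : SimpleGraph V) (out : V → Option V) (u : V)
    (s : NodeState V) : NodeState V :=
  { s with
    phasecnt := fun v => s.phasecnt v + received G out u v
    hatB := s.hatB \ (out u).toFinset }

open Classical in
/-- The message that `u` sends in a round of a shuffle phase: a message popped from its buffer,
and its own message if the buffer is empty. -/
def shuffleMessage (key : V ↪ ℕ) (u : V) (s : NodeState V) : V :=
  if h : s.hatB.Nonempty then (s.hatB.exists_min_image key h).choose else u

open Classical in
/-- The set `R` that remains at the end of a shuffle phase, after the messages with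
`phasecnt < ĉ T` and those that were already non-fresh before the phase are filtered out. -/
def NodeState.filtered (P : Params) (s : NodeState V) : Finset V :=
  Finset.univ.filter fun m =>
    0 < s.phasecnt m ∧ P.cHat * P.T ≤ (s.phasecnt m : ℝ) ∧ (s.cnt m : ℝ) < P.T

/-- A uniformly random selection of `4 τ` of the remaining messages
(of all of them, if there are fewer). -/
def selection (P : Params) (s : NodeState V) : PMF (Finset V) :=
  PMF.uniformOfFinset
    ((s.filtered P).powersetCard (min (4 * P.tau) (s.filtered P).card))
    (Finset.powersetCard_nonempty.2 (min_le_right _ _))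

/-- The end of a shuffle phase, in which the set `A` was selected. -/
def NodeState.endShuffle (P : Params) (A : Finset V) (s : NodeState V) : NodeState V :=
  { s with R := s.R ∪ s.filtered P, sel := some A }

/-! ### Executions with crash failures -/

/-- A failure schedule for `N` rounds: `F u s = true` means that the failure coin of node `u` in
round `s` shows a failure. -/
abbrev Schedule (V : Type*) (N : ℕ) := V → Fin N → Bool

/-- Node `u` works in round `t`: it failed in none of the rounds `0, …, t`. A node that fails in
round `t` neither sends nor receives from round `t` on. -/
def Alive {N : ℕ} (F : Schedule V N) (u : V) (t : ℕ) : Prop :=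
  ∀ s : Fin N, (s : ℕ) ≤ t → F u s = false

/-- Nodes fail independently, with probability `q` per round. -/
def failures (V : Type*) [Fintype V] [DecidableEq V] (q : unitInterval) (N : ℕ) :
    PMF (Schedule V N) :=
  pmfPi fun _ => pmfPi fun _ => coin q

/-- A configuration: the number of rounds executed so far, and all local states. -/
structure Config (V : Type*) where
  time : ℕ
  st : V → NodeState V

/-- A local computation of every node, which takes no communication round. -/
def Config.locally (f : V → ℕ → NodeState V → NodeState V) (c : Config V) : Config V :=
  { c with st := fun u => f u c.time (c.st u) }

open Classical in
/-- One communication round: the working nodes send the messages `msg` to all their neighbours,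
and the working nodes update their states. -/
def Config.round {N : ℕ} (F : Schedule V N)
    (update : (V → Option V) → V → NodeState V → NodeState V)
    (msg : V → Option V) (c : Config V) : Config V where
  time := c.time + 1
  st := fun u =>
    if Alive F u c.time then
      update (fun w => if Alive F w c.time then msg w else none) u (c.st u)
    else c.st u

variable (G : SimpleGraph V) (P : Params) (ρ : Rules V) {N : ℕ} (F : Schedule V N)

/-- The configuration after round 0, in which every node `u` sends `m_u`. -/
def afterRoundZero : Config V :=
  Config.round F (NodeState.sync G) some ⟨0, initState⟩

/-- A round in which every node independently draws its message from its buffer. -/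
def drawRound (c : Config V) : PMF (Config V) :=
  (pmfPi fun u => draw (c.st u).hatB (c.st u).pos).map fun msg =>
    c.round F (NodeState.sync G) msg

/-- A round of a shuffle phase. -/
def shuffleRound (c : Config V) : Config V :=
  c.round F (NodeState.syncShuffle G) fun u =>
    some (shuffleMessage (ρ.pop u c.time (c.st u)) u (c.st u))

/-- The random phase: `τ` rounds. -/
def randomPhase (c : Config V) : PMF (Config V) :=
  iterate (drawRound G F) P.tau (c.locally fun _ _ => NodeState.startRandom)

/-- A ranking phase: `τ'` rounds. -/
def rankingPhase (c : Config V) : PMF (Config V) :=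
  iterate (drawRound G F) P.tau'
    (c.locally fun u t s => s.startRanking P (ρ.tie u t s))

/-- A shuffle phase: `8 τ` rounds, followed by the independent selections of the nodes. -/
def shufflePhase (c : Config V) : PMF (Config V) :=
  let c' := (shuffleRound G ρ F)^[8 * P.tau] (c.locally fun _ _ => NodeState.startShuffle P)
  (pmfPi fun u => selection P (c'.st u)).map fun A =>
    c'.locally fun u _ s => s.endShuffle P (A u)

/-- Round 0, the random phase, and `p` times a ranking phase followed by a shuffle phase. -/
def beforeRanking : ℕ → PMF (Config V)
  | 0 => randomPhase G P F (afterRoundZero G F)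
  | p + 1 => ((beforeRanking p).bind (rankingPhase G P ρ F)).bind (shufflePhase G P ρ F)

/-- The execution up to the end of ranking phase `p`, for `p ≥ 1`. -/
def execution (p : ℕ) : PMF (Config V) :=
  (beforeRanking G P ρ F (p - 1)).bind (rankingPhase G P ρ F)

end Algorithm

/-- The round number at the end of ranking phase `p`, for `p ≥ 1`. -/
def endTime (P : Params) (p : ℕ) : ℕ :=
  1 + P.tau + (p - 1) * (P.tau' + 8 * P.tau) + P.tau'

/-- The joint law of the failures and of the execution up to the end of ranking phase `p`,
for nodes that fail with probability `q` per round. -/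
def faultyExecution {V : Type*} [Fintype V] [DecidableEq V] (G : SimpleGraph V) (P : Params)
    (ρ : Rules V) (q : unitInterval) (p : ℕ) :
    PMF (Schedule V (endTime P p) × Config V) :=
  (failures V q (endTime P p)).bind fun F => (execution G P ρ F p).map fun c => (F, c)

/-- Information spreading is complete: every node `u` that has not failed knows the message of
every node `v` that did not fail before sending its message in round 0. -/
def SpreadComplete {V : Type*} {N : ℕ} (F : Schedule V N) (c : Config V) : Prop :=
  ∀ u v : V, Alive F u c.time → Alive F v 0 → v ∈ (c.st u).R

/-- The graph `G_{n,k}` for `n = m k`: the node `(i, a)` is the `a`-th node of the `i`-th clique,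
and the matchings join `(i, a)` to `(i + 1, a)`. -/
def cliquePath (m k : ℕ) : SimpleGraph (Fin m × Fin k) where
  Adj x y := (x.1 = y.1 ∧ x.2 ≠ y.2) ∨
    (x.2 = y.2 ∧ ((x.1 : ℕ) + 1 = y.1 ∨ (y.1 : ℕ) + 1 = x.1))
  symm := by
    constructor
    rintro x y (⟨h, h'⟩ | ⟨h, h' | h'⟩)
    · exact Or.inl ⟨h.symm, h'.symm⟩
    · exact Or.inr ⟨h.symm, Or.inr h'⟩
    · exact Or.inr ⟨h.symm, Or.inl h'⟩
  loopless := by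
    constructor
    rintro x (⟨-, h⟩ | ⟨-, h | h⟩)
    · exact h rfl
    · omega
    · omega

/-! ### The number of rounds -/

section Time

variable {V : Type*} [Fintype V] [DecidableEq V] (G : SimpleGraph V) (P : Params)
  (ρ : Rules V) {N : ℕ} (F : Schedule V N)

theorem time_drawRounds (r : ℕ) : ∀ c : Config V,
    ∀ c' ∈ (iterate (drawRound G F) r c).support, c'.time = c.time + r := by
  induction r with
  | zero =>
    intro c c' h
    simp only [iterate, PMF.support_pure, Set.mem_singleton_iff] at h
    simp [h]
  | succ r ih =>
    intro c c' h
    simp only [iterate, PMF.mem_support_bind_iff] at h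
    obtain ⟨c₁, h₁, h₂⟩ := h
    rw [ih c₁ c' h₂]
    simp only [drawRound, PMF.support_map, Set.mem_image] at h₁
    obtain ⟨msg, -, rfl⟩ := h₁
    simp only [Config.round]
    omega

theorem time_shuffleRounds (r : ℕ) : ∀ c : Config V,
    ((shuffleRound G ρ F)^[r] c).time = c.time + r := by
  induction r with
  | zero => intro c; rfl
  | succ r ih =>
    intro c
    rw [Function.iterate_succ_apply, ih]
    simp only [shuffleRound, Config.round]
    omega

theorem time_beforeRanking (p : ℕ) : ∀ c ∈ (beforeRanking G P ρ F p).support,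
    c.time = 1 + P.tau + p * (P.tau' + 8 * P.tau) := by
  induction p with
  | zero =>
    intro c h
    simp only [beforeRanking, randomPhase] at h
    rw [time_drawRounds G F _ _ c h]
    simp [Config.locally, afterRoundZero, Config.round]
  | succ p ih =>
    intro c h
    simp only [beforeRanking, PMF.mem_support_bind_iff] at h
    obtain ⟨c₂, ⟨c₁, h₁, h₂⟩, h₃⟩ := h
    simp only [shufflePhase, PMF.support_map, Set.mem_image] at h₃
    obtain ⟨A, -, rfl⟩ := h₃
    have e₂ := time_drawRounds G F _ _ c₂ h₂
    have e₁ := ih c₁ h₁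
    simp only [Config.locally] at e₂
    have e₃ := time_shuffleRounds G ρ F (8 * P.tau)
      (c₂.locally fun _ _ => NodeState.startShuffle P)
    simp only [Config.locally] at e₃ ⊢
    rw [e₃, e₂, e₁]
    ring

/-- Every execution up to the end of ranking phase `p` has exactly `endTime P p` rounds. -/
theorem time_execution (p : ℕ) : ∀ c ∈ (execution G P ρ F p).support,
    c.time = endTime P p := by
  intro c h
  simp only [execution, PMF.mem_support_bind_iff] at h
  obtain ⟨c₁, h₁, h₂⟩ := h
  have e₂ := time_drawRounds G F _ _ c h₂
  simp only [Config.locally] at e₂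
  rw [e₂, time_beforeRanking G P ρ F _ c₁ h₁, endTime]

end Time

end

end VertexCongest

/-!
The nodes of a clique count how often they receive a message. Once more than `T` nodes of a clique
have sent it, its nodes no longer regard it as fresh; a message that has reached a clique only
along the paths of the matchings is received at most three times there and stays fresh. By
induction on `p`, with high probability every message has been sent, after `p` ranking phases, by
`s ≥ T + 1` nodes of every clique at distance at most `p`. So in shuffle phase `p` the fresh
messages come from the at most `2k` nodes at distance `p + 1`; each of them is received in ranking
phase `p` by `s` nodes of such a clique, which pass it on to the whole clique, where every node
selects it with probability about `4τ / 2k`. Hence `s` reliable nodes of the clique select it. In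
the next ranking phase the selected messages have ranks at most `8τ`, so each of them is drawn with
probability at least `1 / (8τ H_n)` per round and is sent during the phase.

The Chernoff-type bounds come from exponential potentials: given a configuration, the choices of
the nodes in a round are independent, so a product of one-node potentials is a supermartingale if
each factor is. As a node fails with probability at most `1 / 32`, with high probability at most
`k / 20` nodes of each clique fail. Every elementary event fails with probability at most
`n ^ (-(c + 5))`, and fewer than `n ^ 5` of them occur.
-/

namespace VertexCongest

/-! ### Expectations and independent choices -/

section Expectation

variable {α β ι : Type*}

/-- The expectation of a nonnegative function under a discrete law, as a series, so that
configurations need not carry a `σ`-algebra. -/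
noncomputable def expect (p : PMF α) (f : α → ℝ≥0∞) : ℝ≥0∞ := ∑' x, p x * f x

theorem expect_pure (a : α) (f : α → ℝ≥0∞) : expect (PMF.pure a) f = f a := by
  rw [expect, tsum_eq_single a fun b hb => by simp [PMF.pure_apply, hb]]
  simp

theorem expect_bind (p : PMF α) (g : α → PMF β) (f : β → ℝ≥0∞) :
    expect (p.bind g) f = expect p fun a => expect (g a) f := by
  simp only [expect, PMF.bind_apply, ← ENNReal.tsum_mul_right, ← ENNReal.tsum_mul_left]
  rw [ENNReal.tsum_comm]
  simp only [mul_assoc]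

theorem expect_map (p : PMF α) (g : α → β) (f : β → ℝ≥0∞) :
    expect (p.map g) f = expect p fun a => f (g a) := by
  simp only [PMF.map, expect_bind, Function.comp_apply, expect_pure]

theorem expect_mono (p : PMF α) {f g : α → ℝ≥0∞} (h : ∀ a ∈ p.support, f a ≤ g a) :
    expect p f ≤ expect p g := by
  refine ENNReal.tsum_le_tsum fun a => ?_
  by_cases ha : p a = 0
  · simp [ha]
  · gcongr
    exact h a ((PMF.mem_support_iff _ _).2 ha)

theorem expect_const (p : PMF α) (r : ℝ≥0∞) : expect p (fun _ => r) = r := by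
  rw [expect, ENNReal.tsum_mul_right, p.tsum_coe, one_mul]

theorem expect_const_mul (p : PMF α) (r : ℝ≥0∞) (f : α → ℝ≥0∞) :
    expect p (fun a => r * f a) = r * expect p f := by
  simp only [expect, ← ENNReal.tsum_mul_left, mul_left_comm]

theorem expect_ite_eq [DecidableEq α] (p : PMF α) (a : α) (x y : ℝ≥0∞) :
    expect p (fun b => if b = a then x else y) = p a * x + (1 - p a) * y := by
  have mass_off : ∑' b, (if b = a then 0 else p b) = 1 - p a :=
    ENNReal.eq_sub_of_add_eq' ENNReal.one_ne_top <| by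
      rw [add_comm]
      convert (ENNReal.tsum_eq_add_tsum_ite a).symm.trans p.tsum_coe
  rw [expect, ENNReal.tsum_eq_add_tsum_ite a, if_pos rfl, ← mass_off, ← ENNReal.tsum_mul_right]
  congr 2
  ext b
  split_ifs <;> simp

theorem toOuterMeasure_eq_expect (p : PMF α) (s : Set α) [DecidablePred (· ∈ s)] :
    p.toOuterMeasure s = expect p fun a => if a ∈ s then 1 else 0 := by
  rw [PMF.toOuterMeasure_apply, expect]
  congr 1
  ext a
  by_cases h : a ∈ s <;> simp [h]

theorem toOuterMeasure_univ (p : PMF α) : p.toOuterMeasure Set.univ = 1 :=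
  (p.toOuterMeasure_apply_eq_one_iff _).2 (Set.subset_univ _)

theorem prob_le_expect (p : PMF α) (s : Set α) (f : α → ℝ≥0∞)
    (h : ∀ a ∈ p.support, a ∈ s → 1 ≤ f a) : p.toOuterMeasure s ≤ expect p f := by
  classical
  rw [toOuterMeasure_eq_expect]
  refine expect_mono p fun a ha => ?_
  split_ifs with hs
  · exact h a ha hs
  · exact zero_le

theorem prob_le_inv_mul_expect (p : PMF α) (s : Set α) (f : α → ℝ≥0∞) {r : ℝ≥0∞}
    (h0 : r ≠ 0) (ht : r ≠ ∞) (h : ∀ a ∈ p.support, a ∈ s → r ≤ f a) :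
    p.toOuterMeasure s ≤ r⁻¹ * expect p f := by
  rw [← expect_const_mul]
  refine prob_le_expect p s _ fun a ha hs => ?_
  rw [← ENNReal.inv_mul_cancel h0 ht]
  gcongr
  exact h a ha hs

theorem prob_mono (p : PMF α) {s t : Set α} (h : ∀ a ∈ p.support, a ∈ s → a ∈ t) :
    p.toOuterMeasure s ≤ p.toOuterMeasure t :=
  PMF.toOuterMeasure_mono p fun a ha => h a ha.2 ha.1

theorem prob_bind_le (p : PMF α) (f : α → PMF β) (b : Set α) (s : Set β) (δ : ℝ≥0∞)
    (h : ∀ a ∈ p.support, a ∉ b → (f a).toOuterMeasure s ≤ δ) :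
    (p.bind f).toOuterMeasure s ≤ p.toOuterMeasure b + δ := by
  rw [PMF.toOuterMeasure_bind_apply, PMF.toOuterMeasure_apply]
  calc ∑' a, p a * (f a).toOuterMeasure s ≤ ∑' a, (b.indicator p a + p a * δ) := by
        refine ENNReal.tsum_le_tsum fun a => ?_
        by_cases hb : a ∈ b
        · rw [Set.indicator_of_mem hb]
          refine le_add_right (mul_le_of_le_one_right' ?_)
          exact ((f a).toOuterMeasure.mono (Set.subset_univ s)).trans (toOuterMeasure_univ _).le
        · refine le_add_left ?_
          by_cases ha : p a = 0
          · simp [ha]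
          · gcongr
            exact h a ((PMF.mem_support_iff _ _).2 ha) hb
    _ = _ := by rw [ENNReal.tsum_add, ENNReal.tsum_mul_right, p.tsum_coe, one_mul]

theorem prob_exists_le [Fintype ι] (p : PMF α) (s : ι → Set α) (e : ℝ≥0∞)
    (h : ∀ i, p.toOuterMeasure (s i) ≤ e) :
    p.toOuterMeasure {a | ∃ i, a ∈ s i} ≤ Fintype.card ι * e := by
  calc p.toOuterMeasure {a | ∃ i, a ∈ s i} = p.toOuterMeasure (⋃ i, s i) := by
        congr 1
        ext
        simp
    _ ≤ ∑ i, p.toOuterMeasure (s i) := MeasureTheory.measure_iUnion_fintype_le _ _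
    _ ≤ ∑ _i : ι, e := Finset.sum_le_sum fun i _ => h i
    _ = Fintype.card ι * e := by simp

theorem prob_exists_and_le [Fintype ι] (p : PMF α) (q : ι → Prop) (s : ι → Set α) (e : ℝ≥0∞)
    (h : ∀ i, q i → p.toOuterMeasure (s i) ≤ e) :
    p.toOuterMeasure {a | ∃ i, q i ∧ a ∈ s i} ≤ Fintype.card ι * e := by
  refine prob_exists_le p (fun i => {a | q i ∧ a ∈ s i}) e fun i => ?_
  by_cases hq : q i
  · simpa only [hq, true_and, Set.ofPred_mem_eq] using h i hq
  · simp [hq]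

theorem one_sub_le_prob_of_compl_le (p : PMF α) (s : Set α) {ε : ℝ} (hε : 0 ≤ ε)
    (h : p.toOuterMeasure sᶜ ≤ ENNReal.ofReal ε) :
    ENNReal.ofReal (1 - ε) ≤ p.toOuterMeasure s := by
  have h1 : 1 ≤ p.toOuterMeasure s + p.toOuterMeasure sᶜ := by
    rw [← toOuterMeasure_univ p, ← Set.union_compl_self s]
    exact MeasureTheory.measure_union_le _ _
  rw [ENNReal.ofReal_sub _ hε, ENNReal.ofReal_one]
  exact tsub_le_iff_right.2 (h1.trans (by gcongr))

theorem iterate_invariant (f : α → PMF α) (I : ℕ → α → Prop)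
    (h : ∀ r a, I r a → ∀ b ∈ (f a).support, I (r + 1) b) (N : ℕ) :
    ∀ r a, I r a → ∀ b ∈ (iterate f N a).support, I (r + N) b := by
  induction N with
  | zero =>
    intro r a ha b hb
    simp only [iterate, PMF.support_pure, Set.mem_singleton_iff] at hb
    exact hb ▸ ha
  | succ N ih =>
    intro r a ha b hb
    simp only [iterate, PMF.mem_support_bind_iff] at hb
    obtain ⟨a', ha', hb'⟩ := hb
    have := ih (r + 1) a' (h r a ha a' ha') b hb'
    rwa [add_assoc, add_comm 1 N] at this

theorem expect_iterate_le (f : α → PMF α) (Φ : ℕ → α → ℝ≥0∞)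
    (h : ∀ r a, expect (f a) (Φ r) ≤ Φ (r + 1) a) (N : ℕ) :
    ∀ a, expect (iterate f N a) (Φ 0) ≤ Φ N a := by
  induction N with
  | zero => intro a; simp [iterate, expect_pure]
  | succ N ih =>
    intro a
    simp only [iterate, expect_bind]
    exact (expect_mono _ fun b _ => ih b).trans (h N a)

end Expectation

section Product

variable {ι β : Type*} [Fintype ι] [DecidableEq ι] [Fintype β]

theorem pmfPi_apply (p : ι → PMF β) (x : ι → β) : pmfPi p x = ∏ i, p i (x i) := rfl

theorem expect_pmfPi_prod (p : ι → PMF β) (g : ι → β → ℝ≥0∞) :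
    expect (pmfPi p) (fun x => ∏ i, g i (x i)) = ∏ i, expect (p i) (g i) := by
  simp only [expect, tsum_fintype, pmfPi_apply, ← Finset.prod_mul_distrib]
  rw [← Fintype.prod_sum (fun i b => p i b * g i b)]

theorem expect_pmfPi_prod_finset (p : ι → PMF β) (K : Finset ι) (g : ι → β → ℝ≥0∞) :
    expect (pmfPi p) (fun x => ∏ i ∈ K, g i (x i)) = ∏ i ∈ K, expect (p i) (g i) := by
  have extend (f : ι → ℝ≥0∞) : ∏ i ∈ K, f i = ∏ i, if i ∈ K then f i else 1 := by
    rw [Fintype.prod_ite_mem]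
  simp only [extend]
  rw [expect_pmfPi_prod p fun i b => if i ∈ K then g i b else 1]
  refine Finset.prod_congr rfl fun i _ => ?_
  split_ifs
  · rfl
  · exact expect_const _ 1

theorem mem_support_of_mem_support_pmfPi {p : ι → PMF β} {x : ι → β}
    (hx : x ∈ (pmfPi p).support) (i : ι) : x i ∈ (p i).support := by
  rw [PMF.mem_support_iff, pmfPi_apply] at hx
  rw [PMF.mem_support_iff]
  exact fun h => hx (Finset.prod_eq_zero (Finset.mem_univ i) h)

end Product

section DrawRounds

theorem Alive.mono {V : Type*} {N : ℕ} {F : Schedule V N} {u : V} {s t : ℕ} (h : Alive F u t)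
    (hst : s ≤ t) : Alive F u s := fun r hr => h r (hr.trans hst)

variable {V : Type*} [Fintype V] [DecidableEq V]

theorem mem_of_some_mem_support_draw {B : Finset V} {pos : V → ℕ} {m : V}
    (h : some m ∈ (draw B pos).support) : m ∈ B := by
  unfold draw at h
  split_ifs at h with hB
  · simp only [PMF.support_map, Set.mem_image, Option.some.injEq, exists_eq_right,
      PMF.mem_support_normalize_iff] at h
    by_contra hm
    exact h (if_neg hm)
  · simp at h

theorem received_pos {G : SimpleGraph V} {out : V → Option V} {u v : V} :
    0 < received G out u v ↔ ∃ w, G.Adj u w ∧ out w = some v := by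
  simp [received, Finset.card_pos, Finset.filter_nonempty_iff]

variable {G : SimpleGraph V} {N : ℕ} {F : Schedule V N}

open Classical in
/-- The invariants that hold at all times: the counters of a working node count the neighbours
that have sent a message, and only messages that were sent in round 0 are around. -/
structure Sound (G : SimpleGraph V) (F : Schedule V N) (c : Config V) : Prop where
  cnt : ∀ u, Alive F u c.time → ∀ v, (c.st u).cnt v =
    (if v = u then 1 else 0) + (Finset.univ.filter fun w => G.Adj u w ∧ v ∈ (c.st w).S).card
  known : ∀ u, Alive F u c.time → ∀ w, G.Adj u w → (c.st w).S ⊆ (c.st u).R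
  self : ∀ u, u ∈ (c.st u).R
  origin : ∀ u, Alive F u c.time → ∀ v ∈ (c.st u).R, Alive F v 0
  sent : ∀ u, ∀ v ∈ (c.st u).S, Alive F v 0
  own : ∀ u, Alive F u 0 → u ∈ (c.st u).S

/-- A round of the random phase or of a ranking phase leads from `c` to `c'` when the nodes send
the messages `out`; a node that has failed has `out u = none`. -/
structure DrawStep (G : SimpleGraph V) (F : Schedule V N) (out : V → Option V)
    (c c' : Config V) : Prop where
  alive : ∀ {u m}, out u = some m → Alive F u c.time
  mem_hatB : ∀ {u m}, out u = some m → m ∈ (c.st u).hatB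
  time_eq : c'.time = c.time + 1
  S_eq : ∀ u, (c'.st u).S = (c.st u).S ∪ (out u).toFinset
  hatB_eq : ∀ u, (c'.st u).hatB = (c.st u).hatB \ (out u).toFinset
  pos_eq : ∀ u, (c'.st u).pos = (c.st u).pos
  sel_eq : ∀ u, (c'.st u).sel = (c.st u).sel
  R_mono : ∀ u, (c.st u).R ⊆ (c'.st u).R
  R_le : ∀ u, ∀ v ∈ (c'.st u).R, v ∈ (c.st u).R ∨ ∃ w, G.Adj u w ∧ out w = some v
  mem_R : ∀ {u w v}, Alive F u c.time → G.Adj u w → out w = some v → v ∈ (c'.st u).R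
  cnt_eq : ∀ u, Alive F u c.time → ∀ v, (c'.st u).cnt v = (c.st u).cnt v + received G out u v

theorem exists_drawStep {c c' : Config V} (h : c' ∈ (drawRound G F c).support) :
    ∃ out : V → Option V, DrawStep G F out c c' := by
  classical
  simp only [drawRound, PMF.support_map, Set.mem_image] at h
  obtain ⟨msg, hmsg, rfl⟩ := h
  set out : V → Option V := fun w => if Alive F w c.time then msg w else none with hout
  have some_out {u m : V} (hu : out u = some m) : Alive F u c.time ∧ msg u = some m := by
    simpa only [hout, Option.ite_none_right_eq_some] using hu
  have st_alive {u : V} (hu : Alive F u c.time) :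
      (c.round F (NodeState.sync G) msg).st u = (c.st u).sync G out u := if_pos hu
  have st_failed {u : V} (hu : ¬ Alive F u c.time) :
      (c.round F (NodeState.sync G) msg).st u = c.st u := if_neg hu
  have out_failed {u : V} (hu : ¬ Alive F u c.time) : out u = none := if_neg hu
  refine ⟨out, ⟨fun hu => (some_out hu).1, fun {u m} hu => ?_, rfl, fun u => ?_, fun u => ?_,
    fun u => ?_, fun u => ?_, fun u => ?_, fun u => ?_, fun {u w v} hu hw hv => ?_,
    fun u hu v => ?_⟩⟩
  · exact mem_of_some_mem_support_draw
      ((some_out hu).2 ▸ mem_support_of_mem_support_pmfPi hmsg u)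
  · by_cases hu : Alive F u c.time
    · rw [st_alive hu, NodeState.sync]
    · rw [st_failed hu, out_failed hu, Option.toFinset_none, Finset.union_empty]
  · by_cases hu : Alive F u c.time
    · rw [st_alive hu, NodeState.sync]
    · rw [st_failed hu, out_failed hu, Option.toFinset_none, Finset.sdiff_empty]
  · by_cases hu : Alive F u c.time <;> simp [hu, st_alive, st_failed, NodeState.sync]
  · by_cases hu : Alive F u c.time <;> simp [hu, st_alive, st_failed, NodeState.sync]
  · by_cases hu : Alive F u c.time
    · exact st_alive hu ▸ Finset.subset_union_left
    · rw [st_failed hu]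
  · by_cases hu : Alive F u c.time
    · simp only [st_alive hu, NodeState.sync, received_pos, Finset.mem_union,
        Finset.mem_filter, Finset.mem_univ, true_and]
      exact fun v => id
    · exact fun v hv => Or.inl (st_failed hu ▸ hv)
  · simp only [st_alive hu, NodeState.sync, received_pos, Finset.mem_union,
      Finset.mem_filter, Finset.mem_univ, true_and]
    exact Or.inr ⟨w, hw, hv⟩
  · rw [st_alive hu, NodeState.sync]

theorem DrawStep.mem_S_iff {out : V → Option V} {c c' : Config V} (h : DrawStep G F out c c')
    {u v : V} : v ∈ (c'.st u).S ↔ v ∈ (c.st u).S ∨ out u = some v := by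
  rw [h.S_eq, Finset.mem_union, Option.mem_toFinset, Option.mem_def]

theorem Sound.drawStep {out : V → Option V} {c c' : Config V} (h : Sound G F c)
    (hc : DrawStep G F out c c') (hR : ∀ {u m}, out u = some m → m ∈ (c.st u).R)
    (hS : ∀ {u m}, out u = some m → m ∉ (c.st u).S) : Sound G F c' := by
  classical
  have alive_before {u : V} (hu : Alive F u c'.time) : Alive F u c.time :=
    hu.mono (by rw [hc.time_eq]; exact Nat.le_succ _)
  have origin_out {u m : V} (hm : out u = some m) : Alive F m 0 :=
    h.origin u (hc.alive hm) m (hR hm)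
  refine ⟨fun u hu v => ?_, fun u hu w hw v hv => ?_, fun u => hc.R_mono u (h.self u),
    fun u hu v hv => ?_, fun u v hv => ?_, fun u hu => hc.mem_S_iff.2 (Or.inl (h.own u hu))⟩
  · rw [hc.cnt_eq u (alive_before hu) v, h.cnt u (alive_before hu) v, add_assoc, received,
      ← Finset.card_union_of_disjoint]
    · congr 2
      ext w
      simp only [Finset.mem_union, Finset.mem_filter, Finset.mem_univ, true_and, hc.mem_S_iff]
      tauto
    · rw [Finset.disjoint_filter]
      exact fun w _ hw hw' => hS hw'.2 hw.2
  · rcases hc.mem_S_iff.1 hv with hv | hv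
    · exact hc.R_mono u (h.known u (alive_before hu) w hw hv)
    · exact hc.mem_R (alive_before hu) hw hv
  · rcases hc.R_le u v hv with hv | ⟨w, -, hw⟩
    · exact h.origin u (alive_before hu) v hv
    · exact origin_out hw
  · rcases hc.mem_S_iff.1 hv with hv | hv
    · exact h.sent u v hv
    · exact origin_out hv

/-- The relation between the start `c₀` of a random or ranking phase and a later configuration
of the same phase. -/
structure DrawInv (G : SimpleGraph V) (F : Schedule V N) (c₀ c : Config V) : Prop where
  sound : Sound G F c
  time_le : c₀.time ≤ c.time
  S_mono : ∀ u, (c₀.st u).S ⊆ (c.st u).S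
  S_le : ∀ u, ∀ v ∈ (c.st u).S, v ∈ (c₀.st u).S ∨ (Alive F u c₀.time ∧ v ∈ (c₀.st u).hatB)
  S_card : ∀ u, (c.st u).S.card + c₀.time ≤ (c₀.st u).S.card + c.time
  hatB_eq : ∀ u, (c.st u).hatB = (c₀.st u).hatB \ (c.st u).S
  pos_eq : ∀ u, (c.st u).pos = (c₀.st u).pos
  sel_eq : ∀ u, (c.st u).sel = (c₀.st u).sel
  R_mono : ∀ u, (c₀.st u).R ⊆ (c.st u).R
  R_le : ∀ u, ∀ v ∈ (c.st u).R, v ∈ (c₀.st u).R ∨ ∃ w, G.Adj u w ∧ v ∈ (c.st w).S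

theorem DrawInv.refl {c₀ : Config V} (h : Sound G F c₀)
    (hd : ∀ u, Disjoint (c₀.st u).hatB (c₀.st u).S) : DrawInv G F c₀ c₀ where
  sound := h
  time_le := le_rfl
  S_mono _ := subset_rfl
  S_le _ _ hv := Or.inl hv
  S_card _ := le_rfl
  hatB_eq u := (Finset.sdiff_eq_self_of_disjoint (hd u)).symm
  pos_eq _ := rfl
  sel_eq _ := rfl
  R_mono _ := subset_rfl
  R_le _ _ hv := Or.inl hv

theorem DrawInv.step {c₀ c c' : Config V}
    (hR : ∀ u, Alive F u c₀.time → (c₀.st u).hatB ⊆ (c₀.st u).R)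
    (h : DrawInv G F c₀ c) (hc : c' ∈ (drawRound G F c).support) : DrawInv G F c₀ c' := by
  obtain ⟨out, hc⟩ := exists_drawStep hc
  have alive_start {u m : V} (hm : out u = some m) : Alive F u c₀.time :=
    (hc.alive hm).mono h.time_le
  have out_fresh {u m : V} (hm : out u = some m) : m ∈ (c₀.st u).hatB ∧ m ∉ (c.st u).S := by
    simpa only [h.hatB_eq, Finset.mem_sdiff] using hc.mem_hatB hm
  refine ⟨h.sound.drawStep hc
      (fun {u m} hm => h.R_mono u (hR u (alive_start hm) (out_fresh hm).1))
      (fun hm => (out_fresh hm).2),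
    h.time_le.trans (by rw [hc.time_eq]; exact Nat.le_succ _),
    fun u v hv => hc.mem_S_iff.2 (Or.inl (h.S_mono u hv)), fun u v hv => ?_, fun u => ?_,
    fun u => ?_, fun u => (hc.pos_eq u).trans (h.pos_eq u),
    fun u => (hc.sel_eq u).trans (h.sel_eq u), fun u => (h.R_mono u).trans (hc.R_mono u),
    fun u v hv => ?_⟩
  · rcases hc.mem_S_iff.1 hv with hv | hv
    · exact h.S_le u v hv
    · exact Or.inr ⟨alive_start hv, (out_fresh hv).1⟩
  · have card_union := Finset.card_union_le (c.st u).S (out u).toFinset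
    have card_out : (out u).toFinset.card ≤ 1 := by
      rw [Option.card_toFinset]
      cases out u <;> simp
    have card_start := h.S_card u
    rw [hc.S_eq, hc.time_eq]
    omega
  · rw [hc.hatB_eq, hc.S_eq, h.hatB_eq, sdiff_sdiff_left]
    rfl
  · rcases hc.R_le u v hv with hv | ⟨w, hw, hv⟩
    · exact (h.R_le u v hv).imp_right fun ⟨w, hw, hv⟩ => ⟨w, hw, hc.mem_S_iff.2 (Or.inl hv)⟩
    · exact Or.inr ⟨w, hw, hc.mem_S_iff.2 (Or.inr hv)⟩

theorem drawInv_of_mem_support {c₀ c : Config V} {r : ℕ} (h : Sound G F c₀)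
    (hd : ∀ u, Disjoint (c₀.st u).hatB (c₀.st u).S)
    (hR : ∀ u, Alive F u c₀.time → (c₀.st u).hatB ⊆ (c₀.st u).R)
    (hc : c ∈ (iterate (drawRound G F) r c₀).support) : DrawInv G F c₀ c :=
  iterate_invariant (drawRound G F) (fun _ a => DrawInv G F c₀ a)
    (fun _ _ ha _ hb => ha.step hR hb) r 0 c₀ (DrawInv.refl h hd) c hc

end DrawRounds

/-! ### Exponential potentials -/

section Potentials

variable {V : Type*}

/-- The total weight of the messages of a buffer, by which `draw` normalizes. -/
noncomputable def totalWeight (B : Finset V) (pos : V → ℕ) : ℝ≥0∞ :=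
  ∑ m ∈ B, ((pos m + 1 : ℕ) : ℝ≥0∞)⁻¹

theorem totalWeight_mono {B B' : Finset V} (h : B ⊆ B') (pos : V → ℕ) :
    totalWeight B pos ≤ totalWeight B' pos :=
  Finset.sum_le_sum_of_subset h

variable [DecidableEq V]

theorem mem_sdiff_toFinset {B : Finset V} {v : V} {o : Option V} (hB : v ∈ B)
    (ho : o ≠ some v) : v ∈ B \ o.toFinset :=
  Finset.mem_sdiff.2 ⟨hB, fun h => ho (Option.mem_toFinset.1 h)⟩

variable [Fintype V]

theorem draw_apply_some {B : Finset V} (pos : V → ℕ) {v : V} (hv : v ∈ B) :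
    draw B pos (some v) = ((pos v + 1 : ℕ) : ℝ≥0∞)⁻¹ * (totalWeight B pos)⁻¹ := by
  rw [draw, dif_pos ⟨v, hv⟩, PMF.map_apply, tsum_eq_single v]
  · rw [if_pos rfl, PMF.normalize_apply, if_pos hv, tsum_fintype, Finset.sum_ite_mem,
      Finset.univ_inter, totalWeight]
  · intro m hm
    rw [if_neg]
    simpa using hm.symm

/-- Bounds the expectation, after `r` more draws of a node with buffer `B`, of the function that
is `1` if `v` is still in the buffer and `w` otherwise. It is `⊤` where `v` need not be drawn with
probability at least `L⁻¹ * H⁻¹`, so that the one-step inequality holds unconditionally. -/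
noncomputable def retainPotential (L H w w' : ℝ≥0∞) (v : V) (r : ℕ) (B : Finset V)
    (pos : V → ℕ) : ℝ≥0∞ :=
  open Classical in
  if v ∈ B then
    if ((pos v + 1 : ℕ) : ℝ≥0∞) ≤ L ∧ totalWeight B pos ≤ H then w + w' * (1 - L⁻¹ * H⁻¹) ^ r
    else ⊤
  else w

theorem expect_draw_retainPotential_le (L H w w' : ℝ≥0∞) (v : V) (r : ℕ) (B : Finset V)
    (pos : V → ℕ) :
    expect (draw B pos) (fun o => retainPotential L H w w' v r (B \ o.toFinset) pos) ≤
      retainPotential L H w w' v (r + 1) B pos := by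
  by_cases hB : v ∈ B
  swap
  · simp [retainPotential, hB, expect_const]
  by_cases hc : ((pos v + 1 : ℕ) : ℝ≥0∞) ≤ L ∧ totalWeight B pos ≤ H
  swap
  · simp only [retainPotential, if_pos hB, if_neg hc, le_top]
  set θ := 1 - L⁻¹ * H⁻¹
  set p := draw B pos (some v) with hp
  have miss_le : 1 - p ≤ θ := by
    rw [hp, draw_apply_some pos hB]
    exact tsub_le_tsub_left
      (mul_le_mul' (ENNReal.inv_le_inv.2 hc.1) (ENNReal.inv_le_inv.2 hc.2)) 1
  have outcome (o : Option V) : retainPotential L H w w' v r (B \ o.toFinset) pos =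
      if o = some v then w else w + w' * θ ^ r := by
    split_ifs with ho
    · simp [retainPotential, ho]
    · rw [retainPotential, if_pos (mem_sdiff_toFinset hB ho),
        if_pos ⟨hc.1, (totalWeight_mono Finset.sdiff_subset pos).trans hc.2⟩]
  calc expect (draw B pos) (fun o => retainPotential L H w w' v r (B \ o.toFinset) pos)
      = p * w + (1 - p) * (w + w' * θ ^ r) := by simp only [outcome, expect_ite_eq, hp]
    _ = (p + (1 - p)) * w + w' * θ ^ r * (1 - p) := by ring
    _ ≤ w + w' * θ ^ r * θ := by
        rw [add_tsub_cancel_of_le (PMF.coe_le_one _ _), one_mul]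
        gcongr
    _ = retainPotential L H w w' v (r + 1) B pos := by
        rw [retainPotential, if_pos hB, if_pos hc]
        ring

/-- Bounds the expectation, after `r` more uniform draws of a node with buffer `B`, of the
function that is `1` if `v` is still in the buffer and `2` otherwise; `⊤` if the weights are not
uniform. -/
noncomputable def lossPotential (v : V) (r : ℕ) (B : Finset V) (pos : V → ℕ) : ℝ≥0∞ :=
  open Classical in
  if v ∈ B then if pos = fun _ => 0 then 1 + r * (B.card : ℝ≥0∞)⁻¹ else ⊤ else 2

theorem one_sub_inv_natCast_succ (b : ℕ) :
    1 - ((b + 1 : ℕ) : ℝ≥0∞)⁻¹ = b * ((b + 1 : ℕ) : ℝ≥0∞)⁻¹ := by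
  refine ENNReal.sub_eq_of_eq_add_rev (by simp) ?_
  rw [← one_add_mul, ← Nat.cast_one, ← Nat.cast_add, Nat.add_comm, ENNReal.mul_inv_cancel] <;>
    simp

theorem expect_draw_lossPotential_le (v : V) (r : ℕ) (B : Finset V) (pos : V → ℕ) :
    expect (draw B pos) (fun o => lossPotential v r (B \ o.toFinset) pos) ≤
      lossPotential v (r + 1) B pos := by
  by_cases hB : v ∈ B
  swap
  · simp [lossPotential, hB, expect_const]
  by_cases hc : pos = fun _ => 0
  swap
  · simp only [lossPotential, if_pos hB, if_neg hc, le_top]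
  obtain ⟨b, hb⟩ : ∃ b, B.card = b + 1 :=
    ⟨B.card - 1, (Nat.succ_pred_eq_of_pos (Finset.card_pos.2 ⟨_, hB⟩)).symm⟩
  set p := draw B pos (some v) with hp
  have p_eq : p = ((b + 1 : ℕ) : ℝ≥0∞)⁻¹ := by
    rw [hp, draw_apply_some pos hB]
    simp [totalWeight, hc, hb]
  have outcome (o : Option V) : lossPotential v r (B \ o.toFinset) pos ≤
      if o = some v then 2 else 1 + r * (b : ℝ≥0∞)⁻¹ := by
    split_ifs with ho
    · simp [lossPotential, ho]
    · have card_ge : b ≤ (B \ o.toFinset).card := by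
        have card_out : o.toFinset.card ≤ 1 := by
          rw [Option.card_toFinset]
          cases o <;> simp
        have := Finset.le_card_sdiff o.toFinset B
        omega
      rw [lossPotential, if_pos (mem_sdiff_toFinset hB ho), if_pos hc]
      gcongr
  have miss_le : (1 - p) * (b : ℝ≥0∞)⁻¹ ≤ p := by
    rw [p_eq, one_sub_inv_natCast_succ, mul_right_comm]
    exact mul_le_of_le_one_left' (ENNReal.mul_inv_le_one _)
  calc expect (draw B pos) (fun o => lossPotential v r (B \ o.toFinset) pos)
      ≤ p * 2 + (1 - p) * (1 + r * (b : ℝ≥0∞)⁻¹) := by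
        rw [hp, ← expect_ite_eq]
        exact expect_mono _ fun o _ => outcome o
    _ = p + (p + (1 - p)) + r * ((1 - p) * (b : ℝ≥0∞)⁻¹) := by ring
    _ ≤ p + 1 + r * p := by
        rw [add_tsub_cancel_of_le (PMF.coe_le_one _ _)]
        gcongr
    _ = lossPotential v (r + 1) B pos := by
        rw [lossPotential, if_pos hB, if_pos hc, hb, ← p_eq]
        push_cast
        ring

variable (G : SimpleGraph V) {N : ℕ} (F : Schedule V N)

theorem expect_drawRound_prod_le (K : Finset V) (φ φ' : V → Finset V → (V → ℕ) → ℝ≥0∞)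
    (c : Config V)
    (halive : ∀ u ∈ K, Alive F u c.time →
      expect (draw (c.st u).hatB (c.st u).pos)
        (fun o => φ u ((c.st u).hatB \ o.toFinset) (c.st u).pos)
        ≤ φ' u (c.st u).hatB (c.st u).pos)
    (hfailed : ∀ u ∈ K, ¬ Alive F u c.time →
      φ u (c.st u).hatB (c.st u).pos ≤ φ' u (c.st u).hatB (c.st u).pos) :
    expect (drawRound G F c) (fun c' => ∏ u ∈ K, φ u (c'.st u).hatB (c'.st u).pos)
      ≤ ∏ u ∈ K, φ' u (c.st u).hatB (c.st u).pos := by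
  classical
  let ψ (u : V) (o : Option V) : ℝ≥0∞ := if Alive F u c.time then
    φ u ((c.st u).hatB \ o.toFinset) (c.st u).pos else φ u (c.st u).hatB (c.st u).pos
  have factor (msg : V → Option V) (u : V) :
      φ u ((c.round F (NodeState.sync G) msg).st u).hatB
        ((c.round F (NodeState.sync G) msg).st u).pos = ψ u (msg u) := by
    by_cases h : Alive F u c.time <;> simp [ψ, Config.round, NodeState.sync, h]
  simp only [drawRound, expect_map, factor, expect_pmfPi_prod_finset _ K ψ]
  refine Finset.prod_le_prod' fun u hu => ?_
  by_cases h : Alive F u c.time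
  · simpa only [ψ, if_pos h] using halive u hu h
  · simpa only [ψ, if_neg h, expect_const] using hfailed u hu h

theorem expect_draws_prod_le (K : Finset V) (φ : V → ℕ → Finset V → (V → ℕ) → ℝ≥0∞)
    (halive : ∀ r, ∀ u ∈ K, ∀ B pos,
      expect (draw B pos) (fun o => φ u r (B \ o.toFinset) pos) ≤ φ u (r + 1) B pos)
    (hfailed : ∀ r, ∀ u ∈ K, (¬ ∀ t, Alive F u t) → ∀ B pos, φ u r B pos ≤ φ u (r + 1) B pos)
    (r : ℕ) (c : Config V) :
    expect (iterate (drawRound G F) r c) (fun c' => ∏ u ∈ K, φ u 0 (c'.st u).hatB (c'.st u).pos)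
      ≤ ∏ u ∈ K, φ u r (c.st u).hatB (c.st u).pos :=
  expect_iterate_le (drawRound G F)
    (fun r c' => ∏ u ∈ K, φ u r (c'.st u).hatB (c'.st u).pos)
    (fun r c' => expect_drawRound_prod_le G F K (fun u => φ u r) (fun u => φ u (r + 1)) c'
      (fun u hu _ => halive r u hu _ _)
      fun u hu h => hfailed r u hu (fun h' => h (h' _)) _ _) r c

theorem expect_draws_retain_le (K : Finset V) (hK : ∀ u ∈ K, ∀ t, Alive F u t) (v : V → V)
    (L H w w' : ℝ≥0∞) (hw : w + w' = 1) (r : ℕ) (c : Config V)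
    (hv : ∀ u ∈ K, v u ∈ (c.st u).hatB ∧ (((c.st u).pos (v u) + 1 : ℕ) : ℝ≥0∞) ≤ L ∧
      totalWeight (c.st u).hatB (c.st u).pos ≤ H) :
    expect (iterate (drawRound G F) r c)
        (fun c' => ∏ u ∈ K, if v u ∈ (c'.st u).hatB then 1 else w)
      ≤ (w + w' * (1 - L⁻¹ * H⁻¹) ^ r) ^ K.card := by
  calc expect (iterate (drawRound G F) r c)
        (fun c' => ∏ u ∈ K, if v u ∈ (c'.st u).hatB then 1 else w)
      ≤ expect (iterate (drawRound G F) r c)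
        (fun c' => ∏ u ∈ K, retainPotential L H w w' (v u) 0 (c'.st u).hatB (c'.st u).pos) := by
        refine expect_mono _ fun c' _ => Finset.prod_le_prod' fun u _ => ?_
        simp only [retainPotential, pow_zero, mul_one, hw]
        split_ifs <;> simp
    _ ≤ ∏ u ∈ K, retainPotential L H w w' (v u) r (c.st u).hatB (c.st u).pos :=
        expect_draws_prod_le G F K (fun u => retainPotential L H w w' (v u))
          (fun r u _ B pos => expect_draw_retainPotential_le L H w w' (v u) r B pos)
          (fun r u hu hd => absurd (hK u hu) hd) r c
    _ = (w + w' * (1 - L⁻¹ * H⁻¹) ^ r) ^ K.card := by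
        rw [← Finset.prod_const]
        refine Finset.prod_congr rfl fun u hu => ?_
        rw [retainPotential, if_pos (hv u hu).1, if_pos (hv u hu).2]

theorem expect_draws_loss_le (K : Finset V) (v : V → V) (r : ℕ) (c : Config V)
    (hv : ∀ u ∈ K, v u ∈ (c.st u).hatB ∧ (c.st u).pos = fun _ => 0) :
    expect (iterate (drawRound G F) r c)
        (fun c' => ∏ u ∈ K, if v u ∈ (c'.st u).hatB then 1 else 2)
      ≤ ∏ u ∈ K, (1 + r * ((c.st u).hatB.card : ℝ≥0∞)⁻¹) := by
  calc expect (iterate (drawRound G F) r c)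
        (fun c' => ∏ u ∈ K, if v u ∈ (c'.st u).hatB then 1 else 2)
      ≤ expect (iterate (drawRound G F) r c)
        (fun c' => ∏ u ∈ K, lossPotential (v u) 0 (c'.st u).hatB (c'.st u).pos) := by
        refine expect_mono _ fun c' _ => Finset.prod_le_prod' fun u _ => ?_
        simp only [lossPotential, Nat.cast_zero, zero_mul, add_zero]
        split_ifs <;> simp
    _ ≤ ∏ u ∈ K, lossPotential (v u) r (c.st u).hatB (c.st u).pos := by
        refine expect_draws_prod_le G F K (fun u => lossPotential (v u))
          (fun r u _ B pos => expect_draw_lossPotential_le (v u) r B pos)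
          (fun r u _ _ B pos => ?_) r c
        unfold lossPotential
        split_ifs
        · gcongr
          exact Nat.le_succ r
        all_goals exact le_rfl
    _ = ∏ u ∈ K, (1 + r * ((c.st u).hatB.card : ℝ≥0∞)⁻¹) := by
        refine Finset.prod_congr rfl fun u hu => ?_
        rw [lossPotential, if_pos (hv u hu).1, if_pos (hv u hu).2]

end Potentials

section Tails

variable {α ι κ : Type*}

/-- At least `s` indices satisfy `q`. -/
def AtLeast (s : ℕ) (q : ι → Prop) : Prop :=
  ∃ D : Finset ι, s ≤ D.card ∧ ∀ i ∈ D, q i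

theorem AtLeast.mono {s : ℕ} {q q' : ι → Prop} (h : AtLeast s q) (hq : ∀ i, q i → q' i) :
    AtLeast s q' := by
  obtain ⟨D, hs, hD⟩ := h
  exact ⟨D, hs, fun i hi => hq i (hD i hi)⟩

theorem AtLeast.map {s : ℕ} {q : ι → Prop} {q' : κ → Prop} (h : AtLeast s q) (f : ι → κ)
    (hf : ∀ i j, q i → q j → f i = f j → i = j) (hq : ∀ i, q i → q' (f i)) : AtLeast s q' := by
  classical
  obtain ⟨D, hs, hD⟩ := h
  refine ⟨D.image f, ?_, fun i hi => ?_⟩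
  · rwa [Finset.card_image_of_injOn fun i hi j hj => hf i j (hD i hi) (hD j hj)]
  · obtain ⟨j, hj, rfl⟩ := Finset.mem_image.1 hi
    exact hq j (hD j hj)

theorem atLeast_mem_iff {s : ℕ} {K : Finset ι} {q : ι → Prop} [DecidablePred q] :
    AtLeast s (fun i => i ∈ K ∧ q i) ↔ s ≤ (K.filter q).card := by
  constructor
  · rintro ⟨D, hs, hD⟩
    exact hs.trans (Finset.card_le_card fun i hi => Finset.mem_filter.2 (hD i hi))
  · exact fun h => ⟨_, h, fun i hi => Finset.mem_filter.1 hi⟩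

theorem prob_not_atLeast (p : PMF α) (K : Finset ι) (q : ι → α → Prop)
    [∀ i a, Decidable (q i a)] (s : ℕ) :
    p.toOuterMeasure {a | ¬ AtLeast s fun i => i ∈ K ∧ q i a} ≤
      2 ^ s * expect p fun a => ∏ i ∈ K, if q i a then 2⁻¹ else 1 := by
  rw [← inv_inv ((2 : ℝ≥0∞) ^ s)]
  refine prob_le_inv_mul_expect p _ _ (by simp) (by simp) fun a _ few => ?_
  rw [Set.mem_ofPred_eq, atLeast_mem_iff, not_le] at few
  rw [Finset.prod_ite, Finset.prod_const, Finset.prod_const_one, mul_one, ← ENNReal.inv_pow]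
  exact ENNReal.inv_le_inv.2 (pow_le_pow_right₀ one_le_two few.le)

theorem prob_atLeast (p : PMF α) (K : Finset ι) (q : ι → α → Prop)
    [∀ i a, Decidable (q i a)] (s : ℕ) :
    p.toOuterMeasure {a | AtLeast s fun i => i ∈ K ∧ q i a} ≤
      (2 ^ s)⁻¹ * expect p fun a => ∏ i ∈ K, if q i a then 2 else 1 := by
  refine prob_le_inv_mul_expect p _ _ (by simp) (by simp) fun a _ many => ?_
  rw [Set.mem_ofPred_eq, atLeast_mem_iff] at many
  rw [Finset.prod_ite, Finset.prod_const, Finset.prod_const_one, mul_one]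
  exact pow_le_pow_right₀ one_le_two many

theorem expect_add_ite_mem (p : PMF α) (E : Set α) [DecidablePred (· ∈ E)] (x y : ℝ≥0∞) :
    expect p (fun a => if a ∈ E then x + y else x) = x + y * p.toOuterMeasure E := by
  rw [toOuterMeasure_eq_expect, ← expect_const_mul]
  conv_rhs => rw [← expect_const p x]
  simp only [expect, ← ENNReal.tsum_add, ← mul_add]
  congr 1
  ext a
  split_ifs <;> simp

theorem prob_notMem_uniform_powersetCard (Q : Finset α) (s : ℕ)
    (hs : s ≤ Q.card) {v : α} (hv : v ∈ Q) :
    (PMF.uniformOfFinset (Q.powersetCard s) (Finset.powersetCard_nonempty.2 hs)).toOuterMeasure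
      {A | v ∈ A}ᶜ = 1 - s / Q.card := by
  classical
  obtain ⟨q, hq⟩ : ∃ q, Q.card = q + 1 :=
    ⟨Q.card - 1, (Nat.succ_pred_eq_of_pos (Finset.card_pos.2 ⟨v, hv⟩)).symm⟩
  have avoiding : (Q.powersetCard s).filter (· ∈ ({A | v ∈ A}ᶜ : Set (Finset α))) =
      (Q.erase v).powersetCard s := by
    ext A
    simp only [Finset.mem_filter, Finset.mem_powersetCard, Set.mem_compl_iff, Set.mem_ofPred_eq,
      Finset.subset_erase]
    tauto
  have choose_mul : (q.choose s : ℝ≥0∞) * (q + 1 : ℕ) = ((q + 1).choose s) * (q + 1 - s : ℕ) := by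
    exact_mod_cast Nat.choose_mul_succ_eq q s
  have choose_ne : (((q + 1).choose s : ℕ) : ℝ≥0∞) ≠ 0 := by
    exact_mod_cast (Nat.choose_pos (hq ▸ hs)).ne'
  have succ_ne : ((q + 1 : ℕ) : ℝ≥0∞) ≠ 0 := by exact_mod_cast Nat.succ_ne_zero q
  rw [PMF.toOuterMeasure_uniformOfFinset_apply]
  calc _ = (((Q.erase v).powersetCard s).card : ℝ≥0∞) / (Q.powersetCard s).card := by
        rw [← avoiding]
        congr!
    _ = ((q + 1 - s : ℕ) : ℝ≥0∞) / (q + 1 : ℕ) := by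
        rw [Finset.card_powersetCard, Finset.card_powersetCard, Finset.card_erase_of_mem hv, hq,
          Nat.add_sub_cancel, ENNReal.div_eq_div_iff succ_ne (by simp) choose_ne (by simp),
          mul_comm, choose_mul, mul_comm]
    _ = 1 - s / Q.card := by
        rw [hq, ENNReal.natCast_sub, ENNReal.sub_div (by simp),
          ENNReal.div_self succ_ne (by simp)]

section Product

variable {β : Type*} [Fintype ι] [DecidableEq ι] [Fintype β]

theorem prob_pmfPi_not_atLeast (p : ι → PMF β) (K : Finset ι) (E : ι → Set β) (θ : ℝ≥0∞)
    (h : ∀ i ∈ K, (p i).toOuterMeasure (E i)ᶜ ≤ θ) (s : ℕ) :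
    (pmfPi p).toOuterMeasure {x | ¬ AtLeast s fun i => i ∈ K ∧ x i ∈ E i} ≤
      2 ^ s * (2⁻¹ + 2⁻¹ * θ) ^ K.card := by
  classical
  refine (prob_not_atLeast (pmfPi p) K (fun i x => x i ∈ E i) s).trans ?_
  gcongr
  rw [expect_pmfPi_prod_finset p K fun i b => if b ∈ E i then 2⁻¹ else 1, ← Finset.prod_const]
  refine Finset.prod_le_prod' fun i hi => ?_
  have weight_eq (b : β) : (if b ∈ E i then 2⁻¹ else 1 : ℝ≥0∞) =
      if b ∈ (E i)ᶜ then 2⁻¹ + 2⁻¹ else 2⁻¹ := by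
    by_cases hb : b ∈ E i <;> simp [hb, ENNReal.inv_two_add_inv_two]
  simp only [weight_eq, expect_add_ite_mem]
  gcongr
  exact h i hi

theorem prob_pmfPi_atLeast (p : ι → PMF β) (K : Finset ι) (E : ι → Set β) (θ : ℝ≥0∞)
    (h : ∀ i ∈ K, (p i).toOuterMeasure (E i) ≤ θ) (s : ℕ) :
    (pmfPi p).toOuterMeasure {x | AtLeast s fun i => i ∈ K ∧ x i ∈ E i} ≤
      (2 ^ s)⁻¹ * (1 + θ) ^ K.card := by
  classical
  refine (prob_atLeast (pmfPi p) K (fun i x => x i ∈ E i) s).trans ?_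
  gcongr
  rw [expect_pmfPi_prod_finset p K fun i b => if b ∈ E i then 2 else 1, ← Finset.prod_const]
  refine Finset.prod_le_prod' fun i hi => ?_
  simp only [← one_add_one_eq_two, expect_add_ite_mem, one_mul]
  gcongr
  exact h i hi

theorem prob_pmfPi_coord (p : ι → PMF β) (i : ι) (E : Set β) :
    (pmfPi p).toOuterMeasure {x | x i ∈ E} = (p i).toOuterMeasure E := by
  classical
  simpa only [toOuterMeasure_eq_expect, Set.mem_ofPred_eq, Finset.prod_singleton] using
    expect_pmfPi_prod_finset p {i} fun _ b => if b ∈ E then 1 else 0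

end Product

variable {V : Type*} [Fintype V] [DecidableEq V]

theorem prob_many_failures (q : unitInterval) (N : ℕ) (θ : ℝ≥0∞)
    (hθ : N * ENNReal.ofReal q ≤ θ) (K : Finset V) (s : ℕ) :
    (failures V q N).toOuterMeasure {F | AtLeast s fun u => u ∈ K ∧ ∃ t, F u t = true} ≤
      (2 ^ s)⁻¹ * (1 + θ) ^ K.card := by
  refine prob_pmfPi_atLeast (fun _ : V => pmfPi fun _ : Fin N => coin q) K
    (fun _ => {x | ∃ t, x t = true}) θ (fun _ _ => ?_) s
  refine le_trans ?_ hθ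
  simpa only [Fintype.card_fin, Set.mem_ofPred_eq] using
    prob_exists_le (pmfPi fun _ : Fin N => coin q) (fun t => {x | x t = true}) (ENNReal.ofReal q)
      fun t => ((prob_pmfPi_coord _ t {true}).trans (PMF.toOuterMeasure_apply_singleton _ _)).le

theorem prob_few_selected (P : Params) (st : V → NodeState V) (K : Finset V) (v : V) (M : ℕ)
    (hK : ∀ u ∈ K, v ∈ (st u).filtered P ∧ ((st u).filtered P).card ≤ M) (s : ℕ) :
    (pmfPi fun u => selection P (st u)).toOuterMeasure
        {A | ¬ AtLeast s fun u => u ∈ K ∧ v ∈ A u} ≤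
      2 ^ s * (2⁻¹ + 2⁻¹ * (1 - (4 * P.tau : ℕ) / M)) ^ K.card := by
  refine prob_pmfPi_not_atLeast _ K (fun _ => {A | v ∈ A}) _ (fun u hu => ?_) s
  obtain ⟨v_mem, card_le⟩ := hK u hu
  rw [selection, prob_notMem_uniform_powersetCard _ _ (min_le_right _ _) v_mem]
  rcases le_total (4 * P.tau) ((st u).filtered P).card with h | h
  · rw [min_eq_left h]
    exact tsub_le_tsub_left (by gcongr) 1
  · have card_pos : 0 < ((st u).filtered P).card := Finset.card_pos.2 ⟨v, v_mem⟩
    rw [min_eq_right h, ENNReal.div_self (by exact_mod_cast card_pos.ne') (by simp), tsub_self]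
    exact zero_le

variable (G : SimpleGraph V) {N : ℕ} (F : Schedule V N)

theorem prob_few_draws (K : Finset V) (hK : ∀ u ∈ K, ∀ t, Alive F u t) (v : V)
    (L H : ℝ≥0∞) (r : ℕ) (c : Config V)
    (hv : ∀ u ∈ K, v ∈ (c.st u).hatB ∧ (((c.st u).pos v + 1 : ℕ) : ℝ≥0∞) ≤ L ∧
      totalWeight (c.st u).hatB (c.st u).pos ≤ H) (s : ℕ) :
    (iterate (drawRound G F) r c).toOuterMeasure
        {c' | ¬ AtLeast s fun u => u ∈ K ∧ v ∉ (c'.st u).hatB} ≤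
      2 ^ s * (2⁻¹ + 2⁻¹ * (1 - L⁻¹ * H⁻¹) ^ r) ^ K.card := by
  refine (prob_not_atLeast _ K (fun u (c' : Config V) => v ∉ (c'.st u).hatB) s).trans ?_
  gcongr
  simpa only [ite_not] using expect_draws_retain_le G F K hK (fun _ => v) L H 2⁻¹ 2⁻¹
    ENNReal.inv_two_add_inv_two r c hv

theorem prob_no_draw (u : V) (hu : ∀ t, Alive F u t) (v : V) (L H : ℝ≥0∞) (r : ℕ) (c : Config V)
    (hv : v ∈ (c.st u).hatB ∧ (((c.st u).pos v + 1 : ℕ) : ℝ≥0∞) ≤ L ∧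
      totalWeight (c.st u).hatB (c.st u).pos ≤ H) :
    (iterate (drawRound G F) r c).toOuterMeasure {c' | v ∈ (c'.st u).hatB} ≤
      (1 - L⁻¹ * H⁻¹) ^ r := by
  have retain_le := expect_draws_retain_le G F {u} (by simpa using hu) (fun _ => v) L H 0 1
    (zero_add 1) r c (by simpa using hv)
  simp only [Finset.prod_singleton, zero_add, one_mul, Finset.card_singleton, pow_one]
    at retain_le
  refine le_trans (prob_le_expect _ _ _ fun c' _ hc' => ?_) retain_le
  rw [Set.mem_ofPred_eq] at hc'
  exact (if_pos hc').ge

theorem prob_many_draws (K : Finset V) (v : V → V) (r : ℕ) (c : Config V) (b : ℝ≥0∞)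
    (hv : ∀ u ∈ K, v u ∈ (c.st u).hatB ∧ ((c.st u).pos = fun _ => 0) ∧
      b ≤ ((c.st u).hatB.card : ℝ≥0∞)) (s : ℕ) :
    (iterate (drawRound G F) r c).toOuterMeasure
        {c' | AtLeast s fun u => u ∈ K ∧ v u ∉ (c'.st u).hatB} ≤
      (2 ^ s)⁻¹ * (1 + r * b⁻¹) ^ K.card := by
  refine (prob_atLeast _ K (fun u (c' : Config V) => v u ∉ (c'.st u).hatB) s).trans ?_
  gcongr
  calc _ ≤ ∏ u ∈ K, (1 + r * ((c.st u).hatB.card : ℝ≥0∞)⁻¹) := by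
        simpa only [ite_not] using expect_draws_loss_le G F K v r c
          fun u hu => ⟨(hv u hu).1, (hv u hu).2.1⟩
    _ ≤ ∏ _u ∈ K, (1 + r * b⁻¹) := Finset.prod_le_prod' fun u hu => by
        gcongr
        exact (hv u hu).2.2
    _ = (1 + r * b⁻¹) ^ K.card := Finset.prod_const _

end Tails

/-! ### Random and ranking phases -/

section Start

variable {V : Type*} [Fintype V] [DecidableEq V] {G : SimpleGraph V} {N : ℕ} {F : Schedule V N}

theorem Sound.of_eq {c c' : Config V} (h : Sound G F c) (ht : c.time ≤ c'.time)
    (hS : ∀ u, (c'.st u).S = (c.st u).S) (hcnt : ∀ u, (c'.st u).cnt = (c.st u).cnt)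
    (hR : ∀ u, (c.st u).R ⊆ (c'.st u).R)
    (ho : ∀ u, Alive F u c'.time → ∀ v ∈ (c'.st u).R, Alive F v 0) : Sound G F c' where
  cnt u hu v := by
    rw [hcnt, h.cnt u (hu.mono ht) v]
    congr 2
    ext w
    simp [hS]
  known u hu w hw := by
    rw [hS]
    exact (h.known u (hu.mono ht) w hw).trans (hR u)
  self u := hR u (h.self u)
  origin := ho
  sent u := by
    rw [hS]
    exact h.sent u
  own u := by
    rw [hS]
    exact h.own u

theorem afterRoundZero_sel (u : V) : ((afterRoundZero G F).st u).sel = none := by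
  by_cases hu : Alive F u 0 <;>
    simp [afterRoundZero, Config.round, NodeState.sync, initState, hu]

theorem mem_afterRoundZero_S {u v : V} :
    v ∈ ((afterRoundZero G F).st u).S ↔ Alive F u 0 ∧ v = u := by
  by_cases hu : Alive F u 0 <;>
    simp [afterRoundZero, Config.round, NodeState.sync, initState, hu, eq_comm]

theorem mem_afterRoundZero_R {u v : V} (hu : Alive F u 0) :
    v ∈ ((afterRoundZero G F).st u).R ↔ v = u ∨ (G.Adj u v ∧ Alive F v 0) := by
  simp only [afterRoundZero, Config.round, NodeState.sync, initState, hu, if_true,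
    Finset.mem_union, Finset.mem_singleton, Finset.mem_filter, Finset.mem_univ, true_and,
    received_pos, Option.ite_none_right_eq_some, Option.some.injEq]
  refine or_congr_right ⟨?_, fun h => ⟨v, h.1, h.2, rfl⟩⟩
  rintro ⟨w, hw, hw0, rfl⟩
  exact ⟨hw, hw0⟩

theorem eq_or_adj_of_mem_afterRoundZero_R {u v : V} (h : v ∈ ((afterRoundZero G F).st u).R) :
    v = u ∨ (G.Adj u v ∧ Alive F v 0) := by
  by_cases hu : Alive F u 0
  · exact (mem_afterRoundZero_R hu).1 h
  · left
    simpa [afterRoundZero, Config.round, initState, hu] using h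

theorem self_mem_afterRoundZero_R (u : V) : u ∈ ((afterRoundZero G F).st u).R := by
  by_cases hu : Alive F u 0 <;>
    simp [afterRoundZero, Config.round, NodeState.sync, initState, hu]

open Classical in
theorem afterRoundZero_cnt {u : V} (hu : Alive F u 0) (v : V) :
    ((afterRoundZero G F).st u).cnt v = (if v = u then 1 else 0) +
      (Finset.univ.filter fun w => G.Adj u w ∧ v ∈ ((afterRoundZero G F).st w).S).card := by
  simp only [afterRoundZero, Config.round, NodeState.sync, initState, received, hu, if_true]
  congr! 4 with w
  by_cases hw : Alive F w 0 <;> simp [hw, eq_comm]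

theorem sound_afterRoundZero : Sound G F (afterRoundZero G F) := by
  have alive_zero {u : V} (hu : Alive F u (afterRoundZero G F).time) : Alive F u 0 :=
    hu.mono (Nat.zero_le _)
  refine ⟨fun u hu => afterRoundZero_cnt (alive_zero hu), fun u hu w hw v hv => ?_,
    self_mem_afterRoundZero_R, fun u hu v hv => ?_, fun u v hv => ?_,
    fun u hu => mem_afterRoundZero_S.2 ⟨hu, rfl⟩⟩
  · obtain ⟨hw0, rfl⟩ := mem_afterRoundZero_S.1 hv
    exact (mem_afterRoundZero_R (alive_zero hu)).2 (Or.inr ⟨hw, hw0⟩)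
  · rcases eq_or_adj_of_mem_afterRoundZero_R hv with rfl | ⟨-, hv0⟩
    · exact alive_zero hu
    · exact hv0
  · obtain ⟨hu0, rfl⟩ := mem_afterRoundZero_S.1 hv
    exact hu0

theorem Sound.startRandom {c : Config V} (h : Sound G F c) :
    Sound G F (c.locally fun _ _ => NodeState.startRandom) :=
  h.of_eq le_rfl (fun _ => rfl) (fun _ => rfl) (fun _ => subset_rfl) h.origin

theorem drawInv_randomPhase {P : Params} {c : Config V}
    (hc : c ∈ (randomPhase G P F (afterRoundZero G F)).support) :
    DrawInv G F ((afterRoundZero G F).locally fun _ _ => NodeState.startRandom) c :=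
  drawInv_of_mem_support sound_afterRoundZero.startRandom (fun _ => Finset.sdiff_disjoint)
    (fun _ _ => Finset.sdiff_subset) hc

end Start

section RankingLists

variable {V : Type*} [DecidableEq V]

theorem NodeState.rankingBuffer_subset_B (P : Params) (s : NodeState V) :
    s.rankingBuffer P ⊆ s.B := by
  unfold NodeState.rankingBuffer
  split
  · exact subset_rfl
  · exact Finset.filter_subset _ _

/-- The order of the ranking list compares these keys lexicographically. -/
def NodeState.rankKey (s : NodeState V) (key : V ↪ ℕ) (m : V) : ℕ ×ₗ (ℕ ×ₗ ℕ) :=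
  toLex (if m ∈ s.sel.getD ∅ then 0 else 1, toLex (s.cnt m, key m))

theorem NodeState.precedes_iff (s : NodeState V) (key : V ↪ ℕ) (m m' : V) :
    s.Precedes key m m' ↔ s.rankKey key m < s.rankKey key m' := by
  simp only [NodeState.Precedes, NodeState.rankKey, Prod.Lex.lt_iff, ofLex_toLex]

theorem NodeState.rankKey_injective (s : NodeState V) (key : V ↪ ℕ) :
    (s.rankKey key).Injective := by
  intro m m' h
  simp only [NodeState.rankKey, EmbeddingLike.apply_eq_iff_eq, Prod.mk.injEq] at h
  exact h.2.2

theorem NodeState.startRanking_pos_lt {P : Params} {key : V ↪ ℕ} {s : NodeState V} {m : V}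
    {Z : Finset V} (hm : m ∈ Z)
    (hZ : ∀ m' ∈ s.rankingBuffer P, s.Precedes key m' m → m' ∈ Z) :
    (s.startRanking P key).pos m < Z.card := by
  classical
  refine Finset.card_lt_card ((Finset.ssubset_iff_of_subset fun m' hm' => ?_).2
    ⟨m, hm, fun h => ?_⟩)
  · rw [Finset.mem_filter] at hm'
    exact hZ m' hm'.1 hm'.2
  · rw [Finset.mem_filter, NodeState.precedes_iff] at h
    exact lt_irrefl _ h.2

theorem NodeState.startRanking_pos_lt_pos {P : Params} {key : V ↪ ℕ} {s : NodeState V} {m m' : V}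
    (hm : m ∈ s.rankingBuffer P) (h : s.rankKey key m < s.rankKey key m') :
    (s.startRanking P key).pos m < (s.startRanking P key).pos m' := by
  classical
  refine NodeState.startRanking_pos_lt (Finset.mem_filter.2 ⟨hm, (s.precedes_iff key _ _).2 h⟩)
    fun x hx hxm => Finset.mem_filter.2 ⟨hx, ?_⟩
  rw [NodeState.precedes_iff] at hxm ⊢
  exact hxm.trans h

theorem NodeState.startRanking_pos_injOn {P : Params} {key : V ↪ ℕ} {s : NodeState V} :
    Set.InjOn (s.startRanking P key).pos (s.rankingBuffer P) := by
  intro m hm m' hm' h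
  rcases lt_trichotomy (s.rankKey key m) (s.rankKey key m') with hlt | heq | hgt
  · exact absurd h (NodeState.startRanking_pos_lt_pos hm hlt).ne
  · exact s.rankKey_injective key heq
  · exact absurd h (NodeState.startRanking_pos_lt_pos hm' hgt).ne'

variable [Fintype V]

/-- The `n`-th harmonic number, as an extended nonnegative real. -/
noncomputable def harmonicSum (n : ℕ) : ℝ≥0∞ := ∑ i ∈ Finset.range n, ((i + 1 : ℕ) : ℝ≥0∞)⁻¹

theorem totalWeight_startRanking_le (P : Params) (key : V ↪ ℕ) (s : NodeState V) :
    totalWeight (s.startRanking P key).hatB (s.startRanking P key).pos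
      ≤ harmonicSum (Fintype.card V) := by
  classical
  change ∑ m ∈ s.rankingBuffer P, _ ≤ _
  rw [harmonicSum, ← Finset.sum_image (f := fun i : ℕ => ((i + 1 : ℕ) : ℝ≥0∞)⁻¹)
    (NodeState.startRanking_pos_injOn (P := P) (key := key) (s := s))]
  refine Finset.sum_le_sum_of_subset fun i hi => ?_
  obtain ⟨m, hm, rfl⟩ := Finset.mem_image.1 hi
  exact Finset.mem_range.2 ((NodeState.startRanking_pos_lt hm fun m' hm' _ => hm').trans_le
    (Finset.card_le_univ _))

variable {G : SimpleGraph V} {N : ℕ} {F : Schedule V N}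

theorem Sound.startRanking {P : Params} {ρ : Rules V} {c : Config V} (h : Sound G F c) :
    Sound G F (c.locally fun u t s => s.startRanking P (ρ.tie u t s)) :=
  h.of_eq le_rfl (fun _ => rfl) (fun _ => rfl) (fun _ => subset_rfl) h.origin

theorem drawInv_rankingPhase {P : Params} {ρ : Rules V} {c c' : Config V} (h : Sound G F c)
    (hc : c' ∈ (rankingPhase G P ρ F c).support) :
    DrawInv G F (c.locally fun u t s => s.startRanking P (ρ.tie u t s)) c' :=
  drawInv_of_mem_support h.startRanking
    (fun u => Finset.disjoint_of_subset_left ((c.st u).rankingBuffer_subset_B P)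
      Finset.sdiff_disjoint)
    (fun u _ => ((c.st u).rankingBuffer_subset_B P).trans Finset.sdiff_subset) hc

/-- A set `Z u` of at most `L` messages that is closed under predecessors in the ranking list lies
among its first `L` messages, each of which is drawn with probability at least `1 / (L H_n)` per
round. -/
theorem prob_rankingPhase_missing (P : Params) (ρ : Rules V) (c : Config V) (Z : V → Finset V)
    (L : ℕ) (e : ℝ≥0∞) (U : Finset V) (hU : ∀ u ∈ U, ∀ t, Alive F u t)
    (hZ : ∀ u ∈ U, Z u ⊆ (c.st u).rankingBuffer P ∧ (Z u).card ≤ L ∧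
      ∀ key : V ↪ ℕ, ∀ m ∈ Z u, ∀ m' ∈ (c.st u).rankingBuffer P,
        (c.st u).Precedes key m' m → m' ∈ Z u)
    (hsound : Sound G F c)
    (he : (1 - (L : ℝ≥0∞)⁻¹ * (harmonicSum (Fintype.card V))⁻¹) ^ P.tau' ≤ e) :
    (rankingPhase G P ρ F c).toOuterMeasure {c' | ∃ u ∈ U, ¬ Z u ⊆ (c'.st u).S} ≤
      (Fintype.card V * Fintype.card V : ℕ) * e := by
  let c₀ := c.locally fun u t s => s.startRanking P (ρ.tie u t s)
  have stays_le : ∀ x : V × V, x.1 ∈ U ∧ x.2 ∈ Z x.1 →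
      (rankingPhase G P ρ F c).toOuterMeasure {c' | x.2 ∈ (c'.st x.1).hatB} ≤ e := by
    rintro ⟨u, v⟩ ⟨hu, hv⟩
    obtain ⟨subset, card_le, closed⟩ := hZ u hu
    have rank_lt : (c₀.st u).pos v < (Z u).card :=
      NodeState.startRanking_pos_lt hv (closed _ v hv)
    have rank_le : (c₀.st u).pos v + 1 ≤ L := (Nat.succ_le_of_lt rank_lt).trans card_le
    exact (prob_no_draw G F u (hU u hu) v L _ P.tau' c₀
      ⟨subset hv, mod_cast rank_le, totalWeight_startRanking_le P _ _⟩).trans he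
  rw [← Fintype.card_prod]
  refine le_trans (prob_mono _ ?_) (prob_exists_and_le _ _ _ e stays_le)
  rintro c' hc' ⟨u, hu, missing⟩
  obtain ⟨v, hv, hvS⟩ := Finset.not_subset.1 missing
  refine ⟨(u, v), ⟨hu, hv⟩, ?_⟩
  rw [Set.mem_ofPred_eq, (drawInv_rankingPhase hsound hc').hatB_eq u, Finset.mem_sdiff]
  exact ⟨(hZ u hu).1 hv, hvS⟩

end RankingLists

/-! ### Shuffle phases -/

section Shuffle

theorem shuffleMessage_mem {V : Type*} {key : V ↪ ℕ} {u : V} {s : NodeState V}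
    (h : s.hatB.Nonempty) : shuffleMessage key u s ∈ s.hatB := by
  rw [shuffleMessage, dif_pos h]
  exact (s.hatB.exists_min_image key h).choose_spec.1

theorem shuffleMessage_mem_or_eq {V : Type*} (key : V ↪ ℕ) (u : V) (s : NodeState V) :
    shuffleMessage key u s ∈ s.hatB ∨ shuffleMessage key u s = u := by
  by_cases h : s.hatB.Nonempty
  · exact Or.inl (shuffleMessage_mem h)
  · exact Or.inr (by rw [shuffleMessage, dif_neg h])

variable {V : Type*} [Fintype V] [DecidableEq V] {G : SimpleGraph V} {N : ℕ} {F : Schedule V N}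
  {ρ : Rules V} {out : V → Option V} {c₀ c c' : Config V} {r : ℕ}

/-- The effect of a round of a shuffle phase in which the nodes send the messages `out`. -/
structure ShuffleStep (G : SimpleGraph V) (F : Schedule V N) (out : V → Option V)
    (c c' : Config V) : Prop where
  time : c'.time = c.time + 1
  R_eq : ∀ u, (c'.st u).R = (c.st u).R
  S_eq : ∀ u, (c'.st u).S = (c.st u).S
  cnt_eq : ∀ u, (c'.st u).cnt = (c.st u).cnt
  hatB_eq : ∀ u, (c'.st u).hatB = (c.st u).hatB \ (out u).toFinset
  phasecnt_alive : ∀ u, Alive F u c.time → ∀ v,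
    (c'.st u).phasecnt v = (c.st u).phasecnt v + received G out u v
  phasecnt_failed : ∀ u, ¬ Alive F u c.time → (c'.st u).phasecnt = (c.st u).phasecnt
  alive_of_sent : ∀ {u v}, out u = some v → Alive F u c.time
  mem_or_eq_of_sent : ∀ {u v}, out u = some v → v ∈ (c.st u).hatB ∨ v = u
  exists_pop : ∀ u, Alive F u c.time → (c.st u).hatB.Nonempty → ∃ m ∈ (c.st u).hatB, out u = some m

theorem exists_shuffleStep (G : SimpleGraph V) (F : Schedule V N) (ρ : Rules V) (c : Config V) :
    ∃ out, ShuffleStep G F out c (shuffleRound G ρ F c) := by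
  classical
  let msg : V → V := fun u => shuffleMessage (ρ.pop u c.time (c.st u)) u (c.st u)
  refine ⟨fun u => if Alive F u c.time then some (msg u) else none, rfl, fun u => ?_, fun u => ?_,
    fun u => ?_, fun u => ?_, fun u hu v => ?_, fun u hu => ?_, fun {u v} h => ?_,
    fun {u v} h => ?_, fun u hu hB => ⟨msg u, shuffleMessage_mem hB, if_pos hu⟩⟩
  case refine_7 =>
    by_contra hu
    exact Option.some_ne_none v (h.symm.trans (if_neg hu))
  case refine_8 =>
    obtain rfl : msg u = v := Option.some_injective _ (Option.ite_none_right_eq_some.1 h).2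
    exact shuffleMessage_mem_or_eq _ u _
  all_goals
    by_cases hu : Alive F u c.time <;>
      simp_all [shuffleRound, Config.round, NodeState.syncShuffle, msg]

theorem ShuffleStep.mem_hatB_iff (h : ShuffleStep G F out c c') {u v : V} :
    v ∈ (c'.st u).hatB ↔ v ∈ (c.st u).hatB ∧ out u ≠ some v := by
  rw [h.hatB_eq, Finset.mem_sdiff, Option.mem_toFinset, Option.mem_def]

theorem ShuffleStep.hatB_subset (h : ShuffleStep G F out c c') (u : V) :
    (c'.st u).hatB ⊆ (c.st u).hatB := by
  rw [h.hatB_eq]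
  exact Finset.sdiff_subset

theorem ShuffleStep.card_hatB_le (h : ShuffleStep G F out c c') {u : V}
    (hu : Alive F u c.time) : (c'.st u).hatB.card ≤ (c.st u).hatB.card - 1 := by
  rcases (c.st u).hatB.eq_empty_or_nonempty with empty | nonempty
  · exact (Finset.card_le_card (h.hatB_subset u)).trans (by rw [empty, Finset.card_empty])
  · obtain ⟨m, hm, sent⟩ := h.exists_pop u hu nonempty
    rw [h.hatB_eq, sent, Option.toFinset_some, Finset.sdiff_singleton_eq_erase,
      Finset.card_erase_of_mem hm]

open Classical in
/-- The neighbours of `w` whose buffer lost `m_v` between the configurations `c` and `c'`. -/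
noncomputable def popped (G : SimpleGraph V) (w v : V) (c c' : Config V) : Finset V :=
  Finset.univ.filter fun u => G.Adj w u ∧ v ∈ (c.st u).hatB ∧ v ∉ (c'.st u).hatB

theorem mem_popped {u v w : V} :
    u ∈ popped G w v c c' ↔ G.Adj w u ∧ v ∈ (c.st u).hatB ∧ v ∉ (c'.st u).hatB := by
  simp only [popped, Finset.mem_filter, Finset.mem_univ, true_and]

theorem card_popped_add_card_popped (G : SimpleGraph V) (w v : V)
    (h : ∀ u, (c.st u).hatB ⊆ (c₀.st u).hatB) (h' : ∀ u, (c'.st u).hatB ⊆ (c.st u).hatB) :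
    (popped G w v c₀ c).card + (popped G w v c c').card = (popped G w v c₀ c').card := by
  classical
  rw [← Finset.card_union_of_disjoint]
  · congr 1
    ext u
    have := @h u v
    have := @h' u v
    simp only [Finset.mem_union, mem_popped]
    tauto
  · refine Finset.disjoint_left.2 fun u hu hu' => ?_
    rw [mem_popped] at hu hu'
    exact hu.2.2 hu'.2.1

theorem ShuffleStep.card_popped_le_received (h : ShuffleStep G F out c c') (w v : V) :
    (popped G w v c c').card ≤ received G out w v := by
  classical
  refine Finset.card_le_card fun u hu => ?_
  rw [mem_popped, h.mem_hatB_iff] at hu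
  simp only [Finset.mem_filter, Finset.mem_univ, true_and]
  tauto

open Classical in
theorem ShuffleStep.received_le (h : ShuffleStep G F out c c') (w v : V) :
    received G out w v ≤
      (popped G w v c c').card + if G.Adj w v ∧ Alive F v c.time then 1 else 0 := by
  have own_message : (if G.Adj w v ∧ Alive F v c.time then 1 else 0) =
      (if G.Adj w v ∧ Alive F v c.time then {v} else ∅ : Finset V).card := by
    split_ifs <;> simp
  rw [own_message, received]
  refine le_trans (Finset.card_le_card fun u hu => ?_) (Finset.card_union_le _ _)
  simp only [Finset.mem_filter, Finset.mem_univ, true_and] at hu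
  obtain ⟨adj, sent⟩ := hu
  rw [Finset.mem_union]
  rcases h.mem_or_eq_of_sent sent with mem | rfl
  · exact Or.inl (mem_popped.2 ⟨adj, mem, fun mem' => (h.mem_hatB_iff.1 mem').2 sent⟩)
  · right
    rw [if_pos ⟨adj, h.alive_of_sent sent⟩]
    exact Finset.mem_singleton_self _

open Classical in
/-- The relation between the start `c₀` of a shuffle phase and the configuration `c` after `r`
rounds of this phase: a message popped from a buffer is counted by all working neighbours, and the
only other messages that are counted are the own messages of the neighbours. -/
structure ShuffleInv (G : SimpleGraph V) (F : Schedule V N) (c₀ : Config V) (r : ℕ)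
    (c : Config V) : Prop where
  time : c.time = c₀.time + r
  R_eq : ∀ u, (c.st u).R = (c₀.st u).R
  S_eq : ∀ u, (c.st u).S = (c₀.st u).S
  cnt_eq : ∀ u, (c.st u).cnt = (c₀.st u).cnt
  hatB_sub : ∀ u, (c.st u).hatB ⊆ (c₀.st u).hatB
  hatB_card : ∀ u, (∀ t, Alive F u t) → (c.st u).hatB.card ≤ (c₀.st u).hatB.card - r
  alive : ∀ u, ∀ v ∈ (c₀.st u).hatB, v ∉ (c.st u).hatB → Alive F u c₀.time
  lower : ∀ w, Alive F w c.time → ∀ v,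
    (c₀.st w).phasecnt v + (popped G w v c₀ c).card ≤ (c.st w).phasecnt v
  upper : ∀ w v, (c.st w).phasecnt v ≤ (c₀.st w).phasecnt v + (popped G w v c₀ c).card +
    if G.Adj w v ∧ Alive F v c₀.time then r else 0

theorem ShuffleInv.refl (G : SimpleGraph V) (F : Schedule V N) (c : Config V) :
    ShuffleInv G F c 0 c := by
  have popped_self (w v : V) : popped G w v c c = ∅ :=
    Finset.eq_empty_of_forall_notMem fun u hu => (mem_popped.1 hu).2.2 (mem_popped.1 hu).2.1
  exact ⟨rfl, fun _ => rfl, fun _ => rfl, fun _ => rfl, fun _ => subset_rfl, fun _ _ => le_rfl,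
    fun u v h h' => absurd h h', fun w _ v => by simp [popped_self],
    fun w v => by simp [popped_self]⟩

open Classical in
theorem ShuffleInv.phasecnt_step_le (h : ShuffleInv G F c₀ r c) (hstep : ShuffleStep G F out c c')
    (w v : V) :
    (c'.st w).phasecnt v ≤ (c₀.st w).phasecnt v + (popped G w v c₀ c').card +
      if G.Adj w v ∧ Alive F v c₀.time then r + 1 else 0 := by
  have upper := h.upper w v
  have card_popped := card_popped_add_card_popped G w v h.hatB_sub hstep.hatB_subset
  by_cases hw : Alive F w c.time
  · have received_le := hstep.received_le w v
    have own_le : (if G.Adj w v ∧ Alive F v c.time then 1 else 0) ≤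
        if G.Adj w v ∧ Alive F v c₀.time then 1 else 0 := by
      have alive_mono : Alive F v c.time → Alive F v c₀.time :=
        fun hv => hv.mono (h.time ▸ Nat.le_add_right _ _)
      split_ifs <;> simp_all
    rw [hstep.phasecnt_alive w hw v]
    split_ifs at upper own_le received_le ⊢ <;> omega
  · rw [hstep.phasecnt_failed w hw]
    split_ifs at upper ⊢ <;> omega

theorem ShuffleInv.step (h : ShuffleInv G F c₀ r c) (hstep : ShuffleStep G F out c c') :
    ShuffleInv G F c₀ (r + 1) c' where
  time := by rw [hstep.time, h.time, add_assoc]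
  R_eq u := (hstep.R_eq u).trans (h.R_eq u)
  S_eq u := (hstep.S_eq u).trans (h.S_eq u)
  cnt_eq u := (hstep.cnt_eq u).trans (h.cnt_eq u)
  hatB_sub u := (hstep.hatB_subset u).trans (h.hatB_sub u)
  hatB_card u hu := by
    have := h.hatB_card u hu
    have := hstep.card_hatB_le (hu c.time)
    omega
  alive u v hv hv' := by
    by_cases mem : v ∈ (c.st u).hatB
    · have sent : out u = some v := by
        by_contra not_sent
        exact hv' (hstep.mem_hatB_iff.2 ⟨mem, not_sent⟩)
      exact (hstep.alive_of_sent sent).mono (h.time ▸ Nat.le_add_right _ _)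
    · exact h.alive u v hv mem
  lower w hw v := by
    have hw' : Alive F w c.time := hw.mono (hstep.time ▸ Nat.le_succ _)
    have := h.lower w hw' v
    have := hstep.card_popped_le_received w v
    have := card_popped_add_card_popped G w v h.hatB_sub hstep.hatB_subset
    rw [hstep.phasecnt_alive w hw' v]
    omega
  upper w v := h.phasecnt_step_le hstep w v

theorem shuffleInv_iterate (c₀ : Config V) (r : ℕ) :
    ShuffleInv G F c₀ r ((shuffleRound G ρ F)^[r] c₀) := by
  induction r with
  | zero => exact ShuffleInv.refl G F c₀
  | succ r ih =>
    rw [Function.iterate_succ_apply']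
    obtain ⟨out, hstep⟩ := exists_shuffleStep G F ρ ((shuffleRound G ρ F)^[r] c₀)
    exact ih.step hstep

open Classical in
/-- The fresh messages of `B_u`. -/
noncomputable def NodeState.fresh (P : Params) (s : NodeState V) : Finset V :=
  s.B.filter fun m => (s.cnt m : ℝ) < P.T

open Classical in
/-- What surely holds between the end `c` of a ranking phase and the end `c'` of the rounds of the
following shuffle phase: `lower` guarantees that `m_v` is counted once for every reliable neighbour
that can pop its whole buffer, and `upper` bounds the count of a message whose origin is not a
working neighbour. -/
structure ShuffleEnd (G : SimpleGraph V) (F : Schedule V N) (P : Params) (c c' : Config V) :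
    Prop where
  time : c'.time = c.time + 8 * P.tau
  R_eq : ∀ u, (c'.st u).R = (c.st u).R
  S_eq : ∀ u, (c'.st u).S = (c.st u).S
  cnt_eq : ∀ u, (c'.st u).cnt = (c.st u).cnt
  lower : ∀ w, Alive F w c'.time → ∀ v, ∀ D : Finset V,
    (∀ u ∈ D, (u = w ∨ G.Adj w u) ∧ (∀ t, Alive F u t) ∧ v ∈ (c.st u).fresh P ∧
      ((c.st u).fresh P).card ≤ 8 * P.tau) → D.card ≤ (c'.st w).phasecnt v
  upper : ∀ w v, ¬ (G.Adj w v ∧ Alive F v c.time) → (c'.st w).phasecnt v ≤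
    (if v ∈ (c.st w).fresh P then 1 else 0) +
    (Finset.univ.filter fun u => G.Adj w u ∧ Alive F u c.time ∧ v ∈ (c.st u).fresh P).card

theorem ShuffleInv.card_le_phasecnt {P : Params} {r : ℕ}
    (h : ShuffleInv G F (c.locally fun _ _ => NodeState.startShuffle P) r c') {w : V}
    (hw : Alive F w c'.time) {v : V} {D : Finset V}
    (hD : ∀ u ∈ D, (u = w ∨ G.Adj w u) ∧ (∀ t, Alive F u t) ∧ v ∈ (c.st u).fresh P ∧
      ((c.st u).fresh P).card ≤ r) : D.card ≤ (c'.st w).phasecnt v := by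
  have initial : ((c.locally fun _ _ => NodeState.startShuffle P).st w).phasecnt v =
      if v ∈ (c.st w).fresh P then 1 else 0 := rfl
  have popped_of_mem : D.erase w ⊆
      popped G w v (c.locally fun _ _ => NodeState.startShuffle P) c' := by
    intro u hu
    obtain ⟨ne, hu⟩ := Finset.mem_erase.1 hu
    obtain ⟨adj, alive, fresh, card_le⟩ := hD u hu
    have buffer_empty : (c'.st u).hatB = ∅ := by
      rw [← Finset.card_eq_zero, ← Nat.le_zero]
      exact (h.hatB_card u alive).trans (Nat.sub_eq_zero_of_le card_le).le
    exact mem_popped.2 ⟨adj.resolve_left ne, fresh, buffer_empty ▸ Finset.notMem_empty v⟩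
  refine le_trans ?_ ((Nat.add_le_add_left (Finset.card_le_card popped_of_mem) _).trans
    (h.lower w hw v))
  by_cases hwD : w ∈ D
  · rw [initial, if_pos (hD w hwD).2.2.1, Finset.card_erase_of_mem hwD]
    omega
  · rw [Finset.erase_eq_of_notMem hwD]
    exact Nat.le_add_left _ _

theorem shuffleEnd_of_iterate (P : Params) (c : Config V) :
    ShuffleEnd G F P c
      ((shuffleRound G ρ F)^[8 * P.tau] (c.locally fun _ _ => NodeState.startShuffle P)) := by
  classical
  have h := shuffleInv_iterate (G := G) (F := F) (ρ := ρ)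
    (c.locally fun _ _ => NodeState.startShuffle P) (8 * P.tau)
  refine ⟨h.time, h.R_eq, h.S_eq, h.cnt_eq, fun w hw v D hD => h.card_le_phasecnt hw hD,
    fun w v hv => ?_⟩
  have upper := h.upper w v
  rw [if_neg (by exact hv), add_zero] at upper
  refine upper.trans (Nat.add_le_add_left (Finset.card_le_card fun u hu => ?_) _)
  obtain ⟨adj, fresh, removed⟩ := mem_popped.1 hu
  simp only [Finset.mem_filter, Finset.mem_univ, true_and]
  exact ⟨adj, h.alive u v fresh removed, fresh⟩

end Shuffle

theorem mem_support_selection {V : Type*} [Fintype V] {P : Params} {s : NodeState V}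
    {A : Finset V} (h : A ∈ (selection P s).support) : A ⊆ s.filtered P ∧ A.card ≤ 4 * P.tau := by
  rw [selection, PMF.mem_support_uniformOfFinset_iff, Finset.mem_powersetCard] at h
  exact ⟨h.1, h.2.le.trans (min_le_left _ _)⟩

/-! ### The path of cliques -/

section CliquePath

/-- The distance between the `i`-th and the `j`-th clique along the path of cliques. -/
def sep {m : ℕ} (i j : Fin m) : ℕ := Nat.dist i j

variable {m k : ℕ}

theorem sep_self (i : Fin m) : sep i i = 0 := Nat.dist_self _

theorem eq_of_sep_eq_zero {i j : Fin m} (h : sep i j = 0) : i = j :=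
  Fin.ext (Nat.eq_of_dist_eq_zero h)

theorem sep_comm (i j : Fin m) : sep i j = sep j i := Nat.dist_comm _ _

theorem sep_triangle (i j l : Fin m) : sep i l ≤ sep i j + sep j l :=
  Nat.dist.triangle_inequality _ _ _

theorem exists_sep_eq_one_sep_eq {i j : Fin m} {p : ℕ} (h : sep i j = p + 1) :
    ∃ l, sep i l = 1 ∧ sep l j = p := by
  simp only [sep, Nat.dist] at h ⊢
  rcases le_total (i : ℕ) j with hij | hij
  · exact ⟨⟨i + 1, by omega⟩, by simp only; omega, by simp only; omega⟩
  · exact ⟨⟨i - 1, by omega⟩, by simp only; omega, by simp only; omega⟩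

theorem eq_of_sep_add_sep_eq {i j l l' : Fin m} (h : sep i l = sep i l')
    (hl : sep i l + sep l j = sep i j) (hl' : sep i l' + sep l' j = sep i j) : l = l' := by
  simp only [sep, Nat.dist] at h hl hl'
  exact Fin.ext (by omega)

open Classical in
theorem card_sep_eq_le (i : Fin m) (p : ℕ) :
    (Finset.univ.filter fun l : Fin m => sep i l = p).card ≤ 2 := by
  refine le_trans (Finset.card_le_card_of_injOn (fun l : Fin m => (l : ℕ))
    (t := {(i : ℕ) + p, (i : ℕ) - p}) ?_ fun l _ l' _ h => Fin.ext h) Finset.card_le_two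
  intro l hl
  have sep_eq := (Finset.mem_filter.1 (Finset.mem_coe.1 hl)).2
  simp only [sep, Nat.dist] at sep_eq
  simp only [Finset.coe_insert, Finset.coe_singleton, Set.mem_insert_iff, Set.mem_singleton_iff]
  omega

open Classical in
theorem card_clique_sep_eq_le (i : Fin m) (p : ℕ) :
    (Finset.univ.filter fun v : Fin m × Fin k => sep i v.1 = p).card ≤ 2 * k := by
  have cliques : (Finset.univ.filter fun v : Fin m × Fin k => sep i v.1 = p) =
      (Finset.univ.filter fun l : Fin m => sep i l = p) ×ˢ Finset.univ := by
    ext v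
    simp
  rw [cliques, Finset.card_product, Finset.card_univ, Fintype.card_fin]
  exact Nat.mul_le_mul_right _ (card_sep_eq_le i p)

theorem adj_iff {x y : Fin m × Fin k} : (cliquePath m k).Adj x y ↔
    (x.1 = y.1 ∧ x.2 ≠ y.2) ∨ (x.2 = y.2 ∧ sep x.1 y.1 = 1) := by
  simp only [cliquePath, sep, Nat.dist]
  refine or_congr Iff.rfl (and_congr Iff.rfl ?_)
  omega

theorem adj_of_sep_eq_one {i l : Fin m} (h : sep i l = 1) (a : Fin k) :
    (cliquePath m k).Adj (i, a) (l, a) := adj_iff.2 (Or.inr ⟨rfl, h⟩)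

theorem sep_le_one_of_adj {x y : Fin m × Fin k} (h : (cliquePath m k).Adj x y) :
    sep x.1 y.1 ≤ 1 := by
  rcases adj_iff.1 h with ⟨same, -⟩ | ⟨-, sep_eq⟩
  · rw [same, sep_self]
    exact zero_le_one
  · exact sep_eq.le

theorem snd_eq_of_adj {x y : Fin m × Fin k} (h : (cliquePath m k).Adj x y)
    (ne : sep x.1 y.1 ≠ 0) : x.2 = y.2 := by
  rcases adj_iff.1 h with ⟨same, -⟩ | ⟨snd_eq, -⟩
  · exact absurd (same ▸ sep_self x.1) ne
  · exact snd_eq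

open Classical in
theorem card_matched_le (u : Fin m × Fin k) :
    (Finset.univ.filter fun w : Fin m × Fin k => u.2 = w.2 ∧ sep u.1 w.1 = 1).card ≤ 2 := by
  refine le_trans (Finset.card_le_card_of_injOn Prod.fst (fun w hw => ?_) fun w hw w' hw' h => ?_)
    (card_sep_eq_le u.1 1)
  · simp only [Finset.coe_filter, Finset.mem_univ, true_and, Set.mem_ofPred_eq] at hw ⊢
    exact hw.2
  · simp only [Finset.coe_filter, Finset.mem_univ, true_and, Set.mem_ofPred_eq] at hw hw'
    exact Prod.ext h (hw.1.symm.trans hw'.1)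

open Classical in
theorem card_adj_filter_le_three {u : Fin m × Fin k} {a : Fin k} {q : Fin m × Fin k → Prop}
    (hq : ∀ w, w.1 = u.1 → q w → w.2 = a) :
    (Finset.univ.filter fun w => (cliquePath m k).Adj u w ∧ q w).card ≤ 3 := by
  refine le_trans (Finset.card_le_card (t := {(u.1, a)} ∪ Finset.univ.filter
    fun w : Fin m × Fin k => u.2 = w.2 ∧ sep u.1 w.1 = 1) fun w hw => ?_)
    ((Finset.card_union_le _ _).trans ?_)
  · simp only [Finset.mem_union, Finset.mem_filter, Finset.mem_univ, true_and,
      Finset.mem_singleton, adj_iff] at hw ⊢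
    obtain ⟨⟨same, -⟩ | matched, hqw⟩ := hw
    · exact Or.inl (Prod.ext same.symm (hq w same.symm hqw))
    · exact Or.inr matched
  · rw [Finset.card_singleton]
    exact Nat.add_le_add_left (card_matched_le u) 1

variable {N : ℕ} {F : Schedule (Fin m × Fin k) N} {P : Params} {s p : ℕ}
  {X : Finset (Fin m × Fin k)} {c c' : Config (Fin m × Fin k)}

/-- Node `u` never fails. -/
def Surv {V : Type*} {N : ℕ} (F : Schedule V N) (u : V) : Prop := ∀ t, F u t = false

theorem Surv.alive {V : Type*} {N : ℕ} {F : Schedule V N} {u : V} (h : Surv F u) (t : ℕ) :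
    Alive F u t := fun r _ => h r

theorem mem_fresh {V : Type*} [DecidableEq V] {s : NodeState V} {v : V} :
    v ∈ s.fresh P ↔ v ∈ s.R ∧ v ∉ s.S ∧ (s.cnt v : ℝ) < P.T := by
  simp only [NodeState.fresh, NodeState.B, Finset.mem_filter, Finset.mem_sdiff, and_assoc]

theorem Sound.cnt_le_three (h : Sound (cliquePath m k) F c) {u v : Fin m × Fin k}
    (hu : Alive F u c.time) (ne : v ≠ u)
    (hS : ∀ w, w.1 = u.1 → v ∈ (c.st w).S → w.2 = v.2) : (c.st u).cnt v ≤ 3 := by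
  rw [h.cnt u hu v, if_neg ne, zero_add]
  convert card_adj_filter_le_three hS

theorem Sound.le_cnt (h : Sound (cliquePath m k) F c) {u v : Fin m × Fin k}
    (hu : Alive F u c.time) (hs : P.T + 1 ≤ s)
    (hv : AtLeast s fun a => v ∈ (c.st (u.1, a)).S) : P.T ≤ (c.st u).cnt v := by
  classical
  obtain ⟨D, card_D, sent⟩ := hv
  have erase_le : (D.erase u.2).card ≤ (c.st u).cnt v := by
    rw [h.cnt u hu v]
    refine le_add_left (Finset.card_le_card_of_injOn (fun a => (u.1, a)) (fun a ha => ?_)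
      fun a _ b _ hab => (Prod.ext_iff.1 hab).2)
    simp only [Finset.coe_erase, Set.mem_sdiff, Finset.mem_coe, Set.mem_singleton_iff] at ha
    simp only [Finset.coe_filter, Finset.mem_univ, true_and, Set.mem_ofPred_eq, adj_iff]
    exact ⟨Or.inl fun h => ha.2 h.symm, sent a ha.1⟩
  have card_D_le := Finset.pred_card_le_card_erase (s := D) (a := u.2)
  have le_succ : (s : ℝ) ≤ (c.st u).cnt v + 1 := by
    exact_mod_cast (show s ≤ (c.st u).cnt v + 1 by omega)
  linarith

/-- The indices `b` for which `(i, b)` has sent the message of the node `(j, b)` on its path. -/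
def crossed (c : Config (Fin m × Fin k)) (i j : Fin m) : Finset (Fin k) :=
  Finset.univ.filter fun b => (j, b) ∈ (c.st (i, b)).S

theorem mem_crossed {i j : Fin m} {b : Fin k} : b ∈ crossed c i j ↔ (j, b) ∈ (c.st (i, b)).S := by
  simp only [crossed, Finset.mem_filter, Finset.mem_univ, true_and]

/-- The state of affairs after the random phase: every message has been sent by `s` nodes of its
own clique whose matched nodes in the neighbouring cliques never fail, whereas few messages have
already crossed to the next clique. -/
structure PostRandom (P : Params) (s : ℕ) (F : Schedule (Fin m × Fin k) N)
    (c : Config (Fin m × Fin k)) : Prop where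
  sound : Sound (cliquePath m k) F c
  sel : ∀ u, (c.st u).sel = none
  S_le : ∀ u, ∀ v ∈ (c.st u).S, v = u ∨ (cliquePath m k).Adj u v
  S_card : ∀ u, (c.st u).S.card ≤ 1 + P.tau
  R_le : ∀ u, ∀ v ∈ (c.st u).R, v = u ∨ ∃ w, (cliquePath m k).Adj u w ∧ v ∈ (c.st w).S
  lower : ∀ v, Alive F v 0 →
    AtLeast s fun a => v ∈ (c.st (v.1, a)).S ∧ ∀ j, sep j v.1 ≤ 2 → Surv F (j, a)
  early : ∀ i j, sep i j = 1 → (crossed c i j).card ≤ 2 * P.tau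

open Classical in
/-- Messages have travelled `p` cliques: every message has been sent by at least `s` nodes of every
clique up to this distance. The nodes outside the exceptional set `X`, which is small in every
clique, hold no messages from a distance of more than `p + 1`. -/
structure Progress (P : Params) (s : ℕ) (F : Schedule (Fin m × Fin k) N) (p : ℕ)
    (X : Finset (Fin m × Fin k)) (c : Config (Fin m × Fin k)) : Prop where
  sound : Sound (cliquePath m k) F c
  X_card : ∀ i, (Finset.univ.filter fun a : Fin k => (i, a) ∈ X).card ≤ 4 * P.tau
  S_le : ∀ u, ∀ v ∈ (c.st u).S, sep u.1 v.1 ≤ p ∨ (p = 1 ∧ v.2 = u.2 ∧ sep u.1 v.1 ≤ 2)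
  R_le : ∀ u, Alive F u c.time → ∀ v ∈ (c.st u).R, sep u.1 v.1 ≤ p + 1 ∨ v.2 = u.2
  R_le_of_notMem : ∀ u, Alive F u c.time → u ∉ X → ∀ v ∈ (c.st u).R, sep u.1 v.1 ≤ p + 1
  known : ∀ i v, Alive F v 0 → sep i v.1 ≤ p → AtLeast s fun a => v ∈ (c.st (i, a)).S

/-- The state of affairs after ranking phase `p`: every message has been received by `s` reliable
nodes of every clique at distance `p + 1`. The nodes of `Y` may hold too many fresh messages to
send all of them in a shuffle phase. -/
structure Spread (P : Params) (s : ℕ) (F : Schedule (Fin m × Fin k) N) (p : ℕ)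
    (X Y : Finset (Fin m × Fin k)) (c : Config (Fin m × Fin k)) : Prop
    extends Progress P s F p X c where
  holders : ∀ i v, Alive F v 0 → sep i v.1 = p + 1 →
    AtLeast s fun a => Surv F (i, a) ∧ (i, a) ∉ Y ∧ v ∈ (c.st (i, a)).R
  fresh_card : ∀ u, Surv F u → u ∉ Y → ((c.st u).fresh P).card ≤ 8 * P.tau

/-- The state of affairs after shuffle phase `p`: every message has been selected by `s` reliable
nodes of every clique at distance `p + 1`, and only such messages are selected. -/
structure Shuffled (P : Params) (s : ℕ) (F : Schedule (Fin m × Fin k) N) (p : ℕ)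
    (X : Finset (Fin m × Fin k)) (c : Config (Fin m × Fin k)) : Prop
    extends Progress P s F p X c where
  sel : ∀ u, ∃ A, (c.st u).sel = some A ∧ A.card ≤ 4 * P.tau
  sel_sub : ∀ u, Alive F u c.time → ∀ A, (c.st u).sel = some A →
    ∀ v ∈ A, v ∈ (c.st u).R ∧ sep u.1 v.1 = p + 1
  chosen : ∀ i v, Alive F v 0 → sep i v.1 = p + 1 →
    AtLeast s fun a => (∀ j, sep i j ≤ 1 → Surv F (j, a) ∧ (j, a) ∉ X) ∧
      v ∈ (c.st (i, a)).sel.getD ∅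

theorem Progress.snd_eq_of_mem_S (h : Progress P s F p X c) {u v : Fin m × Fin k}
    (hv : v ∈ (c.st u).S) (hsep : p < sep u.1 v.1) : v.2 = u.2 := by
  rcases h.S_le u v hv with near | far
  · exact absurd near hsep.not_ge
  · exact far.2.1

theorem Progress.cnt_le_three (h : Progress P s F p X c) {u v : Fin m × Fin k}
    (hu : Alive F u c.time) (hsep : p < sep u.1 v.1) : (c.st u).cnt v ≤ 3 := by
  refine h.sound.cnt_le_three hu ?_ fun w hw hv => (h.snd_eq_of_mem_S hv (hw ▸ hsep)).symm
  rintro rfl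
  rw [sep_self] at hsep
  exact Nat.not_lt_zero _ hsep

theorem Progress.cnt_lt (h : Progress P s F p X c) (hT : 3 < P.T) {u v : Fin m × Fin k}
    (hu : Alive F u c.time) (hsep : p < sep u.1 v.1) : ((c.st u).cnt v : ℝ) < P.T :=
  lt_of_le_of_lt (by exact_mod_cast h.cnt_le_three hu hsep) hT

theorem Progress.lt_sep_of_cnt_lt (h : Progress P s F p X c) (hs : P.T + 1 ≤ s)
    {u v : Fin m × Fin k} (hu : Alive F u c.time) (hv : Alive F v 0)
    (hcnt : ((c.st u).cnt v : ℝ) < P.T) : p < sep u.1 v.1 := by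
  by_contra near
  exact (h.sound.le_cnt hu hs (h.known u.1 v hv (not_lt.1 near))).not_gt hcnt

end CliquePath

/-! ### The first ranking phase -/

section FirstRanking

variable {m k : ℕ} {N : ℕ} {F : Schedule (Fin m × Fin k) N} {P : Params} {s : ℕ}
  {ρ : Rules (Fin m × Fin k)} {c c' : Config (Fin m × Fin k)}

/-- The invariant of the drawing steps that follow the start of a ranking phase from `c`. -/
abbrev RankingInv (F : Schedule (Fin m × Fin k) N) (P : Params) (ρ : Rules (Fin m × Fin k))
    (c c' : Config (Fin m × Fin k)) : Prop :=
  DrawInv (cliquePath m k) F (c.locally fun u t s => s.startRanking P (ρ.tie u t s)) c'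

theorem RankingInv.mem_S_cases (d : RankingInv F P ρ c c') {u v : Fin m × Fin k}
    (hv : v ∈ (c'.st u).S) :
    v ∈ (c.st u).S ∨ (Alive F u c.time ∧ v ∈ (c.st u).rankingBuffer P) :=
  d.S_le u v hv

theorem RankingInv.mem_S_or_R (d : RankingInv F P ρ c c') {u v : Fin m × Fin k}
    (hv : v ∈ (c'.st u).S) : v ∈ (c.st u).S ∨ v ∈ (c.st u).R :=
  (d.mem_S_cases hv).imp_right fun buffered =>
    Finset.sdiff_subset ((c.st u).rankingBuffer_subset_B P buffered.2)

theorem PostRandom.le_cnt (h : PostRandom P s F c) {u v : Fin m × Fin k}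
    (hu : Alive F u c.time) (hs : P.T + 1 ≤ s) (hv : Alive F v 0) (huv : sep u.1 v.1 = 0) :
    P.T ≤ (c.st u).cnt v := by
  refine h.sound.le_cnt hu hs ?_
  rw [eq_of_sep_eq_zero huv]
  exact (h.lower v hv).mono fun _ ha => ha.1

theorem PostRandom.sep_le_one (h : PostRandom P s F c) {u v : Fin m × Fin k}
    (hv : v ∈ (c.st u).S) : sep u.1 v.1 ≤ 1 := by
  rcases h.S_le u v hv with rfl | adj
  · exact (sep_self _).trans_le zero_le_one
  · exact sep_le_one_of_adj adj

theorem PostRandom.snd_eq (h : PostRandom P s F c) {u v : Fin m × Fin k}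
    (hv : v ∈ (c.st u).S) (ne : sep u.1 v.1 ≠ 0) : v.2 = u.2 := by
  rcases h.S_le u v hv with rfl | adj
  · rfl
  · exact (snd_eq_of_adj adj ne).symm

theorem PostRandom.sep_eq_two_of_one_lt_sep (h : PostRandom P s F c) {u v : Fin m × Fin k}
    (hv : v ∈ (c.st u).S ∨ v ∈ (c.st u).R) (hsep : 1 < sep u.1 v.1) :
    sep u.1 v.1 = 2 ∧ v.2 = u.2 ∧
      ∃ l, sep u.1 l = 1 ∧ sep l v.1 = 1 ∧ v ∈ (c.st (l, u.2)).S := by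
  rcases hv with hv | hv
  · exact absurd (h.sep_le_one hv) hsep.not_ge
  rcases h.R_le u v hv with rfl | ⟨⟨l, b⟩, adj, sent⟩
  · rw [sep_self] at hsep
    omega
  have sep_ul : sep u.1 l ≤ 1 := sep_le_one_of_adj adj
  have sep_lv : sep l v.1 ≤ 1 := h.sep_le_one sent
  have triangle := sep_triangle u.1 l v.1
  obtain rfl : u.2 = b := snd_eq_of_adj adj (show sep u.1 l ≠ 0 by omega)
  have snd_eq : v.2 = u.2 := h.snd_eq (u := (l, u.2)) sent (show sep l v.1 ≠ 0 by omega)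
  exact ⟨by omega, snd_eq, l, by omega, by omega, sent⟩

open Classical in
theorem PostRandom.fresh_subset (h : PostRandom P s F c) (hs : P.T + 1 ≤ s)
    {u : Fin m × Fin k} (hu : Alive F u c.time) : (c.st u).fresh P ⊆
      ((Finset.univ.filter fun w : Fin m × Fin k => u.2 = w.2 ∧ sep u.1 w.1 = 1).biUnion
        fun w => (c.st w).S) ∪
      ((Finset.univ.filter fun j : Fin m => sep u.1 j = 1).biUnion fun j =>
        (crossed c u.1 j).image fun b => (j, b)) := by
  intro v hv
  obtain ⟨hR, -, few⟩ := mem_fresh.1 hv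
  have far : sep u.1 v.1 ≠ 0 := fun same =>
    (h.le_cnt hu hs (h.sound.origin u hu v hR) same).not_gt few
  simp only [Finset.mem_union, Finset.mem_biUnion, Finset.mem_filter, Finset.mem_univ, true_and,
    Finset.mem_image, mem_crossed]
  rcases h.R_le u v hR with rfl | ⟨w, adj, sent⟩
  · exact absurd (sep_self _) far
  rcases adj_iff.1 adj with ⟨same, -⟩ | matched
  · have far_w : sep w.1 v.1 ≠ 0 := same ▸ far
    have w_eq : w = (u.1, v.2) := Prod.ext same.symm (h.snd_eq sent far_w).symm
    have sep_eq : sep u.1 v.1 = 1 := by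
      rw [same]
      exact le_antisymm (h.sep_le_one sent) (Nat.one_le_iff_ne_zero.2 far_w)
    exact Or.inr ⟨v.1, sep_eq, v.2, w_eq ▸ sent, rfl⟩
  · exact Or.inl ⟨w, matched, sent⟩

open Classical in
theorem PostRandom.card_fresh_le (h : PostRandom P s F c) (hs : P.T + 1 ≤ s) (ht : 2 ≤ P.tau)
    {u : Fin m × Fin k} (hu : Alive F u c.time) : ((c.st u).fresh P).card ≤ 8 * P.tau := by
  have from_matched := Finset.card_biUnion_le_card_mul
    (Finset.univ.filter fun w : Fin m × Fin k => u.2 = w.2 ∧ sep u.1 w.1 = 1)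
    (fun w => (c.st w).S) (1 + P.tau) fun w _ => h.S_card w
  have from_clique := Finset.card_biUnion_le_card_mul
    (Finset.univ.filter fun j : Fin m => sep u.1 j = 1)
    (fun j => (crossed c u.1 j).image fun b => (j, b)) (2 * P.tau) fun j hj =>
      Finset.card_image_le.trans (h.early u.1 j (Finset.mem_filter.1 hj).2)
  have matched_le := Nat.mul_le_mul_right (1 + P.tau) (card_matched_le u)
  have cliques_le := Nat.mul_le_mul_right (2 * P.tau) (card_sep_eq_le u.1 1)
  have card_le := (Finset.card_le_card (h.fresh_subset hs hu)).trans (Finset.card_union_le _ _)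
  omega

theorem PostRandom.cnt_le_three (h : PostRandom P s F c) {u v : Fin m × Fin k}
    (hu : Alive F u c.time) (hsep : sep u.1 v.1 ≠ 0) : (c.st u).cnt v ≤ 3 := by
  refine h.sound.cnt_le_three hu ?_ fun w same sent => (h.snd_eq sent (same ▸ hsep)).symm
  rintro rfl
  exact hsep (sep_self _)

theorem PostRandom.mem_S_of_matched (h : PostRandom P s F c) (d : RankingInv F P ρ c c')
    (hT : 3 < P.T) (hf : ∀ u, Surv F u → (c.st u).fresh P ⊆ (c'.st u).S) {l : Fin m} {a : Fin k}
    {v : Fin m × Fin k} (hlv : sep l v.1 = 1) (hv : v ∈ (c.st (v.1, a)).S)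
    (ha : Surv F (l, a)) : v ∈ (c'.st (l, a)).S := by
  by_cases sent : v ∈ (c.st (l, a)).S
  · exact d.S_mono _ sent
  refine hf _ ha (mem_fresh.2 ⟨?_, sent, lt_of_le_of_lt ?_ hT⟩)
  · exact h.sound.known _ (ha.alive _) (v.1, a) (adj_of_sep_eq_one hlv a) hv
  · exact_mod_cast h.cnt_le_three (ha.alive _) (show sep l v.1 ≠ 0 by omega)

theorem PostRandom.mem_S_of_sep_eq_one (h : PostRandom P s F c) {u v : Fin m × Fin k}
    (hsep : sep u.1 v.1 = 1) (hv : v ∈ (c.st u).S ∨ v ∈ (c.st u).R) :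
    v ∈ (c.st (u.1, v.2)).S ∨ v ∈ (c.st (v.1, u.2)).S := by
  have crossed_of_sent : ∀ b, v ∈ (c.st (u.1, b)).S → v ∈ (c.st (u.1, v.2)).S := fun b sent => by
    rwa [h.snd_eq sent (show sep u.1 v.1 ≠ 0 by omega)]
  rcases hv with sent | hv
  · exact Or.inl (crossed_of_sent u.2 sent)
  rcases h.R_le u v hv with rfl | ⟨⟨j, b⟩, adj, sent⟩
  · rw [sep_self] at hsep
    omega
  rcases adj_iff.1 adj with ⟨rfl, -⟩ | ⟨rfl, sep_uj⟩
  · exact Or.inl (crossed_of_sent b sent)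
  · have sep_jv : sep j v.1 ≤ 1 := h.sep_le_one sent
    have same : j = v.1 := by
      simp only [sep, Nat.dist] at hsep sep_uj sep_jv
      exact Fin.ext (by omega)
    exact Or.inr (same ▸ sent)

theorem PostRandom.mem_R_cases (h : PostRandom P s F c) (d : RankingInv F P ρ c c')
    {u v : Fin m × Fin k} (hv : v ∈ (c'.st u).R) (hsep : 1 < sep u.1 v.1) :
    (sep u.1 v.1 = 2 ∧ ∃ l, sep u.1 l = 1 ∧ sep l v.1 = 1 ∧
      (v ∈ (c.st (l, v.2)).S ∨ v ∈ (c.st (v.1, u.2)).S)) ∨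
    (sep u.1 v.1 = 3 ∧ v.2 = u.2 ∧ ∃ l, sep u.1 l = 2 ∧ sep l v.1 = 1 ∧
      v ∈ (c.st (l, u.2)).S) := by
  have of_clique : ∀ b, v ∈ (c.st (u.1, b)).S ∨ v ∈ (c.st (u.1, b)).R → sep u.1 v.1 = 2 ∧
      ∃ l, sep u.1 l = 1 ∧ sep l v.1 = 1 ∧ (v ∈ (c.st (l, v.2)).S ∨ v ∈ (c.st (v.1, u.2)).S) := by
    intro b hv
    obtain ⟨sep_eq, snd_eq, l, sep_ul, sep_lv, sent⟩ := h.sep_eq_two_of_one_lt_sep hv hsep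
    exact ⟨sep_eq, l, sep_ul, sep_lv, Or.inl (snd_eq ▸ sent)⟩
  rcases d.R_le u v hv with hv | ⟨⟨l, b⟩, adj, sent⟩
  · exact Or.inl (of_clique u.2 (Or.inr hv))
  rcases adj_iff.1 adj with ⟨rfl, -⟩ | ⟨rfl, sep_ul⟩
  · exact Or.inl (of_clique b (d.mem_S_or_R sent))
  dsimp only at sep_ul
  have triangle := sep_triangle u.1 l v.1
  by_cases far : 1 < sep l v.1
  · obtain ⟨sep_lv, snd_eq, l', sep_ll', sep_l'v, sent'⟩ :=
      h.sep_eq_two_of_one_lt_sep (d.mem_S_or_R sent) far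
    dsimp only at sep_lv sep_ll' snd_eq
    have outward : sep u.1 v.1 = 3 ∧ sep u.1 l' = 2 := by
      simp only [sep, Nat.dist] at *
      omega
    exact Or.inr ⟨outward.1, snd_eq, l', outward.2, sep_l'v, sent'⟩
  · have sep_lv : sep l v.1 = 1 := by omega
    exact Or.inl ⟨by omega, l, sep_ul, sep_lv, h.mem_S_of_sep_eq_one sep_lv (d.mem_S_or_R sent)⟩

open Classical in
/-- The nodes that know a message from a distance of more than two cliques. -/
def outliers (c : Config (Fin m × Fin k)) : Finset (Fin m × Fin k) :=
  Finset.univ.filter fun u => ∃ v ∈ (c.st u).R, 2 < sep u.1 v.1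

open Classical in
theorem PostRandom.card_outliers_le (h : PostRandom P s F c) (d : RankingInv F P ρ c c')
    (i : Fin m) : (Finset.univ.filter fun a : Fin k => (i, a) ∈ outliers c').card ≤ 4 * P.tau := by
  let crossedAt (j : Fin m) : Finset (Fin k) := Finset.univ.filter fun a =>
    ∃ l, sep i l = 2 ∧ sep l j = 1 ∧ a ∈ crossed c l j
  have subset : (Finset.univ.filter fun a : Fin k => (i, a) ∈ outliers c') ⊆
      (Finset.univ.filter fun j : Fin m => sep i j = 3).biUnion crossedAt := by
    intro a ha
    simp only [outliers, Finset.mem_filter, Finset.mem_univ, true_and] at ha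
    obtain ⟨⟨j, b⟩, hR, far⟩ := ha
    change 2 < sep i j at far
    simp only [crossedAt, Finset.mem_biUnion, Finset.mem_filter, Finset.mem_univ, true_and,
      mem_crossed]
    rcases h.mem_R_cases d hR (show 1 < sep i j by omega) with
      ⟨sep_eq, -⟩ | ⟨sep_eq, rfl, l, sep_il, sep_lj, sent⟩
    · exact absurd sep_eq far.ne'
    · exact ⟨j, sep_eq, l, sep_il, sep_lj, sent⟩
  have card_crossedAt : ∀ j ∈ Finset.univ.filter fun j : Fin m => sep i j = 3,
      (crossedAt j).card ≤ 2 * P.tau := by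
    intro j hj
    have sep_ij := (Finset.mem_filter.1 hj).2
    by_cases between : ∃ l, sep i l = 2 ∧ sep l j = 1
    · obtain ⟨l, sep_il, sep_lj⟩ := between
      refine (Finset.card_le_card fun a ha => ?_).trans (h.early l j sep_lj)
      obtain ⟨-, l', sep_il', sep_l'j, ha⟩ := Finset.mem_filter.1 ha
      rwa [eq_of_sep_add_sep_eq (j := j) (sep_il.trans sep_il'.symm) (by omega) (by omega)]
    · simp only [crossedAt]
      rw [Finset.filter_false_of_mem fun a _ ⟨l, sep_il, sep_lj, _⟩ =>
        between ⟨l, sep_il, sep_lj⟩, Finset.card_empty]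
      exact Nat.zero_le _
  have card_le := (Finset.card_le_card subset).trans
    (Finset.card_biUnion_le_card_mul _ _ _ card_crossedAt)
  have cliques_le := Nat.mul_le_mul_right (2 * P.tau) (card_sep_eq_le i 3)
  omega

theorem PostRandom.progress (h : PostRandom P s F c) (d : RankingInv F P ρ c c')
    (hT : 3 < P.T) (hf : ∀ u, Surv F u → (c.st u).fresh P ⊆ (c'.st u).S) :
    Progress P s F 1 (outliers c') c' where
  sound := d.sound
  X_card := h.card_outliers_le d
  S_le u v hv := by
    by_cases near : sep u.1 v.1 ≤ 1
    · exact Or.inl near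
    · obtain ⟨sep_eq, snd_eq, -⟩ := h.sep_eq_two_of_one_lt_sep (d.mem_S_or_R hv) (not_le.1 near)
      exact Or.inr ⟨rfl, snd_eq, sep_eq.le⟩
  R_le u _ v hv := by
    by_cases far : 1 < sep u.1 v.1
    · exact (h.mem_R_cases d hv far).imp (fun near => near.1.le) fun straight => straight.2.1
    · exact Or.inl (by omega)
  R_le_of_notMem u _ hu v hv := by
    by_contra far
    exact hu (Finset.mem_filter.2 ⟨Finset.mem_univ u, v, hv, not_le.1 far⟩)
  known i v hv hsep := (h.lower v hv).mono fun a ⟨sent, surv⟩ => by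
    rcases hsep.lt_or_eq with same | next
    · rw [eq_of_sep_eq_zero (show sep i v.1 = 0 by omega)]
      exact d.S_mono _ sent
    · exact h.mem_S_of_matched d hT hf next sent (surv i (by omega))

open Classical in
theorem PostRandom.card_fresh_filter_le (h : PostRandom P s F c) (d : RankingInv F P ρ c c')
    {u : Fin m × Fin k} {j : Fin m} (hj : sep u.1 j = 2) :
    (((c'.st u).fresh P).filter fun v => v.1 = j).card ≤ 3 * P.tau + 1 := by
  obtain ⟨l, sep_ul, sep_lj⟩ := exists_sep_eq_one_sep_eq hj
  have subset : ((c'.st u).fresh P).filter (fun v => v.1 = j) ⊆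
      (crossed c l j).image (fun b => (j, b)) ∪ (c.st (j, u.2)).S := by
    intro v hv
    obtain ⟨fresh, rfl⟩ := Finset.mem_filter.1 hv
    simp only [Finset.mem_union, Finset.mem_image, mem_crossed]
    rcases h.mem_R_cases d (mem_fresh.1 fresh).1 (show 1 < sep u.1 v.1 by omega) with
      ⟨-, l', sep_ul', sep_l'v, sent⟩ | far
    · obtain rfl : l = l' :=
        eq_of_sep_add_sep_eq (j := v.1) (sep_ul.trans sep_ul'.symm) (by omega) (by omega)
      exact sent.imp_left fun sent => ⟨v.2, sent, rfl⟩
    · omega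
  have card_le := (Finset.card_le_card subset).trans (Finset.card_union_le _ _)
  have card_crossed := (Finset.card_image_le (f := fun b => (j, b))).trans (h.early l j sep_lj)
  have card_sent := h.S_card (j, u.2)
  omega

open Classical in
theorem PostRandom.card_fresh_after_le (h : PostRandom P s F c) (d : RankingInv F P ρ c c')
    (pr : Progress P s F 1 (outliers c') c') (hs : P.T + 1 ≤ s) (ht : 2 ≤ P.tau)
    {u : Fin m × Fin k} (hu : Alive F u c'.time) : ((c'.st u).fresh P).card ≤ 8 * P.tau := by
  have subset : (c'.st u).fresh P ⊆
      ((Finset.univ.filter fun j : Fin m => sep u.1 j = 2).biUnion fun j =>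
        ((c'.st u).fresh P).filter fun v => v.1 = j) ∪
      (Finset.univ.filter fun j : Fin m => sep u.1 j = 3).image fun j => (j, u.2) := by
    intro v hv
    obtain ⟨hR, -, few⟩ := mem_fresh.1 hv
    have far := pr.lt_sep_of_cnt_lt hs hu (pr.sound.origin u hu v hR) few
    simp only [Finset.mem_union, Finset.mem_biUnion, Finset.mem_image, Finset.mem_filter,
      Finset.mem_univ, true_and]
    rcases h.mem_R_cases d hR far with ⟨sep_eq, -⟩ | ⟨sep_eq, snd_eq, -⟩
    · exact Or.inl ⟨v.1, sep_eq, hv, rfl⟩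
    · exact Or.inr ⟨v.1, sep_eq, Prod.ext rfl snd_eq.symm⟩
  have card_le := (Finset.card_le_card subset).trans (Finset.card_union_le _ _)
  have near_le := Finset.card_biUnion_le_card_mul
    (Finset.univ.filter fun j : Fin m => sep u.1 j = 2)
    (fun j => ((c'.st u).fresh P).filter fun v => v.1 = j) (3 * P.tau + 1)
    fun j hj => h.card_fresh_filter_le d (Finset.mem_filter.1 hj).2
  have near_cliques := Nat.mul_le_mul_right (3 * P.tau + 1) (card_sep_eq_le u.1 2)
  have far_le := (Finset.card_image_le (f := fun j => (j, u.2))).trans (card_sep_eq_le u.1 3)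
  omega

theorem PostRandom.spread (h : PostRandom P s F c) (d : RankingInv F P ρ c c')
    (hs : P.T + 1 ≤ s) (hT : 3 < P.T) (ht : 2 ≤ P.tau)
    (hf : ∀ u, Surv F u → (c.st u).fresh P ⊆ (c'.st u).S) :
    Spread P s F 1 (outliers c') ∅ c' where
  toProgress := h.progress d hT hf
  holders i v hv hsep := by
    obtain ⟨l, sep_il, sep_lv⟩ := exists_sep_eq_one_sep_eq hsep
    refine (h.lower v hv).mono fun a ⟨sent, surv⟩ => ?_
    have surv_i : Surv F (i, a) := surv i (by omega)
    exact ⟨surv_i, Finset.notMem_empty _,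
      d.sound.known _ (surv_i.alive _) (l, a) (adj_of_sep_eq_one sep_il a)
        (h.mem_S_of_matched d hT hf sep_lv sent (surv l (by omega)))⟩
  fresh_card _ hu _ := h.card_fresh_after_le d (h.progress d hT hf) hs ht (hu.alive _)

end FirstRanking

/-! ### Later phases -/

section LaterPhases

variable {m k : ℕ} {N : ℕ} {F : Schedule (Fin m × Fin k) N} {P : Params} {s p : ℕ}
  {X Y : Finset (Fin m × Fin k)} {ρ : Rules (Fin m × Fin k)} {c c' : Config (Fin m × Fin k)}

theorem Shuffled.mem_sel_of_mem_rankingBuffer (h : Shuffled P s F p X c) (hT : 3 < P.T)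
    {u v : Fin m × Fin k} (hu : Alive F u c.time) (hsep : p < sep u.1 v.1)
    (hv : v ∈ (c.st u).rankingBuffer P) : v ∈ (c.st u).sel.getD ∅ := by
  obtain ⟨A, sel_eq, -⟩ := h.sel u
  simp only [NodeState.rankingBuffer, sel_eq, Finset.mem_filter] at hv
  rw [sel_eq]
  exact hv.2.resolve_right fun stale => (h.cnt_lt hT hu hsep).not_ge stale

theorem Shuffled.mem_sel (h : Shuffled P s F p X c) {u v : Fin m × Fin k}
    (hu : Alive F u c.time) (hv : v ∈ (c.st u).sel.getD ∅) :
    v ∈ (c.st u).R ∧ sep u.1 v.1 = p + 1 := by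
  obtain ⟨A, sel_eq, -⟩ := h.sel u
  rw [sel_eq] at hv
  exact h.sel_sub u hu A sel_eq v hv

theorem Shuffled.card_sel_le (h : Shuffled P s F p X c) (u : Fin m × Fin k) :
    ((c.st u).sel.getD ∅).card ≤ 4 * P.tau := by
  obtain ⟨A, sel_eq, card_le⟩ := h.sel u
  rw [sel_eq]
  exact card_le

theorem Shuffled.sep_le_of_mem_rankingBuffer (h : Shuffled P s F p X c) (hT : 3 < P.T)
    {u v : Fin m × Fin k} (hu : Alive F u c.time) (hv : v ∈ (c.st u).rankingBuffer P) :
    sep u.1 v.1 ≤ p + 1 := by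
  by_contra far
  exact far (h.mem_sel hu (h.mem_sel_of_mem_rankingBuffer hT hu (by omega) hv)).2.le

theorem Shuffled.mem_S_of_mem_sel (h : Shuffled P s F p X c) (d : RankingInv F P ρ c c')
    {u v : Fin m × Fin k} (hu : Surv F u) (hf : (c.st u).sel.getD ∅ ∩ (c.st u).B ⊆ (c'.st u).S)
    (hv : v ∈ (c.st u).sel.getD ∅) : v ∈ (c'.st u).S := by
  by_cases sent : v ∈ (c.st u).S
  · exact d.S_mono u sent
  · exact hf (Finset.mem_inter.2
      ⟨hv, Finset.mem_sdiff.2 ⟨(h.mem_sel (hu.alive _) hv).1, sent⟩⟩)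

theorem Shuffled.sep_le_of_mem_S (h : Shuffled P s F p X c) (d : RankingInv F P ρ c c')
    (hT : 3 < P.T) {u v : Fin m × Fin k} (hv : v ∈ (c'.st u).S) : sep u.1 v.1 ≤ p + 1 := by
  rcases d.mem_S_cases hv with hv | ⟨hu, hv⟩
  · rcases h.S_le u v hv with near | far <;> omega
  · exact h.sep_le_of_mem_rankingBuffer hT hu hv

theorem Shuffled.mem_R_cases (h : Shuffled P s F p X c) (d : RankingInv F P ρ c c')
    (hT : 3 < P.T) {u v : Fin m × Fin k} (hv : v ∈ (c'.st u).R) :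
    v ∈ (c.st u).R ∨ sep u.1 v.1 ≤ p + 2 := by
  refine (d.R_le u v hv).imp_right fun ⟨w, adj, sent⟩ => ?_
  have near := h.sep_le_of_mem_S d hT sent
  have step := sep_le_one_of_adj adj
  have triangle := sep_triangle u.1 w.1 v.1
  omega

theorem Shuffled.progress (h : Shuffled P s F p X c) (d : RankingInv F P ρ c c')
    (hT : 3 < P.T)
    (hf : ∀ u, Surv F u → (c.st u).sel.getD ∅ ∩ (c.st u).B ⊆ (c'.st u).S) :
    Progress P s F (p + 1) X c' where
  sound := d.sound
  X_card := h.X_card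
  S_le _ _ hv := Or.inl (h.sep_le_of_mem_S d hT hv)
  R_le u hu v hv := by
    rcases h.mem_R_cases d hT hv with old | near
    · exact (h.R_le u (hu.mono d.time_le) v old).imp_left fun near => near.trans (Nat.le_succ _)
    · exact Or.inl near
  R_le_of_notMem u hu hX v hv := by
    rcases h.mem_R_cases d hT hv with old | near
    · exact (h.R_le_of_notMem u (hu.mono d.time_le) hX v old).trans (Nat.le_succ _)
    · exact near
  known i v hv hsep := by
    rcases hsep.lt_or_eq with near | next
    · exact (h.known i v hv (Nat.le_of_lt_succ near)).mono fun a ha => d.S_mono _ ha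
    · refine (h.chosen i v hv next).mono fun a ⟨reliable, selected⟩ => ?_
      have surv := (reliable i (by rw [sep_self]; exact zero_le_one)).1
      exact h.mem_S_of_mem_sel d surv (hf _ surv) selected

open Classical in
theorem Shuffled.fresh_subset (h : Shuffled P s F p X c) (d : RankingInv F P ρ c c')
    (pr : Progress P s F (p + 1) X c') (hs : P.T + 1 ≤ s) (hT : 3 < P.T) {u : Fin m × Fin k}
    (hu : Alive F u c'.time) (hX : u ∉ X) : (c'.st u).fresh P ⊆
      (Finset.univ.filter fun w : Fin m × Fin k => u.2 = w.2 ∧ sep u.1 w.1 = 1).biUnion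
        fun w => (c.st w).sel.getD ∅ := by
  intro v hv
  obtain ⟨hR, -, few⟩ := mem_fresh.1 hv
  have hu' : Alive F u c.time := hu.mono d.time_le
  have far : p + 1 < sep u.1 v.1 := pr.lt_sep_of_cnt_lt hs hu (pr.sound.origin u hu v hR) few
  have unknown : v ∉ (c.st u).R := fun old => far.not_ge (h.R_le_of_notMem u hu' hX v old)
  obtain ⟨w, adj, sent⟩ := (d.R_le u v hR).resolve_left unknown
  rcases d.mem_S_cases sent with sent | ⟨hw, buffered⟩
  · exact absurd (h.sound.known u hu' w adj sent) unknown
  rcases adj_iff.1 adj with ⟨same, -⟩ | matched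
  · exact absurd (h.sep_le_of_mem_rankingBuffer hT hw buffered) (same ▸ far).not_ge
  · have triangle := sep_triangle u.1 w.1 v.1
    exact Finset.mem_biUnion.2 ⟨w, Finset.mem_filter.2 ⟨Finset.mem_univ w, matched⟩,
      h.mem_sel_of_mem_rankingBuffer hT hw (by omega) buffered⟩

theorem Shuffled.spread (h : Shuffled P s F p X c) (d : RankingInv F P ρ c c')
    (hs : P.T + 1 ≤ s) (hT : 3 < P.T)
    (hf : ∀ u, Surv F u → (c.st u).sel.getD ∅ ∩ (c.st u).B ⊆ (c'.st u).S) :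
    Spread P s F (p + 1) X X c' where
  toProgress := h.progress d hT hf
  holders i v hv hsep := by
    obtain ⟨l, sep_il, sep_lv⟩ := exists_sep_eq_one_sep_eq hsep
    refine (h.chosen l v hv sep_lv).mono fun a ⟨reliable, selected⟩ => ?_
    obtain ⟨surv_i, notMem_X⟩ := reliable i ((sep_comm l i).trans sep_il).le
    have surv_l := (reliable l (by rw [sep_self]; exact zero_le_one)).1
    exact ⟨surv_i, notMem_X, d.sound.known _ (surv_i.alive _) (l, a) (adj_of_sep_eq_one sep_il a)
      (h.mem_S_of_mem_sel d surv_l (hf _ surv_l) selected)⟩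
  fresh_card u hu hX := by
    classical
    have card_le := (Finset.card_le_card
      (h.fresh_subset d (h.progress d hT hf) hs hT (hu.alive _) hX)).trans
      (Finset.card_biUnion_le_card_mul _ _ (4 * P.tau) fun w _ => h.card_sel_le w)
    have matched_le := Nat.mul_le_mul_right (4 * P.tau) (card_matched_le u)
    omega

theorem ShuffleEnd.alive_of_phasecnt_pos (e : ShuffleEnd (cliquePath m k) F P c c')
    (hc : Sound (cliquePath m k) F c) {u v : Fin m × Fin k} (hu : Alive F u c.time)
    (hpos : 0 < (c'.st u).phasecnt v) : Alive F v 0 := by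
  classical
  by_contra failed
  have nowhere_fresh : ∀ w, Alive F w c.time → v ∉ (c.st w).fresh P := fun w hw fresh =>
    failed (hc.origin w hw v (mem_fresh.1 fresh).1)
  have upper := e.upper u v fun origin => failed (origin.2.mono (Nat.zero_le _))
  rw [if_neg (nowhere_fresh u hu),
    Finset.filter_false_of_mem fun w _ hw => nowhere_fresh w hw.2.1 hw.2.2,
    Finset.card_empty, add_zero] at upper
  exact hpos.not_ge upper

theorem Progress.phasecnt_le_four (h : Progress P s F p X c)
    (e : ShuffleEnd (cliquePath m k) F P c c') {u v : Fin m × Fin k}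
    (hadj : ¬ (cliquePath m k).Adj u v) (hsep : p + 1 < sep u.1 v.1) :
    (c'.st u).phasecnt v ≤ 4 := by
  classical
  refine (e.upper u v fun origin => hadj origin.1).trans (Nat.add_le_add (b := 1) (d := 3) ?_ ?_)
  · split_ifs <;> omega
  · convert card_adj_filter_le_three (u := u) (a := v.2)
      (q := fun w => Alive F w c.time ∧ v ∈ (c.st w).fresh P) fun w same ⟨hw, fresh⟩ =>
        ((h.R_le w hw v (mem_fresh.1 fresh).1).resolve_left
          (by rw [same]; exact hsep.not_ge)).symm

theorem Progress.of_mem_filtered (h : Progress P s F p X c)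
    (e : ShuffleEnd (cliquePath m k) F P c c') (hp : 1 ≤ p) (hs : P.T + 1 ≤ s)
    (hc : 4 < P.cHat * P.T) {u v : Fin m × Fin k} (hu : Alive F u c'.time)
    (hv : v ∈ (c'.st u).filtered P) : Alive F v 0 ∧ sep u.1 v.1 = p + 1 := by
  have hu' : Alive F u c.time := hu.mono (e.time ▸ Nat.le_add_right _ _)
  simp only [NodeState.filtered, Finset.mem_filter, Finset.mem_univ, true_and, e.cnt_eq] at hv
  obtain ⟨pos, many, few⟩ := hv
  have hv₀ : Alive F v 0 := e.alive_of_phasecnt_pos h.sound hu' pos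
  have far : p < sep u.1 v.1 := h.lt_sep_of_cnt_lt hs hu' hv₀ few
  refine ⟨hv₀, by_contra fun ne => ?_⟩
  have not_adj : ¬ (cliquePath m k).Adj u v := fun adj => by
    have := sep_le_one_of_adj adj
    omega
  have le_four : ((c'.st u).phasecnt v : ℝ) ≤ 4 := by
    exact_mod_cast h.phasecnt_le_four e not_adj (by omega)
  linarith

theorem Spread.le_phasecnt_succ (h : Spread P s F p X Y c)
    (e : ShuffleEnd (cliquePath m k) F P c c') (hT : 3 < P.T) {u v : Fin m × Fin k}
    (hu : Alive F u c'.time) (hv : Alive F v 0) (hsep : sep u.1 v.1 = p + 1) :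
    s ≤ (c'.st u).phasecnt v + 1 := by
  obtain ⟨D, card_D, holders⟩ := h.holders u.1 v hv hsep
  have lower := e.lower u hu v ((D.erase v.2).image fun a => (u.1, a)) fun w hw => ?_
  · rw [Finset.card_image_of_injective _ (Prod.mk_right_injective u.1)] at lower
    have := Finset.pred_card_le_card_erase (s := D) (a := v.2)
    omega
  obtain ⟨a, ha, rfl⟩ := Finset.mem_image.1 hw
  obtain ⟨ne, ha⟩ := Finset.mem_erase.1 ha
  obtain ⟨surv, notMem_Y, received⟩ := holders a ha
  have far : p < sep u.1 v.1 := hsep ▸ Nat.lt_succ_self p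
  refine ⟨?_, surv.alive, mem_fresh.2 ⟨received, fun sent => ?_, ?_⟩, h.fresh_card _ surv notMem_Y⟩
  · by_cases eq : a = u.2
    · exact Or.inl (by rw [eq])
    · exact Or.inr (adj_iff.2 (Or.inl ⟨rfl, Ne.symm eq⟩))
  · exact ne (h.snd_eq_of_mem_S sent far).symm
  · exact h.cnt_lt hT (surv.alive _) far

theorem Spread.mem_filtered (h : Spread P s F p X Y c)
    (e : ShuffleEnd (cliquePath m k) F P c c') (hs : P.T + 1 ≤ s) (hT : 3 < P.T)
    (hc : P.cHat ≤ 1) {u v : Fin m × Fin k} (hu : Alive F u c'.time)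
    (hv : Alive F v 0) (hsep : sep u.1 v.1 = p + 1) : v ∈ (c'.st u).filtered P := by
  have count : (s : ℝ) ≤ (c'.st u).phasecnt v + 1 := by
    exact_mod_cast h.le_phasecnt_succ e hT hu hv hsep
  have T_le : P.T ≤ (c'.st u).phasecnt v := by linarith
  have pos : (0 : ℝ) < (c'.st u).phasecnt v := by linarith
  simp only [NodeState.filtered, Finset.mem_filter, Finset.mem_univ, true_and, e.cnt_eq]
  exact ⟨by exact_mod_cast pos, (mul_le_of_le_one_left (by linarith) hc).trans T_le,
    h.cnt_lt hT (hu.mono (e.time ▸ Nat.le_add_right _ _)) (hsep ▸ Nat.lt_succ_self p)⟩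

theorem Progress.card_filtered_le (h : Progress P s F p X c)
    (e : ShuffleEnd (cliquePath m k) F P c c') (hp : 1 ≤ p) (hs : P.T + 1 ≤ s)
    (hc : 4 < P.cHat * P.T) {u : Fin m × Fin k} (hu : Alive F u c'.time) :
    ((c'.st u).filtered P).card ≤ 2 * k := by
  classical
  exact (Finset.card_le_card fun v hv => Finset.mem_filter.2
    ⟨Finset.mem_univ v, (h.of_mem_filtered e hp hs hc hu hv).2⟩).trans
    (card_clique_sep_eq_le u.1 (p + 1))

theorem Progress.endShuffle (h : Progress P s F p X c)
    (e : ShuffleEnd (cliquePath m k) F P c c') (hp : 1 ≤ p) (hs : P.T + 1 ≤ s)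
    (hc : 4 < P.cHat * P.T) (A : Fin m × Fin k → Finset (Fin m × Fin k)) :
    Progress P s F p X (c'.locally fun u _ s => s.endShuffle P (A u)) := by
  have time_le : c.time ≤ c'.time := e.time ▸ Nat.le_add_right _ _
  have R_eq : ∀ u, ((c'.locally fun u _ s => s.endShuffle P (A u)).st u).R =
      (c.st u).R ∪ (c'.st u).filtered P := fun u => by
    rw [← e.R_eq u]
    rfl
  have R_cases : ∀ u, Alive F u c'.time → ∀ v ∈ (c.st u).R ∪ (c'.st u).filtered P,
      v ∈ (c.st u).R ∨ (Alive F v 0 ∧ sep u.1 v.1 = p + 1) := fun u hu v hv =>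
    (Finset.mem_union.1 hv).imp_right (h.of_mem_filtered e hp hs hc hu)
  refine ⟨h.sound.of_eq time_le e.S_eq e.cnt_eq (fun u => ?_) (fun u hu v hv => ?_), h.X_card,
    fun u v hv => h.S_le u v (e.S_eq u ▸ hv), fun u hu v hv => ?_, fun u hu hX v hv => ?_,
    fun i v hv hsep => (h.known i v hv hsep).mono fun a ha => (e.S_eq (i, a)).symm ▸ ha⟩
  · rw [R_eq]
    exact Finset.subset_union_left
  all_goals
    rw [R_eq] at hv
    rcases R_cases u hu v hv with old | next
  · exact h.sound.origin u (hu.mono time_le) v old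
  · exact next.1
  · exact h.R_le u (hu.mono time_le) v old
  · exact Or.inl next.2.le
  · exact h.R_le_of_notMem u (hu.mono time_le) hX v old
  · exact next.2.le

theorem Progress.shuffled (h : Progress P s F p X c)
    (e : ShuffleEnd (cliquePath m k) F P c c') (hp : 1 ≤ p) (hs : P.T + 1 ≤ s)
    (hc : 4 < P.cHat * P.T) (A : Fin m × Fin k → Finset (Fin m × Fin k))
    (hA : ∀ u, A u ⊆ (c'.st u).filtered P ∧ (A u).card ≤ 4 * P.tau)
    (hch : ∀ i v, Alive F v 0 → sep i v.1 = p + 1 →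
      AtLeast s fun a => (∀ j, sep i j ≤ 1 → Surv F (j, a) ∧ (j, a) ∉ X) ∧ v ∈ A (i, a)) :
    Shuffled P s F p X (c'.locally fun u _ s => s.endShuffle P (A u)) where
  toProgress := h.endShuffle e hp hs hc A
  sel u := ⟨A u, rfl, (hA u).2⟩
  sel_sub u hu A' hA' v hv := by
    obtain rfl : A u = A' := Option.some_injective _ hA'
    have passed := (hA u).1 hv
    exact ⟨Finset.mem_union_right _ passed, (h.of_mem_filtered e hp hs hc hu passed).2⟩
  chosen := hch

end LaterPhases

/-! ### Error probabilities of the phases -/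

section Phases

variable {m k : ℕ} {N : ℕ} {F : Schedule (Fin m × Fin k) N} {P : Params} {s f p : ℕ} {e : ℝ≥0∞}
  {X Y : Finset (Fin m × Fin k)} {ρ : Rules (Fin m × Fin k)} {c c' : Config (Fin m × Fin k)}

/-- The relations between the parameters on which the analysis relies: `s` is a threshold above
`T`, `f` bounds the number of failures in a clique, and `e` the probability of the elementary
failure events of the algorithm. -/
structure Regime (m k : ℕ) (P : Params) (s f : ℕ) (e : ℝ≥0∞) : Prop where
  k_pos : 0 < k
  thr : P.T + 1 ≤ s
  T_gt : 3 < P.T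
  tau_ge : 2 ≤ P.tau
  cHat_le : P.cHat ≤ 1
  cHat_mul : 4 < P.cHat * P.T
  ranking : (1 - ((8 * P.tau : ℕ) : ℝ≥0∞)⁻¹ * (harmonicSum (m * k))⁻¹) ^ P.tau' ≤ e
  selection : ∀ K, k - 3 * (f + 4 * P.tau) ≤ K →
    2 ^ s * (2⁻¹ + 2⁻¹ * (1 - (4 * P.tau : ℕ) / (2 * k : ℕ))) ^ K ≤ e
  random : ∀ K, k - 5 * f - 1 ≤ K →
    2 ^ s * (2⁻¹ + 2⁻¹ * (1 - 1⁻¹ * ((k + 1 : ℕ) : ℝ≥0∞)⁻¹) ^ P.tau) ^ K ≤ e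
  early : ∀ K ≤ k, (2 ^ (2 * P.tau + 1))⁻¹ *
    (1 + P.tau * ((k - f - 1 : ℕ) : ℝ≥0∞)⁻¹) ^ K ≤ e

open Classical in
/-- At most `f` nodes of each clique fail. -/
def FewFailures (f : ℕ) (F : Schedule (Fin m × Fin k) N) : Prop :=
  ∀ i, (Finset.univ.filter fun a : Fin k => ¬ Surv F (i, a)).card ≤ f

theorem card_sep_le_le (i : Fin m) (r : ℕ) :
    (Finset.univ.filter fun l : Fin m => sep i l ≤ r).card ≤ 2 * r + 1 := by
  refine le_trans (Finset.card_le_card_of_injOn (fun l : Fin m => (l : ℕ) + r - i)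
    (t := Finset.range (2 * r + 1)) ?_ ?_) (Finset.card_range _).le
  · intro l hl
    have near := (Finset.mem_filter.1 (Finset.mem_coe.1 hl)).2
    simp only [sep, Nat.dist] at near
    simp only [Finset.coe_range, Set.mem_Iio]
    omega
  · intro l hl l' hl' h
    have near := (Finset.mem_filter.1 (Finset.mem_coe.1 hl)).2
    have near' := (Finset.mem_filter.1 (Finset.mem_coe.1 hl')).2
    simp only [sep, Nat.dist] at near near' h
    exact Fin.ext (by omega)

open Classical in
theorem le_card_forall_sep_le (i : Fin m) (r b : ℕ) (q : Fin m → Fin k → Prop)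
    (hq : ∀ j, (Finset.univ.filter fun a => ¬ q j a).card ≤ b) :
    k - (2 * r + 1) * b ≤
      (Finset.univ.filter fun a => ∀ j, sep i j ≤ r → q j a).card := by
  have subset : (Finset.univ.filter fun a => ¬ ∀ j, sep i j ≤ r → q j a) ⊆
      (Finset.univ.filter fun l : Fin m => sep i l ≤ r).biUnion fun j =>
        Finset.univ.filter fun a => ¬ q j a := by
    intro a ha
    simpa only [Finset.mem_biUnion, Finset.mem_filter, Finset.mem_univ, true_and, not_forall,
      exists_prop] using ha
  have card_bad := (Finset.card_le_card subset).trans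
    (Finset.card_biUnion_le_card_mul _ _ b fun j _ => hq j)
  have card_near := Nat.mul_le_mul_right b (card_sep_le_le i r)
  have card_add := Finset.card_filter_add_card_filter_not (s := (Finset.univ : Finset (Fin k)))
    (fun a => ∀ j, sep i j ≤ r → q j a)
  rw [Finset.card_univ, Fintype.card_fin] at card_add
  omega

open Classical in
theorem FewFailures.le_card_surv (hF : FewFailures f F) (i : Fin m) :
    k - f ≤ (Finset.univ.filter fun a : Fin k => Surv F (i, a)).card := by
  have card_add := Finset.card_filter_add_card_filter_not (s := (Finset.univ : Finset (Fin k)))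
    (fun a => Surv F (i, a))
  rw [Finset.card_univ, Fintype.card_fin] at card_add
  have := hF i
  omega

theorem AtLeast.of_mem_singleton_product {q : Fin m × Fin k → Prop} {i : Fin m}
    {A : Finset (Fin k)} (h : AtLeast s fun u => u ∈ {i} ×ˢ A ∧ q u) :
    AtLeast s fun a => a ∈ A ∧ q (i, a) := by
  have fst_eq {u : Fin m × Fin k} (hu : u ∈ {i} ×ˢ A) : u.1 = i :=
    Finset.mem_singleton.1 (Finset.mem_product.1 hu).1
  refine h.map Prod.snd (fun u u' hu hu' snd_eq => ?_) fun u hu => ?_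
  · exact Prod.ext ((fst_eq hu.1).trans (fst_eq hu'.1).symm) snd_eq
  · obtain rfl := fst_eq hu.1
    exact ⟨(Finset.mem_product.1 hu.1).2, hu.2⟩

/-- The configuration in which the random phase starts. -/
noncomputable abbrev randomStart (F : Schedule (Fin m × Fin k) N) : Config (Fin m × Fin k) :=
  (afterRoundZero (cliquePath m k) F).locally fun _ _ => NodeState.startRandom

theorem eq_of_mem_randomStart_S {u v : Fin m × Fin k} (h : v ∈ ((randomStart F).st u).S) :
    v = u :=
  (mem_afterRoundZero_S.1 h).2

theorem totalWeight_randomStart (u : Fin m × Fin k) :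
    totalWeight ((randomStart F).st u).hatB ((randomStart F).st u).pos =
      ((randomStart F).st u).hatB.card := by
  simp [totalWeight, Config.locally, NodeState.startRandom]

theorem mem_randomStart_hatB {u v : Fin m × Fin k} (hu : Alive F u 1) (hv : Alive F v 0)
    (h : (cliquePath m k).Adj u v) : v ∈ ((randomStart F).st u).hatB :=
  Finset.mem_sdiff.2 ⟨sound_afterRoundZero.known u hu v h (mem_afterRoundZero_S.2 ⟨hv, rfl⟩),
    fun sent => h.ne' (eq_of_mem_randomStart_S sent)⟩

theorem card_randomStart_hatB_le (hk : 0 < k) {u : Fin m × Fin k} (hu : Alive F u 0) :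
    ((randomStart F).st u).hatB.card ≤ k + 1 := by
  classical
  have subset : ((randomStart F).st u).hatB ⊆ {u.1} ×ˢ Finset.univ.erase u.2 ∪
      Finset.univ.filter fun w : Fin m × Fin k => u.2 = w.2 ∧ sep u.1 w.1 = 1 := by
    intro v hv
    obtain ⟨known, unsent⟩ := Finset.mem_sdiff.1 hv
    have ne : v ≠ u := fun eq => unsent (mem_afterRoundZero_S.2 ⟨hu, eq⟩)
    have adj := ((eq_or_adj_of_mem_afterRoundZero_R known).resolve_left ne).1
    rw [adj_iff] at adj
    refine Finset.mem_union.2 (adj.imp (fun own => ?_) fun matched => ?_)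
    · exact Finset.mem_product.2 ⟨Finset.mem_singleton.2 own.1.symm,
        Finset.mem_erase.2 ⟨own.2.symm, Finset.mem_univ _⟩⟩
    · exact Finset.mem_filter.2 ⟨Finset.mem_univ v, matched⟩
  have card_own : ({u.1} ×ˢ Finset.univ.erase u.2).card = k - 1 := by
    simp [Finset.card_erase_of_mem]
  have card_le := (Finset.card_le_card subset).trans (Finset.card_union_le _ _)
  have card_matched := card_matched_le u
  omega

theorem le_card_randomStart_hatB (hF : FewFailures f F) {u : Fin m × Fin k} (hu : Alive F u 1) :
    k - f - 1 ≤ ((randomStart F).st u).hatB.card := by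
  classical
  let surviving : Finset (Fin k) := Finset.univ.filter fun a => Surv F (u.1, a)
  have subset : {u.1} ×ˢ surviving.erase u.2 ⊆ ((randomStart F).st u).hatB := by
    rintro ⟨i, a⟩ h
    obtain ⟨hi, ha⟩ := Finset.mem_product.1 h
    obtain rfl : i = u.1 := Finset.mem_singleton.1 hi
    obtain ⟨ne, surv⟩ := Finset.mem_erase.1 ha
    exact mem_randomStart_hatB hu ((Finset.mem_filter.1 surv).2.alive 0)
      (adj_iff.2 (Or.inl ⟨rfl, ne.symm⟩))
  have card_le := Finset.card_le_card subset
  rw [Finset.card_product, Finset.card_singleton, one_mul] at card_le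
  have card_erase := Finset.pred_card_le_card_erase (s := surviving) (a := u.2)
  have card_surviving : k - f ≤ surviving.card := hF.le_card_surv u.1
  omega

theorem prob_random_lower (hr : Regime m k P s f e) (hF : FewFailures f F) {v : Fin m × Fin k}
    (hv : Alive F v 0) :
    (randomPhase (cliquePath m k) P F (afterRoundZero (cliquePath m k) F)).toOuterMeasure
      {c | ¬ AtLeast s fun a => v ∈ (c.st (v.1, a)).S ∧ ∀ j, sep j v.1 ≤ 2 → Surv F (j, a)} ≤
        e := by
  classical
  let good : Finset (Fin k) := Finset.univ.filter fun a => ∀ j, sep v.1 j ≤ 2 → Surv F (j, a)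
  let K : Finset (Fin m × Fin k) := {v.1} ×ˢ good.erase v.2
  have surv_near {a} (ha : a ∈ good.erase v.2) : ∀ j, sep v.1 j ≤ 2 → Surv F (j, a) :=
    (Finset.mem_filter.1 (Finset.mem_of_mem_erase ha)).2
  have mem_K {u : Fin m × Fin k} (hu : u ∈ K) :
      Surv F u ∧ v ∈ ((randomStart F).st u).hatB := by
    obtain ⟨i, a⟩ := u
    obtain ⟨hi, ha⟩ := Finset.mem_product.1 hu
    obtain rfl : i = v.1 := Finset.mem_singleton.1 hi
    have surv : Surv F (v.1, a) := surv_near ha v.1 ((sep_self _).trans_le zero_le_two)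
    exact ⟨surv, mem_randomStart_hatB (surv.alive 1) hv
      (adj_iff.2 (Or.inl ⟨rfl, Finset.ne_of_mem_erase ha⟩))⟩
  have few_draws := prob_few_draws (cliquePath m k) F K (fun u hu => (mem_K hu).1.alive) v 1
    ((k + 1 : ℕ) : ℝ≥0∞) P.tau (randomStart F) (fun u hu => ⟨(mem_K hu).2,
      by simp [Config.locally, NodeState.startRandom], by
        rw [totalWeight_randomStart]
        exact_mod_cast card_randomStart_hatB_le hr.k_pos ((mem_K hu).1.alive 0)⟩) s
  refine le_trans (prob_mono _ fun c hc => mt fun many => ?_) (few_draws.trans (hr.random _ ?_))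
  · refine many.of_mem_singleton_product.mono fun a ⟨ha, unbuffered⟩ => ⟨?_, fun j hj =>
      surv_near ha j (by rwa [sep_comm])⟩
    rw [(drawInv_randomPhase hc).hatB_eq, Finset.mem_sdiff, not_and_not_right] at unbuffered
    exact unbuffered (mem_K (u := (v.1, a)) (Finset.mem_product.2
      ⟨Finset.mem_singleton_self _, ha⟩)).2
  · have card_good : k - (2 * 2 + 1) * f ≤ good.card :=
      le_card_forall_sep_le v.1 2 f (fun j a => Surv F (j, a)) hF
    have card_erase := Finset.pred_card_le_card_erase (s := good) (a := v.2)
    rw [Finset.card_product, Finset.card_singleton, one_mul]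
    omega

theorem prob_random_early (hr : Regime m k P s f e) (hF : FewFailures f F) {i j : Fin m}
    (hij : sep i j = 1) :
    (randomPhase (cliquePath m k) P F (afterRoundZero (cliquePath m k) F)).toOuterMeasure
      {c | ¬ (crossed c i j).card ≤ 2 * P.tau} ≤ e := by
  classical
  let K : Finset (Fin m × Fin k) := {i} ×ˢ Finset.univ.filter fun b : Fin k =>
    Alive F (i, b) 1 ∧ (j, b) ∈ ((randomStart F).st (i, b)).hatB
  have mem_K {u : Fin m × Fin k} :
      u ∈ K ↔ u.1 = i ∧ Alive F (i, u.2) 1 ∧ (j, u.2) ∈ ((randomStart F).st (i, u.2)).hatB := by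
    simp only [K, Finset.mem_product, Finset.mem_singleton, Finset.mem_filter, Finset.mem_univ,
      true_and]
  have card_K : K.card ≤ k := by
    rw [Finset.card_product, Finset.card_singleton, one_mul]
    exact (Finset.card_filter_le _ _).trans (Finset.card_fin k).le
  have many_draws := prob_many_draws (cliquePath m k) F K (fun u => (j, u.2)) P.tau (randomStart F)
    ((k - f - 1 : ℕ) : ℝ≥0∞) (fun u hu => by
      obtain ⟨rfl, alive, buffered⟩ := mem_K.1 hu
      exact ⟨buffered, rfl, mod_cast le_card_randomStart_hatB hF alive⟩) (2 * P.tau + 1)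
  refine le_trans (prob_mono _ fun c hc many => ?_) (many_draws.trans (hr.early _ card_K))
  refine ⟨{i} ×ˢ crossed c i j, ?_, ?_⟩
  · rw [Finset.card_product, Finset.card_singleton, one_mul]
    exact not_le.1 many
  · rintro ⟨i', b⟩ hb
    obtain ⟨hi, hb⟩ := Finset.mem_product.1 hb
    obtain rfl : i' = i := Finset.mem_singleton.1 hi
    have sent : (j, b) ∈ (c.st (i', b)).S := mem_crossed.1 hb
    have d := drawInv_randomPhase hc
    refine ⟨mem_K.2 ⟨rfl, (d.S_le _ _ sent).resolve_left fun start => ?_⟩, ?_⟩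
    · obtain rfl : j = i' := congrArg Prod.fst (eq_of_mem_randomStart_S start)
      rw [sep_self] at hij
      exact zero_ne_one hij
    · rw [d.hatB_eq, Finset.mem_sdiff]
      exact fun buffered => buffered.2 sent

theorem postRandom_of_mem_support
    (hc : c ∈ (randomPhase (cliquePath m k) P F (afterRoundZero (cliquePath m k) F)).support)
    (lower : ∀ v, Alive F v 0 →
      AtLeast s fun a => v ∈ (c.st (v.1, a)).S ∧ ∀ j, sep j v.1 ≤ 2 → Surv F (j, a))
    (early : ∀ i j, sep i j = 1 → (crossed c i j).card ≤ 2 * P.tau) : PostRandom P s F c := by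
  have d := drawInv_randomPhase hc
  refine ⟨d.sound, fun u => (d.sel_eq u).trans (afterRoundZero_sel u), fun u v hv => ?_,
    fun u => ?_, fun u v hv => ?_, lower, early⟩
  · rcases d.S_le u v hv with start | ⟨-, buffered⟩
    · exact Or.inl (eq_of_mem_randomStart_S start)
    · exact (eq_or_adj_of_mem_afterRoundZero_R (Finset.mem_sdiff.1 buffered).1).imp_right And.left
  · have card_start : ((randomStart F).st u).S.card ≤ 1 := Finset.card_le_one.2 fun a ha b hb =>
      (eq_of_mem_randomStart_S ha).trans (eq_of_mem_randomStart_S hb).symm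
    have card_le : (c.st u).S.card + (randomStart F).time ≤
        ((randomStart F).st u).S.card + c.time := d.S_card u
    have time_eq : c.time = (randomStart F).time + P.tau :=
      time_drawRounds (cliquePath m k) F _ _ c hc
    omega
  · rcases d.R_le u v hv with start | sent
    · exact (eq_or_adj_of_mem_afterRoundZero_R start).imp_right fun ⟨adj, alive⟩ =>
        ⟨v, adj, d.sound.own v alive⟩
    · exact Or.inr sent

theorem prob_not_postRandom (hr : Regime m k P s f e) (hF : FewFailures f F) :
    (randomPhase (cliquePath m k) P F (afterRoundZero (cliquePath m k) F)).toOuterMeasure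
      {c | ¬ PostRandom P s F c} ≤ (2 * ((m * k) * (m * k)) : ℕ) * e := by
  have le_mul : m ≤ m * k := Nat.le_mul_of_pos_right m hr.k_pos
  have le_sq : m * k ≤ (m * k) * (m * k) := Nat.le_mul_self _
  have not_lower := prob_exists_and_le _ (fun v => Alive F v 0) _ e fun v hv =>
    prob_random_lower hr hF hv
  have not_early := prob_exists_and_le _ (fun x : Fin m × Fin m => sep x.1 x.2 = 1) _ e
    fun x hx => prob_random_early hr hF hx
  simp only [Fintype.card_prod, Fintype.card_fin] at not_lower not_early
  refine (prob_mono _ fun c hc hbad => ?_).trans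
    ((MeasureTheory.measure_union_le _ _).trans (add_le_add not_lower not_early)) |>.trans ?_
  · by_contra hgood
    obtain ⟨lower, early⟩ := not_or.1 hgood
    refine hbad (postRandom_of_mem_support hc (fun v hv => ?_) fun i j hij => ?_)
    · by_contra few
      exact lower ⟨v, hv, few⟩
    · by_contra many
      exact early ⟨(i, j), hij, many⟩
  · rw [← add_mul, two_mul]
    gcongr
    exact_mod_cast add_le_add le_sq (Nat.mul_le_mul le_mul le_mul)

open Classical in
theorem prob_not_spread_of_postRandom (hr : Regime m k P s f e) (h : PostRandom P s F c) :
    (rankingPhase (cliquePath m k) P ρ F c).toOuterMeasure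
      {c' | ¬ ∃ X Y, Spread P s F 1 X Y c'} ≤ ((m * k) * (m * k) : ℕ) * e := by
  have missing := prob_rankingPhase_missing (G := cliquePath m k) (F := F) P ρ c
    (fun u => (c.st u).fresh P) (8 * P.tau) e (Finset.univ.filter (Surv F))
    (fun u hu => (Finset.mem_filter.1 hu).2.alive) (fun u hu => ⟨?_, ?_, ?_⟩) h.sound
    (by simpa using hr.ranking)
  · simp only [Fintype.card_prod, Fintype.card_fin] at missing
    refine le_trans (prob_mono _ fun c' hc' hbad => ?_) missing
    by_contra hgood
    refine hbad ⟨_, _, h.spread (drawInv_rankingPhase h.sound hc') hr.thr hr.T_gt hr.tau_ge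
      fun u hu => ?_⟩
    by_contra unsent
    exact hgood ⟨u, Finset.mem_filter.2 ⟨Finset.mem_univ u, hu⟩, unsent⟩
  · simp only [NodeState.rankingBuffer, h.sel u]
    exact Finset.filter_subset _ _
  · exact h.card_fresh_le hr.thr hr.tau_ge ((Finset.mem_filter.1 hu).2.alive _)
  · intro key v hv v' hv' precedes
    have cnt_le : (c.st u).cnt v' ≤ (c.st u).cnt v := by
      simp only [NodeState.Precedes, h.sel u, Option.getD_none, Finset.notMem_empty, if_false,
        lt_irrefl, false_or, true_and] at precedes
      omega
    refine Finset.mem_filter.2 ⟨(c.st u).rankingBuffer_subset_B P hv', ?_⟩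
    exact lt_of_le_of_lt (by exact_mod_cast cnt_le) (Finset.mem_filter.1 hv).2

open Classical in
theorem prob_not_spread_of_shuffled (hr : Regime m k P s f e) (h : Shuffled P s F p X c) :
    (rankingPhase (cliquePath m k) P ρ F c).toOuterMeasure
      {c' | ¬ ∃ X Y, Spread P s F (p + 1) X Y c'} ≤ ((m * k) * (m * k) : ℕ) * e := by
  have missing := prob_rankingPhase_missing (G := cliquePath m k) (F := F) P ρ c
    (fun u => (c.st u).sel.getD ∅ ∩ (c.st u).B) (8 * P.tau) e (Finset.univ.filter (Surv F))
    (fun u hu => (Finset.mem_filter.1 hu).2.alive) (fun u _ => ⟨?_, ?_, ?_⟩) h.sound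
    (by simpa using hr.ranking)
  · simp only [Fintype.card_prod, Fintype.card_fin] at missing
    refine le_trans (prob_mono _ fun c' hc' hbad => ?_) missing
    by_contra hgood
    refine hbad ⟨X, X, h.spread (drawInv_rankingPhase h.sound hc') hr.thr hr.T_gt
      fun u hu => ?_⟩
    by_contra unsent
    exact hgood ⟨u, Finset.mem_filter.2 ⟨Finset.mem_univ u, hu⟩, unsent⟩
  · intro v hv
    obtain ⟨A, sel_eq, -⟩ := h.sel u
    simp only [sel_eq, Option.getD_some, Finset.mem_inter] at hv
    simp only [NodeState.rankingBuffer, sel_eq]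
    exact Finset.mem_filter.2 ⟨hv.2, Or.inl hv.1⟩
  · calc ((c.st u).sel.getD ∅ ∩ (c.st u).B).card ≤ ((c.st u).sel.getD ∅).card :=
          Finset.card_le_card Finset.inter_subset_left
      _ ≤ 4 * P.tau := h.card_sel_le u
      _ ≤ 8 * P.tau := by omega
  · intro key v hv v' hv' precedes
    refine Finset.mem_inter.2 ⟨?_, (c.st u).rankingBuffer_subset_B P hv'⟩
    by_contra unselected
    simp only [NodeState.Precedes, if_pos (Finset.mem_inter.1 hv).1, if_neg unselected] at precedes
    omega

open Classical in
theorem Progress.le_card_reliable (h : Progress P s F p X c) (hF : FewFailures f F) (i : Fin m) :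
    k - 3 * (f + 4 * P.tau) ≤
      (Finset.univ.filter fun a => ∀ j, sep i j ≤ 1 → Surv F (j, a) ∧ (j, a) ∉ X).card := by
  have card_bad (j : Fin m) :
      (Finset.univ.filter fun a => ¬ (Surv F (j, a) ∧ (j, a) ∉ X)).card ≤ f + 4 * P.tau := by
    simp only [not_and_or, not_not, Finset.filter_or]
    exact (Finset.card_union_le _ _).trans (add_le_add (hF j) (h.X_card j))
  convert le_card_forall_sep_le i 1 (f + 4 * P.tau) (fun j a => Surv F (j, a) ∧ (j, a) ∉ X)
    fun j => ?_
  convert card_bad j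

theorem prob_not_selected (hr : Regime m k P s f e) (hF : FewFailures f F) (hp : 1 ≤ p)
    (h : Spread P s F p X Y c) (E : ShuffleEnd (cliquePath m k) F P c c') {i : Fin m}
    {v : Fin m × Fin k} (hv : Alive F v 0) (hsep : sep i v.1 = p + 1) :
    (pmfPi fun u => selection P (c'.st u)).toOuterMeasure
      {A | ¬ AtLeast s fun a =>
        (∀ j, sep i j ≤ 1 → Surv F (j, a) ∧ (j, a) ∉ X) ∧ v ∈ A (i, a)} ≤ e := by
  classical
  let K : Finset (Fin m × Fin k) := {i} ×ˢ Finset.univ.filter fun a : Fin k =>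
    ∀ j, sep i j ≤ 1 → Surv F (j, a) ∧ (j, a) ∉ X
  have filtered {u} (hu : u ∈ K) :
      v ∈ (c'.st u).filtered P ∧ ((c'.st u).filtered P).card ≤ 2 * k := by
    obtain ⟨i', a⟩ := u
    obtain ⟨hi, ha⟩ := Finset.mem_product.1 hu
    obtain rfl : i' = i := Finset.mem_singleton.1 hi
    have surv : Surv F (i', a) :=
      ((Finset.mem_filter.1 ha).2 i' ((sep_self i').trans_le zero_le_one)).1
    exact ⟨h.mem_filtered E hr.thr hr.T_gt hr.cHat_le (surv.alive _) hv hsep,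
      h.card_filtered_le E hp hr.thr hr.cHat_mul (surv.alive _)⟩
  have few_selected := prob_few_selected P c'.st K v (2 * k) (fun u hu => filtered hu) s
  refine (prob_mono _ fun A _ => mt fun many => ?_).trans (few_selected.trans (hr.selection _ ?_))
  · exact many.of_mem_singleton_product.mono fun a ⟨ha, selected⟩ =>
      ⟨(Finset.mem_filter.1 ha).2, selected⟩
  · rw [Finset.card_product, Finset.card_singleton, one_mul]
    exact h.le_card_reliable hF i

theorem prob_not_shuffled (hr : Regime m k P s f e) (hF : FewFailures f F) (hp : 1 ≤ p)
    (h : Spread P s F p X Y c) :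
    (shufflePhase (cliquePath m k) P ρ F c).toOuterMeasure {c' | ¬ Shuffled P s F p X c'} ≤
      ((m * k) * (m * k) : ℕ) * e := by
  rw [shufflePhase, PMF.toOuterMeasure_map_apply]
  have E := shuffleEnd_of_iterate (G := cliquePath m k) (F := F) (ρ := ρ) P c
  have not_selected := prob_exists_and_le _
    (fun x : Fin m × (Fin m × Fin k) => Alive F x.2 0 ∧ sep x.1 x.2.1 = p + 1) _ e
    fun x hx => prob_not_selected hr hF hp h E hx.1 hx.2
  refine (prob_mono _ fun A hA hbad => ?_).trans (not_selected.trans ?_)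
  · by_contra hgood
    refine hbad (h.shuffled E hp hr.thr hr.cHat_mul A
      (fun u => mem_support_selection (mem_support_of_mem_support_pmfPi hA u))
      fun i v hv hsep => ?_)
    by_contra few
    exact hgood ⟨(i, v), ⟨hv, hsep⟩, few⟩
  · simp only [Fintype.card_prod, Fintype.card_fin]
    gcongr
    exact Nat.le_mul_of_pos_right m hr.k_pos

/-- What holds with high probability at the start of ranking phase `p + 1`. -/
def Ready (P : Params) (s : ℕ) (F : Schedule (Fin m × Fin k) N) :
    ℕ → Config (Fin m × Fin k) → Prop
  | 0, c => PostRandom P s F c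
  | p + 1, c => ∃ X, Shuffled P s F (p + 1) X c

theorem prob_not_spread_of_ready (hr : Regime m k P s f e) (h : Ready P s F p c) :
    (rankingPhase (cliquePath m k) P ρ F c).toOuterMeasure
      {c' | ¬ ∃ X Y, Spread P s F (p + 1) X Y c'} ≤ ((m * k) * (m * k) : ℕ) * e := by
  cases p with
  | zero => exact prob_not_spread_of_postRandom hr h
  | succ p =>
    obtain ⟨X, hX⟩ := h
    exact prob_not_spread_of_shuffled hr hX

theorem prob_bind_rankingPhase_not_spread (hr : Regime m k P s f e)
    {μ : PMF (Config (Fin m × Fin k))} {n : ℕ}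
    (h : μ.toOuterMeasure {c | ¬ Ready P s F p c} ≤ (n * ((m * k) * (m * k)) : ℕ) * e) :
    (μ.bind (rankingPhase (cliquePath m k) P ρ F)).toOuterMeasure
      {c | ¬ ∃ X Y, Spread P s F (p + 1) X Y c} ≤ ((n + 1) * ((m * k) * (m * k)) : ℕ) * e := by
  refine (prob_bind_le _ _ _ _ _ fun c _ ready =>
    prob_not_spread_of_ready hr (not_not.1 ready)).trans ((add_le_add_left h _).trans_eq ?_)
  push_cast
  ring

theorem prob_not_ready (hr : Regime m k P s f e) (hF : FewFailures f F) (p : ℕ) :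
    (beforeRanking (cliquePath m k) P ρ F p).toOuterMeasure {c | ¬ Ready P s F p c} ≤
      ((2 * p + 2) * ((m * k) * (m * k)) : ℕ) * e := by
  induction p with
  | zero => exact prob_not_postRandom hr hF
  | succ p ih =>
    refine (prob_bind_le _ _ _ _ (((m * k) * (m * k) : ℕ) * e) fun c _ spread => ?_).trans
      ((add_le_add_left (prob_bind_rankingPhase_not_spread hr ih) _).trans_eq ?_)
    · obtain ⟨X, Y, hXY⟩ := not_not.1 spread
      exact (prob_mono _ fun c' _ => mt fun shuffled => ⟨X, shuffled⟩).trans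
        (prob_not_shuffled hr hF p.succ_pos hXY)
    · push_cast
      ring

theorem prob_not_spread (hr : Regime m k P s f e) (hF : FewFailures f F) (p : ℕ) :
    ((beforeRanking (cliquePath m k) P ρ F p).bind
      (rankingPhase (cliquePath m k) P ρ F)).toOuterMeasure
      {c | ¬ ∃ X Y, Spread P s F (p + 1) X Y c} ≤ ((2 * p + 3) * ((m * k) * (m * k)) : ℕ) * e :=
  prob_bind_rankingPhase_not_spread hr (prob_not_ready hr hF p)

end Phases

section Execution

variable {m k : ℕ} {N : ℕ} {F : Schedule (Fin m × Fin k) N} {P : Params} {s f : ℕ} {e : ℝ≥0∞}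
  {X Y : Finset (Fin m × Fin k)} {c : Config (Fin m × Fin k)}

theorem Spread.complete (h : Spread P s F m X Y c) (hs : P.T + 1 ≤ s) (hT : 3 < P.T) :
    SpreadComplete F c := by
  classical
  intro u v hu hv
  have sep_le : sep u.1 v.1 ≤ m := by
    simp only [sep, Nat.dist]
    omega
  have le_cnt := h.sound.le_cnt hu hs (h.known u.1 v hv sep_le)
  by_cases hvu : v = u
  · rw [hvu]
    exact h.sound.self u
  rw [h.sound.cnt u hu v, if_neg hvu, zero_add] at le_cnt
  have card_pos : (0 : ℝ) < (Finset.univ.filter fun w => (cliquePath m k).Adj u w ∧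
      v ∈ (c.st w).S).card := by linarith
  obtain ⟨w, hw⟩ := Finset.card_pos.1 (Nat.cast_pos.1 card_pos)
  obtain ⟨-, adj, sent⟩ := Finset.mem_filter.1 hw
  exact h.sound.known u hu w adj sent

theorem prob_not_fewFailures (q : unitInterval) (θ : ℝ≥0∞) (hθ : N * ENNReal.ofReal q ≤ θ)
    (he : (2 ^ (f + 1))⁻¹ * (1 + θ) ^ k ≤ e) :
    (failures (Fin m × Fin k) q N).toOuterMeasure {F | ¬ FewFailures f F} ≤ m * e := by
  classical
  have many_failures (i : Fin m) := (prob_many_failures q N θ hθ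
    ({i} ×ˢ (Finset.univ : Finset (Fin k))) (f + 1)).trans (by simpa using he)
  refine (prob_mono _ fun F _ hF => ?_).trans
    ((prob_exists_le _ _ e many_failures).trans_eq (by rw [Fintype.card_fin]))
  obtain ⟨i, many⟩ := not_forall.1 hF
  refine ⟨i, {i} ×ˢ Finset.univ.filter fun a : Fin k => ¬ Surv F (i, a), ?_, ?_⟩
  · rw [Finset.card_product, Finset.card_singleton, one_mul]
    convert Nat.succ_le_of_lt (not_le.1 many)
  · rintro ⟨i', a⟩ ha
    obtain ⟨hi, failed⟩ := Finset.mem_product.1 ha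
    obtain rfl : i' = i := Finset.mem_singleton.1 hi
    refine ⟨Finset.mem_product.2 ⟨Finset.mem_singleton_self _, Finset.mem_univ a⟩, ?_⟩
    simpa only [Surv, not_forall, Bool.not_eq_false] using (Finset.mem_filter.1 failed).2

theorem prob_not_spreadComplete (hr : Regime m k P s f e) (hm : 0 < m)
    (ρ : Rules (Fin m × Fin k)) (q : unitInterval) (θ : ℝ≥0∞)
    (hθ : endTime P m * ENNReal.ofReal q ≤ θ) (he : (2 ^ (f + 1))⁻¹ * (1 + θ) ^ k ≤ e) :
    (faultyExecution (cliquePath m k) P ρ q m).toOuterMeasure {x | SpreadComplete x.1 x.2}ᶜ ≤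
      (m + (2 * m + 1) * ((m * k) * (m * k)) : ℕ) * e := by
  rw [faultyExecution]
  refine (prob_bind_le _ _ {F | ¬ FewFailures f F} _
    (((2 * m + 1) * ((m * k) * (m * k)) : ℕ) * e) fun F _ hF => ?_).trans
      ((add_le_add_left (prob_not_fewFailures q θ hθ he) _).trans_eq ?_)
  · rw [PMF.toOuterMeasure_map_apply]
    obtain ⟨p, rfl⟩ := Nat.exists_eq_succ_of_ne_zero hm.ne'
    refine (prob_mono _ fun c _ => mt ?_).trans (prob_not_spread hr (not_not.1 hF) p)
    exact fun ⟨X, Y, spread⟩ => spread.complete hr.thr hr.T_gt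
  · push_cast
    ring

end Execution

/-! ### The choice of the parameters -/

theorem one_sub_le_ofReal_exp {x : ℝ} {a : ℝ≥0∞} (hx : 0 ≤ x) (h : ENNReal.ofReal x ≤ a) :
    1 - a ≤ ENNReal.ofReal (Real.exp (-x)) := by
  refine (tsub_le_tsub_left h 1).trans ?_
  rw [← ENNReal.ofReal_one, ← ENNReal.ofReal_sub _ hx]
  exact ENNReal.ofReal_le_ofReal (by linarith [Real.add_one_le_exp (-x)])

theorem half_add_half_mul_le {y : ℝ} {θ : ℝ≥0∞}
    (h : θ ≤ ENNReal.ofReal (1 - y)) (hy1 : y ≤ 1) :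
    2⁻¹ + 2⁻¹ * θ ≤ ENNReal.ofReal (Real.exp (-(y / 2))) := by
  have inv_two_eq : (2⁻¹ : ℝ≥0∞) = ENNReal.ofReal (1 / 2) := by
    rw [one_div, ENNReal.ofReal_inv_of_pos (by norm_num)]
    simp
  calc 2⁻¹ + 2⁻¹ * θ
      ≤ ENNReal.ofReal (1 / 2) + ENNReal.ofReal (1 / 2) * ENNReal.ofReal (1 - y) := by
        rw [inv_two_eq]
        gcongr
    _ = ENNReal.ofReal (1 / 2 + 1 / 2 * (1 - y)) := by
        rw [← ENNReal.ofReal_mul (by norm_num), ← ENNReal.ofReal_add (by norm_num)]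
        exact mul_nonneg (by norm_num) (by linarith)
    _ ≤ _ := ENNReal.ofReal_le_ofReal (by linarith [Real.add_one_le_exp (-(y / 2))])

theorem two_pow_eq_ofReal (s : ℕ) :
    (2 : ℝ≥0∞) ^ s = ENNReal.ofReal (Real.exp (s * Real.log 2)) := by
  rw [mul_comm, Real.exp_mul, Real.exp_log (by norm_num), Real.rpow_natCast,
    ENNReal.ofReal_pow (by norm_num)]
  simp

theorem two_pow_mul_pow_le {s K : ℕ} {b : ℝ≥0∞} {x E : ℝ} (hb : b ≤ ENNReal.ofReal (Real.exp (-x)))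
    (h : Real.exp (s * Real.log 2 - K * x) ≤ E) : 2 ^ s * b ^ K ≤ ENNReal.ofReal E := by
  calc 2 ^ s * b ^ K ≤ ENNReal.ofReal (Real.exp (s * Real.log 2)) *
        ENNReal.ofReal (Real.exp (-x)) ^ K := by
        rw [two_pow_eq_ofReal]
        gcongr
    _ = ENNReal.ofReal (Real.exp (s * Real.log 2 - K * x)) := by
        rw [← ENNReal.ofReal_pow (Real.exp_pos _).le, ← ENNReal.ofReal_mul (Real.exp_pos _).le,
          ← Real.exp_nat_mul, ← Real.exp_add]
        ring_nf
    _ ≤ _ := ENNReal.ofReal_le_ofReal h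

theorem inv_two_pow_mul_pow_le {s K : ℕ} {b : ℝ≥0∞} {x E : ℝ} (hx : 0 ≤ x)
    (hb : b ≤ ENNReal.ofReal x)
    (h : Real.exp (K * x - s * Real.log 2) ≤ E) : (2 ^ s)⁻¹ * (1 + b) ^ K ≤ ENNReal.ofReal E := by
  calc (2 ^ s)⁻¹ * (1 + b) ^ K ≤ ENNReal.ofReal (Real.exp (-(s * Real.log 2))) *
        ENNReal.ofReal (Real.exp x) ^ K := by
        rw [two_pow_eq_ofReal, ← ENNReal.ofReal_inv_of_pos (Real.exp_pos _), ← Real.exp_neg]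
        gcongr
        rw [← ENNReal.ofReal_one]
        refine (add_le_add_right hb _).trans ?_
        rw [← ENNReal.ofReal_add zero_le_one hx]
        exact ENNReal.ofReal_le_ofReal (by linarith [Real.add_one_le_exp x])
    _ = ENNReal.ofReal (Real.exp (K * x - s * Real.log 2)) := by
        rw [← ENNReal.ofReal_pow (Real.exp_pos _).le, ← ENNReal.ofReal_mul (Real.exp_pos _).le,
          ← Real.exp_nat_mul, ← Real.exp_add]
        ring_nf
    _ ≤ _ := ENNReal.ofReal_le_ofReal h

theorem harmonicSum_le (n : ℕ) : harmonicSum n ≤ ENNReal.ofReal (1 + Real.log n) := by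
  have harmonicSum_eq : harmonicSum n = ENNReal.ofReal (harmonic n : ℝ) := by
    rw [harmonicSum, harmonic]
    push_cast
    rw [ENNReal.ofReal_sum_of_nonneg fun i _ => by positivity]
    refine Finset.sum_congr rfl fun i _ => ?_
    rw [ENNReal.ofReal_inv_of_pos (by positivity), ENNReal.ofReal_add (by positivity) zero_le_one]
    simp
  rw [harmonicSum_eq]
  exact ENNReal.ofReal_le_ofReal (harmonic_le_one_add_log n)

theorem natCast_div_eq_ofReal (a : ℕ) {b : ℕ} (hb : 0 < b) :
    (a : ℝ≥0∞) / b = ENNReal.ofReal ((a : ℝ) / b) := by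
  rw [ENNReal.ofReal_div_of_pos (by exact_mod_cast hb)]
  simp

theorem natCast_half_add_two_mul_log_two_le (t : ℕ) :
    ((t / 2 + 2 : ℕ) : ℝ) * Real.log 2 ≤ 347 / 1000 * t + 2 * Real.log 2 := by
  have half_le : ((t / 2 : ℕ) : ℝ) ≤ t / 2 := Nat.cast_div_le
  push_cast
  nlinarith [Real.log_two_lt_d9, Real.log_two_gt_d9]

theorem exp_le_four_mul_exp {x y : ℝ} (h : x ≤ y + 2 * Real.log 2) :
    Real.exp x ≤ 4 * Real.exp y := by
  calc Real.exp x ≤ Real.exp (y + 2 * Real.log 2) := Real.exp_le_exp.2 h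
    _ = 4 * Real.exp y := by
      rw [Real.exp_add, mul_comm 2, Real.exp_mul, Real.exp_log two_pos]
      norm_num [mul_comm]

theorem exp_neg_le_one_sub {x : ℝ} (hx0 : 0 ≤ x) (hx1 : x ≤ 1 / 100) :
    Real.exp (-x) ≤ 1 - 99 / 100 * x := by
  rw [Real.exp_neg, inv_le_comm₀ (Real.exp_pos _) (by linarith)]
  refine le_trans ?_ (Real.add_one_le_exp x)
  rw [inv_le_iff_one_le_mul₀ (by linarith)]
  nlinarith

theorem one_sub_inv_mul_inv_harmonicSum_pow_le {t n : ℕ} (ht : 0 < t) (hn : 1 ≤ Real.log n)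
    (r : ℕ) :
    (1 - ((8 * t : ℕ) : ℝ≥0∞)⁻¹ * (harmonicSum n)⁻¹) ^ r ≤
      ENNReal.ofReal (Real.exp (-(r / (16 * t * Real.log n)))) := by
  have rate_le : ENNReal.ofReal (1 / (16 * t * Real.log n)) ≤
      ((8 * t : ℕ) : ℝ≥0∞)⁻¹ * (harmonicSum n)⁻¹ := by
    rw [← ENNReal.mul_inv (Or.inl (by exact_mod_cast (by lia : 8 * t ≠ 0)))
      (Or.inl (ENNReal.natCast_ne_top _)), one_div, ENNReal.ofReal_inv_of_pos (by positivity)]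
    refine ENNReal.inv_le_inv.2 ((mul_le_mul_right (harmonicSum_le _) _).trans ?_)
    rw [← ENNReal.ofReal_natCast, ← ENNReal.ofReal_mul (by positivity)]
    refine ENNReal.ofReal_le_ofReal ?_
    push_cast
    nlinarith
  refine (pow_le_pow_left' (one_sub_le_ofReal_exp (by positivity) rate_le) r).trans_eq ?_
  rw [← ENNReal.ofReal_pow (Real.exp_pos _).le, ← Real.exp_nat_mul]
  congr 2
  ring

theorem two_pow_mul_selection_pow_le {t k K : ℕ} (hk0 : 0 < k) (hk : 120 * t ≤ k)
    (hK : k - 3 * (k / 20 + 4 * t) ≤ K) :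
    2 ^ (t / 2 + 2) * (2⁻¹ + 2⁻¹ * (1 - (4 * t : ℕ) / (2 * k : ℕ)) : ℝ≥0∞) ^ K ≤
      ENNReal.ofReal (4 * Real.exp (-(t / 100))) := by
  have hk0' : (0 : ℝ) < k := by exact_mod_cast hk0
  have hkt : 120 * (t : ℝ) ≤ k := by exact_mod_cast hk
  have many_nodes : (3 / 4 : ℝ) * k ≤ K := by
    have : 3 * k ≤ 4 * K := by lia
    have : (3 : ℝ) * k ≤ 4 * K := by exact_mod_cast this
    linarith
  have unselected_le : (1 - (4 * t : ℕ) / (2 * k : ℕ) : ℝ≥0∞) ≤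
      ENNReal.ofReal (1 - 2 * (t / k)) := by
    rw [natCast_div_eq_ofReal _ (by lia), ENNReal.ofReal_sub _ (by positivity),
      ENNReal.ofReal_one]
    refine tsub_le_tsub_left (ENNReal.ofReal_le_ofReal (le_of_eq ?_)) 1
    push_cast
    rw [mul_div_mul_comm, mul_div_assoc', mul_div_assoc']
    ring
  have ratio_le : 2 * ((t : ℝ) / k) ≤ 1 := by
    rw [← mul_div_assoc, div_le_one hk0']
    linarith
  refine two_pow_mul_pow_le (half_add_half_mul_le unselected_le ratio_le)
    (exp_le_four_mul_exp ?_)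
  have gain : (3 / 4 : ℝ) * t ≤ K * (t / k) := by
    calc (3 / 4 : ℝ) * t = (3 / 4 * k) * (t / k) := by field_simp
      _ ≤ K * (t / k) := by gcongr
  rw [mul_div_cancel_left₀ _ two_ne_zero]
  linarith [natCast_half_add_two_mul_log_two_le t, Nat.cast_nonneg (α := ℝ) t]

theorem one_sub_inv_natCast_pow_le {t k : ℕ} (hk : 100 * t ≤ k) :
    (1 - 1⁻¹ * ((k + 1 : ℕ) : ℝ≥0∞)⁻¹) ^ t ≤ ENNReal.ofReal (1 - 99 / 100 * (t / (k + 1))) := by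
  have rate_le : ENNReal.ofReal (1 / (k + 1)) ≤ 1⁻¹ * ((k + 1 : ℕ) : ℝ≥0∞)⁻¹ := by
    rw [inv_one, one_mul, one_div, ENNReal.ofReal_inv_of_pos (by positivity),
      ENNReal.ofReal_add (by positivity) zero_le_one]
    simp
  have ratio_le : (t : ℝ) / (k + 1) ≤ 1 / 100 := by
    have : (100 : ℝ) * t ≤ k := by exact_mod_cast hk
    rw [div_le_iff₀ (by positivity)]
    linarith
  calc (1 - 1⁻¹ * ((k + 1 : ℕ) : ℝ≥0∞)⁻¹) ^ t
      ≤ ENNReal.ofReal (Real.exp (-(1 / (k + 1)))) ^ t :=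
        pow_le_pow_left' (one_sub_le_ofReal_exp (by positivity) rate_le) t
    _ = ENNReal.ofReal (Real.exp (-(t / (k + 1)))) := by
        rw [← ENNReal.ofReal_pow (Real.exp_pos _).le, ← Real.exp_nat_mul]
        congr 2
        ring
    _ ≤ ENNReal.ofReal (1 - 99 / 100 * (t / (k + 1))) :=
        ENNReal.ofReal_le_ofReal (exp_neg_le_one_sub (by positivity) ratio_le)

theorem two_pow_mul_random_pow_le {t k K : ℕ} (ht : 3 ≤ t) (hk : 120 * t ≤ k)
    (hK : k - 5 * (k / 20) - 1 ≤ K) :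
    2 ^ (t / 2 + 2) * (2⁻¹ + 2⁻¹ * (1 - 1⁻¹ * ((k + 1 : ℕ) : ℝ≥0∞)⁻¹) ^ t) ^ K ≤
      ENNReal.ofReal (4 * Real.exp (-(t / 100))) := by
  have many_nodes : (149 / 200 : ℝ) * (k + 1) ≤ K := by
    have : 149 * (k + 1) ≤ 200 * K := by lia
    have : (149 : ℝ) * (k + 1) ≤ 200 * K := by exact_mod_cast this
    linarith
  have ratio_le : (t : ℝ) / (k + 1) ≤ 1 := by
    have : t ≤ k + 1 := by lia
    rw [div_le_one (by positivity)]
    exact_mod_cast this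
  refine two_pow_mul_pow_le (half_add_half_mul_le (one_sub_inv_natCast_pow_le (by lia))
    (by linarith)) (exp_le_four_mul_exp ?_)
  have gain : (149 / 200 : ℝ) * t ≤ K * (t / (k + 1)) := by
    calc (149 / 200 : ℝ) * t = (149 / 200 * (k + 1)) * (t / (k + 1)) := by field_simp
      _ ≤ K * (t / (k + 1)) := by gcongr
  linarith [natCast_half_add_two_mul_log_two_le t, Nat.cast_nonneg (α := ℝ) t]

theorem inv_two_pow_mul_early_pow_le {t k K : ℕ} (ht : 0 < t) (hk : 120 * t ≤ k) (hK : K ≤ k) :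
    (2 ^ (2 * t + 1))⁻¹ * (1 + t * ((k - k / 20 - 1 : ℕ) : ℝ≥0∞)⁻¹) ^ K ≤
      ENNReal.ofReal (4 * Real.exp (-(t / 100))) := by
  have hk0 : (0 : ℝ) < k := by exact_mod_cast (by lia : 0 < k)
  have denom_ge : (9 / 10 : ℝ) * k ≤ (k - k / 20 - 1 : ℕ) := by
    have : 9 * k ≤ 10 * (k - k / 20 - 1) := by lia
    have : (9 : ℝ) * k ≤ 10 * (k - k / 20 - 1 : ℕ) := by exact_mod_cast this
    linarith
  have rate_le : (t * ((k - k / 20 - 1 : ℕ) : ℝ≥0∞)⁻¹) ≤ ENNReal.ofReal (t / (9 / 10 * k)) := by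
    rw [← div_eq_mul_inv, natCast_div_eq_ofReal _ (by lia)]
    exact ENNReal.ofReal_le_ofReal (by gcongr)
  refine inv_two_pow_mul_pow_le (by positivity) rate_le (exp_le_four_mul_exp ?_)
  have cost : (K : ℝ) * (t / (9 / 10 * k)) ≤ 10 / 9 * t := by
    calc (K : ℝ) * (t / (9 / 10 * k)) ≤ k * (t / (9 / 10 * k)) := by gcongr
      _ = 10 / 9 * t := by field_simp
  push_cast
  nlinarith [Real.log_two_gt_d9, Nat.cast_nonneg (α := ℝ) t]

theorem regime_of_bounds {m k : ℕ} {P : Params} {E : ℝ} (hk : 120 * P.tau ≤ k)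
    (hcτ : 8 < P.cHat * P.tau) (hc : P.cHat ≤ 1 / 2) (hlog : 1 ≤ Real.log (m * k : ℕ))
    (hE : 4 * Real.exp (-(P.tau / 100)) ≤ E)
    (hE' : Real.exp (-(P.tau' / (16 * P.tau * Real.log (m * k : ℕ)))) ≤ E) :
    Regime m k P (P.tau / 2 + 2) (k / 20) (ENNReal.ofReal E) := by
  have tau_gt' : (16 : ℝ) < P.tau := by nlinarith [Nat.cast_nonneg (α := ℝ) P.tau]
  have tau_gt : 16 < P.tau := by exact_mod_cast tau_gt'
  have threshold_le : (P.tau : ℝ) + 2 ≤ 2 * (P.tau / 2 + 2 : ℕ) := by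
    exact_mod_cast (by lia : P.tau + 2 ≤ 2 * (P.tau / 2 + 2))
  have hE_ofReal := ENNReal.ofReal_le_ofReal hE
  exact
    { k_pos := by lia
      thr := by rw [Params.T]; linarith
      T_gt := by rw [Params.T]; linarith
      tau_ge := by lia
      cHat_le := by linarith
      cHat_mul := by rw [Params.T]; linarith
      ranking := (one_sub_inv_mul_inv_harmonicSum_pow_le (by lia) hlog P.tau').trans
        (ENNReal.ofReal_le_ofReal hE')
      selection := fun _ hK => (two_pow_mul_selection_pow_le (by lia) hk hK).trans hE_ofReal
      random := fun _ hK => (two_pow_mul_random_pow_le (by lia) hk hK).trans hE_ofReal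
      early := fun _ hK => (inv_two_pow_mul_early_pow_le (by lia) hk hK).trans hE_ofReal }

theorem inv_two_pow_mul_few_failures_pow_le {k : ℕ} {E : ℝ}
    (hE : Real.exp (-(3 / 1000 * k)) ≤ E) :
    (2 ^ (k / 20 + 1))⁻¹ * (1 + ENNReal.ofReal (1 / 32)) ^ k ≤ ENNReal.ofReal E := by
  refine inv_two_pow_mul_pow_le (by norm_num) le_rfl (le_trans (Real.exp_le_exp.2 ?_) hE)
  have exponent_ge : (k : ℝ) / 20 ≤ (k / 20 + 1 : ℕ) := by
    have : (k : ℝ) ≤ 20 * (k / 20 + 1 : ℕ) := by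
      exact_mod_cast (by lia : k ≤ 20 * (k / 20 + 1))
    linarith
  nlinarith [Real.log_two_gt_d9, Nat.cast_nonneg (α := ℝ) k]

/-! ### Asymptotics of the parameters -/

theorem log_le_logb_two {x : ℝ} (hx : 0 ≤ Real.log x) : Real.log x ≤ Real.logb 2 x := by
  rw [Real.logb, le_div_iff₀ (by linarith [Real.log_two_gt_d9])]
  nlinarith [Real.log_two_lt_d9]

theorem logb_two_le_two_mul_log {x : ℝ} (hx : 0 ≤ Real.log x) :
    Real.logb 2 x ≤ 2 * Real.log x := by
  rw [Real.logb, div_le_iff₀ (by linarith [Real.log_two_gt_d9])]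
  nlinarith [Real.log_two_gt_d9]

section

variable {α d : ℝ} (cHat : ℝ) {n : ℕ}

theorem params_tau_ge (d) (hα : 0 ≤ α) (hn : 0 ≤ Real.log n) :
    α * Real.log n ≤ (params α d cHat n).tau :=
  (mul_le_mul_of_nonneg_left (log_le_logb_two hn) hα).trans (Nat.le_ceil _)

theorem params_tau_le (d) (hα : 1 ≤ α) (hn : 1 ≤ Real.log n) :
    ((params α d cHat n).tau : ℝ) ≤ 3 * α * Real.log n := by
  have logb_le := logb_two_le_two_mul_log (zero_le_one.trans hn)
  have le_logb := log_le_logb_two (zero_le_one.trans hn)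
  refine (Nat.ceil_lt_add_one (by nlinarith)).le.trans ?_
  nlinarith

theorem params_tau'_ge (α) (hd : 0 ≤ d) (hn : 0 ≤ Real.log n) :
    8 * d * (params α d cHat n).tau * Real.log n ^ 2 ≤ (params α d cHat n).tau' := by
  refine le_trans ?_ (Nat.le_ceil _)
  change 8 * d * (params α d cHat n).tau * Real.log n ^ 2 ≤
    8 * d * (params α d cHat n).tau * Real.logb 2 n ^ 2
  gcongr
  exact log_le_logb_two hn

theorem params_tau'_le (hα : 1 ≤ α) (hd : 0 ≤ d) (hn : 1 ≤ Real.log n) :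
    ((params α d cHat n).tau' : ℝ) ≤ 96 * α * d * Real.log n ^ 3 + 1 := by
  have hn0 := zero_le_one.trans hn
  have logb_nonneg : 0 ≤ Real.logb 2 n := hn0.trans (log_le_logb_two hn0)
  have unrounded_le : 8 * d * (params α d cHat n).tau * Real.logb 2 n ^ 2 ≤
      96 * α * d * Real.log n ^ 3 := calc
    8 * d * (params α d cHat n).tau * Real.logb 2 n ^ 2
      ≤ 8 * d * (3 * α * Real.log n) * (2 * Real.log n) ^ 2 := by
        gcongr
        · exact params_tau_le cHat d hα hn
        · exact logb_two_le_two_mul_log hn0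
    _ = 96 * α * d * Real.log n ^ 3 := by ring
  exact (Nat.ceil_lt_add_one (by positivity)).le.trans (by linarith!)

theorem endTime_le_mul (P : Params) {m : ℕ} (hm : 0 < m) :
    endTime P m ≤ m * (1 + 9 * P.tau + P.tau') := by
  obtain ⟨m, rfl⟩ : ∃ m', m = m' + 1 := ⟨m - 1, by lia⟩
  rw [endTime, Nat.add_sub_cancel]
  nlinarith [Nat.zero_le (m * P.tau)]

theorem endTime_params_le (hα : 1 ≤ α) (hd : 0 ≤ d) {m : ℕ} (hm : 0 < m)
    (hn : 1 ≤ Real.log n) :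
    (endTime (params α d cHat n) m : ℝ) ≤
      (2 + 27 * α + 96 * α * d) * (m * Real.log n ^ 3) := by
  have tau_le : ((params α d cHat n).tau : ℝ) ≤ 3 * α * Real.log n ^ 3 :=
    (params_tau_le cHat d hα hn).trans (by gcongr; exact le_self_pow₀ hn (by norm_num))
  have tau'_le := params_tau'_le cHat hα hd hn
  have one_le : (1 : ℝ) ≤ Real.log n ^ 3 := one_le_pow₀ hn
  calc (endTime (params α d cHat n) m : ℝ)
      ≤ m * (1 + 9 * (params α d cHat n).tau + (params α d cHat n).tau') := by
        exact_mod_cast endTime_le_mul (params α d cHat n) hm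
    _ ≤ m * ((2 + 27 * α + 96 * α * d) * Real.log n ^ 3) := by
        gcongr
        linarith
    _ = (2 + 27 * α + 96 * α * d) * (m * Real.log n ^ 3) := by ring

end

theorem endTime_params_div_le {α d : ℝ} (cHat : ℝ) {n k : ℕ} (hα : 1 ≤ α) (hd : 0 ≤ d)
    (hn : 1 ≤ Real.log n) (hk : 0 < k) (hkn : k ∣ n) :
    (endTime (params α d cHat n) (n / k) : ℝ) ≤
      (2 + 27 * α + 96 * α * d) * (n * Real.log n ^ 3 / k) := by
  have hn0 : 0 < n := Nat.pos_of_ne_zero fun h => by norm_num [h] at hn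
  refine (endTime_params_le cHat hα hd (Nat.div_pos (Nat.le_of_dvd hn0 hkn) hk) hn).trans_eq ?_
  rw [Nat.cast_div hkn (by exact_mod_cast hk.ne'), div_mul_eq_mul_div]

theorem endTime_mul_ofReal_le (P : Params) (m : ℕ) {q : ℝ} (hq : q ≤ 1 / (32 * endTime P m)) :
    endTime P m * ENNReal.ofReal q ≤ ENNReal.ofReal (1 / 32) := by
  have endTime_pos : (0 : ℝ) < endTime P m := by
    exact_mod_cast (by rw [endTime]; lia : 0 < endTime P m)
  rw [← ENNReal.ofReal_natCast, ← ENNReal.ofReal_mul (Nat.cast_nonneg _)]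
  refine ENNReal.ofReal_le_ofReal ?_
  rw [le_div_iff₀ (by positivity)] at hq
  linarith

theorem exp_neg_le_rpow_neg {x y b : ℝ} (hx : 0 < x) (h : b * Real.log x ≤ y) :
    Real.exp (-y) ≤ x ^ (-b) := by
  rw [Real.rpow_def_of_pos hx]
  exact Real.exp_le_exp.2 (by linarith)

theorem regime_params {α d cHat b : ℝ} {m k : ℕ} (hb : 0 ≤ b)
    (hα : 100 * (b + 1) ≤ α) (hd : 2 * b ≤ d) (hc : cHat ≤ 1 / 2) (hn : 4 ≤ m * k)
    (hlog : 1 ≤ Real.log (m * k : ℕ)) (hcα : 8 < cHat * (α * Real.log (m * k : ℕ)))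
    (hk : 360 * α * Real.log (m * k : ℕ) ≤ k) :
    Regime m k (params α d cHat (m * k)) ((params α d cHat (m * k)).tau / 2 + 2) (k / 20)
      (ENNReal.ofReal (((m * k : ℕ) : ℝ) ^ (-b))) := by
  set n := m * k
  have hn0 : (0 : ℝ) < n := by exact_mod_cast (by lia : 0 < n)
  have hα1 : 1 ≤ α := by linarith
  have hc0 : 0 < cHat := pos_of_mul_pos_left ((by norm_num : (0 : ℝ) < 8).trans hcα) (by positivity)
  have tau_ge := params_tau_ge cHat d (by linarith : 0 ≤ α) (zero_le_one.trans hlog)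
  have tau_pos : (0 : ℝ) < (params α d cHat n).tau := by nlinarith
  refine regime_of_bounds ?_ (hcα.trans_le (mul_le_mul_of_nonneg_left tau_ge hc0.le)) hc hlog ?_ ?_
  · have : (120 : ℝ) * (params α d cHat n).tau ≤ k := by
      linarith [params_tau_le cHat d hα1 hlog]
    exact_mod_cast this
  · have four_le : (4 : ℝ) ≤ Real.exp (Real.log n) := by
      rw [Real.exp_log hn0]
      exact_mod_cast hn
    calc 4 * Real.exp (-((params α d cHat n).tau / 100))
        ≤ Real.exp (Real.log n) * Real.exp (-((params α d cHat n).tau / 100)) := by gcongr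
      _ = Real.exp (-((params α d cHat n).tau / 100 - Real.log n)) := by
          rw [← Real.exp_add]
          ring_nf
      _ ≤ (n : ℝ) ^ (-b) := exp_neg_le_rpow_neg hn0 (by nlinarith)
  · refine exp_neg_le_rpow_neg hn0 ?_
    rw [le_div_iff₀ (by positivity)]
    calc b * Real.log n * (16 * (params α d cHat n).tau * Real.log n)
        = 8 * (2 * b) * (params α d cHat n).tau * Real.log n ^ 2 := by ring
      _ ≤ 8 * d * (params α d cHat n).tau * Real.log n ^ 2 := by gcongr
      _ ≤ (params α d cHat n).tau' := params_tau'_ge cHat α (by linarith) (by linarith)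

theorem union_bound_count_le {m n : ℕ} (hmn : m ≤ n) (hn : 4 ≤ n) :
    m + (2 * m + 1) * (n * n) ≤ n ^ 5 := by
  calc m + (2 * m + 1) * (n * n) ≤ n + (2 * n + 1) * (n * n) := by gcongr
    _ ≤ 4 * 4 * n ^ 3 := by nlinarith [Nat.zero_le (n ^ 2)]
    _ ≤ n * n * n ^ 3 := by gcongr
    _ = n ^ 5 := by ring

theorem natCast_mul_ofReal_rpow_le {N n : ℕ} (hn : 0 < n) (j : ℕ) (c : ℝ) (hN : N ≤ n ^ j) :
    N * ENNReal.ofReal ((n : ℝ) ^ (-(c + j))) ≤ ENNReal.ofReal ((n : ℝ) ^ (-c)) := by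
  have hn0 : (0 : ℝ) < n := by exact_mod_cast hn
  rw [← ENNReal.ofReal_natCast, ← ENNReal.ofReal_mul (Nat.cast_nonneg _)]
  refine ENNReal.ofReal_le_ofReal ?_
  calc (N : ℝ) * (n : ℝ) ^ (-(c + j)) ≤ (n : ℝ) ^ j * (n : ℝ) ^ (-(c + j)) := by
        gcongr
        exact_mod_cast hN
    _ = (n : ℝ) ^ (-c) := by
        rw [← Real.rpow_natCast, ← Real.rpow_add hn0]
        congr 1
        ring

theorem one_sub_rpow_le_prob_spreadComplete {α d cHat c : ℝ} {n m k : ℕ} (hc : 0 ≤ c)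
    (hα : 100 * (c + 6) ≤ α) (hd : 2 * (c + 5) ≤ d) (hc1 : cHat ≤ 1 / 2) (hn : 4 ≤ n)
    (hlog : 1 ≤ Real.log n) (hmk : m * k = n) (hcα : 8 < cHat * (α * Real.log n))
    (hk : (360 * α + 1000 * (c + 5)) * Real.log n ≤ k) (q : unitInterval)
    (hq : (q : ℝ) ≤ 1 / (32 * endTime (params α d cHat n) m)) (ρ : Rules (Fin m × Fin k)) :
    ENNReal.ofReal (1 - (n : ℝ) ^ (-c)) ≤
      (faultyExecution (cliquePath m k) (params α d cHat n) ρ q m).toOuterMeasure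
        {x | SpreadComplete x.1 x.2} := by
  subst hmk
  have hm0 : 0 < m := by
    by_contra! h
    simp [Nat.le_zero.1 h] at hn
  have hn0 : (0 : ℝ) < (m * k : ℕ) := by exact_mod_cast (by lia : 0 < m * k)
  have regime := regime_params (by linarith) (by linarith) hd hc1 hn hlog hcα (by nlinarith)
  have few_failures := inv_two_pow_mul_few_failures_pow_le (k := k)
    (exp_neg_le_rpow_neg (b := c + 5) hn0 (y := 3 / 1000 * k) (by nlinarith))
  refine one_sub_le_prob_of_compl_le _ _ (by positivity)
    ((prob_not_spreadComplete regime hm0 ρ q _ (endTime_mul_ofReal_le _ m hq) few_failures).trans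
      ?_)
  exact natCast_mul_ofReal_rpow_le (by lia) 5 c
    (union_bound_count_le (Nat.le_mul_of_pos_right m regime.k_pos) hn)

theorem eventually_mul_log_le {k : ℕ → ℕ}
    (hk : Tendsto (fun n : ℕ => (k n : ℝ) / Real.log n ^ 3) atTop atTop) (a : ℝ) :
    ∀ᶠ n : ℕ in atTop, a * Real.log n ≤ k n := by
  filter_upwards [hk.eventually_ge_atTop (max a 0),
    (Real.tendsto_log_atTop.comp tendsto_natCast_atTop_atTop).eventually_ge_atTop 1]
    with n hkn hlog
  have one_le_log : 1 ≤ Real.log n := hlog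
  rw [le_div_iff₀ (by positivity)] at hkn
  calc a * Real.log n ≤ max a 0 * Real.log n ^ 3 := by
        gcongr
        · exact le_max_left a 0
        · exact le_self_pow₀ one_le_log (by norm_num)
    _ ≤ k n := hkn

end VertexCongest

theorem mainTheorem1 (c : ℝ) (hc : 1 ≤ c) :
    ∃ α₀ d₀ : ℝ, ∀ α d cHat : ℝ, α₀ ≤ α → d₀ ≤ d → 0 < cHat → cHat ≤ 1 / 2 →
      ∃ C : ℝ, 0 < C ∧
        ∀ k : ℕ → ℕ, Tendsto (fun n : ℕ => (k n : ℝ) / Real.log n ^ 3) atTop atTop →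
          ∀ᶠ n : ℕ in atTop, k n ∣ n →
            (VertexCongest.endTime (VertexCongest.params α d cHat n) (n / k n) : ℝ)
                ≤ C * ((n : ℝ) * Real.log n ^ 3 / (k n : ℝ)) ∧
            ∀ q : unitInterval,
              (q : ℝ) ≤ 1 / (32 *
                (VertexCongest.endTime (VertexCongest.params α d cHat n) (n / k n) : ℝ)) →
              ∀ ρ : VertexCongest.Rules (Fin (n / k n) × Fin (k n)),
                ENNReal.ofReal (1 - (n : ℝ) ^ (-c)) ≤
                  (VertexCongest.faultyExecution
                    (VertexCongest.cliquePath (n / k n) (k n))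
                    (VertexCongest.params α d cHat n) ρ q (n / k n)).toOuterMeasure
                    {x | VertexCongest.SpreadComplete x.1 x.2} := by
  open VertexCongest in
  refine ⟨100 * (c + 6), 2 * (c + 5), fun α d cHat hα hd hc0 hc1 =>
    ⟨2 + 27 * α + 96 * α * d, ?_, fun k hk => ?_⟩⟩
  all_goals
    have hα0 : 0 < α := by linarith
    have hd0 : 0 < d := by linarith
  · positivity
  have log_tendsto : Tendsto (fun n : ℕ => Real.log n) atTop atTop :=
    Real.tendsto_log_atTop.comp tendsto_natCast_atTop_atTop
  filter_upwards [log_tendsto.eventually_ge_atTop 1, eventually_ge_atTop 4,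
    ((log_tendsto.const_mul_atTop hα0).const_mul_atTop hc0).eventually_gt_atTop 8,
    eventually_mul_log_le hk (360 * α + 1000 * (c + 5))] with n hlog hn hcα hkn hdvd
  have hk0 : 0 < k n := Nat.pos_of_dvd_of_pos hdvd (by lia)
  refine ⟨endTime_params_div_le cHat (by linarith) hd0.le hlog hk0 hdvd, fun q hq ρ => ?_⟩
  exact one_sub_rpow_le_prob_spreadComplete (by linarith) hα hd hc1 hn hlog
    (Nat.div_mul_cancel hdvd) hcα hkn q hq ρ
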